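/- **Setting.** Consider the following process calculus (the fragment of CQP, Communicating Quantum Processes, used below). A *pure configuration* $(\sigma;\omega;P)$ consists of a quantum state $\sigma=[\vec q\mapsto|\psi\rangle]$ of a list $\vec q$ of named qubits, the qubits $\omega\subseteq\vec q$ owned by the process, and a process term $P$; the qubits in $\vec q\setminus\omega$ form the environment. A *mixed configuration* $\bigoplus_i g_i(\sigma_i;\omega;\lambda\vec x.P;\vec v_i)$ is a finite weighted mixture (weights $g_i$ of sum $1$) of configurations with the same qubit list, the same $\omega$ and the same term up to the measurement outcomes $\vec v_i$. $\boxplus_j p_j s_j$ is a probability distribution over such configurations. Terms are: $\mathbf 0$; parallel composition $P\parallel Q$; restriction $(\mathsf{new}\ c)P$; $(\mathsf{qbit}\ \vec y)P$ (allocate fresh qubits, each in state $|0\rangle$, owned by the process); actions $\{\vec e\mathrel{*{=}}U\}.P$ (apply a gate) and $\{\mathsf{measure}\ e\}.P$; typed input $c?[\vec x:\vec T].P$; and output $c![\vec e].P$, whose arguments may be measurements $\mathsf{measure}\ x$, which are performed before the output takes place. Allocations, gates, measurements and internal communications are $\tau$ transitions; a measurement splits each component $i$ into one component for every outcome of nonzero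 probability, with the weights multiplied by the outcome probabilities. An input $c?[\vec v]$ from outside takes classical data and distinct environment qubits, which become owned. An output $c![V,\vec q]$ returns the owned qubits $\vec q$ to the environment and reveals the classical part of the message, $V=\{\vec v_1,\dots,\vec v_m\}$ being the set of its possible values: it leads to $\boxplus_{j} p_j s_j$, where $p_j$ is the probability of $\vec v_j$ and $s_j$ is the mixture conditioned on $\vec v_j$ (if $m=1$ it leads to $s_1$). For $m>1$, $\boxplus_j p_js_j\rightsquigarrow_{p_j}s_j$ are probabilistic transitions; $\mathcal S_p$ is the set of configurations that have probabilistic transitions and $\mathcal S_n$ is its complement. Put $\mu(s,D)=\sum_{j:\,s_j\in D}p_j$ for $s=\boxplus_j p_js_j\in\mathcal S_p$, and for $s\in\mathcal S_n$ let $\mu(s,D)$ be $1$ if $s\in D$ and $0$ otherwise. $\rho^{\vec r}(s)$ denotes the reduced density matrix of the list $\vec r$ of qubits (weighted over the components of $s$), and $\rho_E(s)$ that of the list of environment qubits, in the order of the qubit list. Write $\Longrightarrow$ for zero or more $\tau$ transitions. An equivalence relation $\mathcal R$ on configurations is a *probabilistic branching bisimulation* if $(s,t)\in\mathcal R$ implies: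 1. if $s\in\mathcal S_n$ and $s\xrightarrow{\tau}s'$, then $t\Longrightarrow t'$ and ($t''=t'$ or $t'\xrightarrow{\tau}t''$) for some $t',t''$ with $(s,t'),(s',t'')\in\mathcal R$; 2. if $s\xrightarrow{c![V,\vec q_1]}s'=\boxplus_{j}p_js'_j$, then $t\Longrightarrow t'\xrightarrow{c![V,\vec q_2]}\boxplus_{j}p_jt''_j$ for some $t',\vec q_2,t''_j$ with $(s,t')\in\mathcal R$, $\rho^{\vec q_1}(s)=\rho^{\vec q_2}(t')$ and, for every $j$, $\rho_E(s'_j)=\rho_E(t''_j)$ and $(s'_j,t''_j)\in\mathcal R$; 3. if $s\xrightarrow{c?[\vec v]}s'$, then $t\Longrightarrow t'\xrightarrow{c?[\vec v]}t''$ for some $t',t''$ with $(s,t'),(s',t'')\in\mathcal R$; 4. if $s\in\mathcal S_p$, then $\mu(s,D)=\mu(t,D)$ for every $\mathcal R$-class $D$. Processes $P,Q$ are *full probabilistic branching bisimilar*, $P\mathrel{\underline{\leftrightarrow}}^c Q$, if for all substitutions $\kappa$ of values (data and channel names) for free variables, all quantum states $\sigma$ and all $\omega\subseteq\sigma$ there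 is a probabilistic branching bisimulation that contains the pair $\big((\sigma;\omega;P\kappa),(\sigma;\omega;Q\kappa)\big)$. **The systems.** With all variables $x,y,z,u,v,s,t$ of type $\mathsf{Qbit}$ and $j,k$ of type $\mathsf{bit}$, and with $F.R$ short for $\{x\mathrel{*{=}}X^{jk}\}.\{y\mathrel{*{=}}X^{j\bar k}\}.\{z\mathrel{*{=}}X^{\bar jk}\}.R$, let - $\mathrm{Alice}(a,b)=(\mathsf{qbit}\ y,z)\,a?[x].\{x,z\mathrel{*{=}}\mathrm{CNot}\}.\{x,y\mathrel{*{=}}\mathrm{CNot}\}.b![x,y,z].\mathbf 0$ - $\mathrm{NoiseRnd}(p)=(\mathsf{qbit}\ u,v)\{u\mathrel{*{=}}H\}.\{v\mathrel{*{=}}H\}.p![\mathsf{measure}\ u,\mathsf{measure}\ v].\mathbf 0$ - $\mathrm{NoiseErr}(b,p,c)=b?[x,y,z].p?[j,k].F.c![x,y,z].\mathbf 0$ - $\mathrm{Noise}(b,c)=(\mathsf{new}\ p)(\mathrm{NoiseRnd}(p)\parallel\mathrm{NoiseErr}(b,p,c))$ - $\mathrm{BobRec}(c,p)=(\mathsf{qbit}\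 s,t)\,c?[x,y,z].\{x,s\mathrel{*{=}}\mathrm{CNot}\}.\{y,s\mathrel{*{=}}\mathrm{CNot}\}.\{x,t\mathrel{*{=}}\mathrm{CNot}\}.\{z,t\mathrel{*{=}}\mathrm{CNot}\}.p![x,y,z,\mathsf{measure}\ s,\mathsf{measure}\ t].\mathbf 0$ - $\mathrm{BobCorr}(p,d)=p?[x,y,z,j,k].F.\{x,y\mathrel{*{=}}\mathrm{CNot}\}.\{x,z\mathrel{*{=}}\mathrm{CNot}\}.d![x].\mathbf 0$ - $\mathrm{Bob}(c,d)=(\mathsf{new}\ p)(\mathrm{BobRec}(c,p)\parallel\mathrm{BobCorr}(p,d))$ - $\mathrm{QECC}(a,d)=(\mathsf{new}\ b,c)(\mathrm{Alice}(a,b)\parallel\mathrm{Noise}(b,c)\parallel\mathrm{Bob}(c,d))$ - $\mathrm{Identity}(a,d)=a?[x].d![x].\mathbf 0$ **Proposition.** For all channels $a,d$: $\ \mathrm{QECC}(a,d)\mathrel{\underline{\leftrightarrow}}^c \mathrm{Identity}(a,d)$. -/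

import Mathlib

namespace CQP

/-! ## Quantum states

Qubit names are natural numbers.  A computational basis vector is labelled by the finite set of
those qubits that are in state `|1⟩`; a ket assigns an amplitude to every basis vector. -/

abbrev Qubit := ℕ
abbrev Ket := Finset Qubit → ℂ

/-- A global quantum state `[q₁,…,qₙ ↦ |ψ⟩]`: a list of distinct qubit names and a unit vector
of the corresponding tensor product (no amplitude on basis vectors that use other qubits). -/
structure QState where
  qubits : List Qubit
  nodup : qubits.Nodup
  ket : Ket
  supported : ∀ B, ¬ B ⊆ qubits.toFinset → ket B = 0
  normalized : ∑ B ∈ qubits.toFinset.powerset, ‖ket B‖ ^ 2 = 1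

/-- `H` on qubit `q`. -/
noncomputable def Ket.had (q : Qubit) (ψ : Ket) : Ket := fun B =>
  (ψ (B.erase q) + (if q ∈ B then -1 else 1) * ψ (insert q B)) / (Real.sqrt 2 : ℂ)

/-- `X` on qubit `q`. -/
def Ket.flip (q : Qubit) (ψ : Ket) : Ket := fun B =>
  if q ∈ B then ψ (B.erase q) else ψ (insert q B)

/-- `CNot` with control `q` and target `r`. -/
def Ket.cnot (q r : Qubit) (ψ : Ket) : Ket := fun B =>
  if q ∈ B then ψ.flip r B else ψ B

/-- Probability that measuring `q` (in the standard basis) in the state `[qs ↦ ψ]` yields `b`. -/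
noncomputable def Ket.born (qs : List Qubit) (ψ : Ket) (q : Qubit) (b : Bool) : ℝ :=
  ∑ B ∈ qs.toFinset.powerset with decide (q ∈ B) = b, ‖ψ B‖ ^ 2

/-- The normalized state after measuring `q` with outcome `b`. -/
noncomputable def Ket.collapse (qs : List Qubit) (ψ : Ket) (q : Qubit) (b : Bool) : Ket := fun B =>
  if decide (q ∈ B) = b then ψ B / (Real.sqrt (ψ.born qs q b) : ℂ) else 0

/-! ## Syntax -/

abbrev Var := ℕ

/-- Data types of messages. -/
inductive Ty
  | bit
  | qbit

/-- Run-time values.  Processes run inside mixed configurations whose components are indexed by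
the vector `w` of measurement outcomes; a classical value may depend on `w`.  This is the
`λ`-abstraction over measurement outcomes in a mixed configuration: the component with index `w`
contains the bit `f w`. -/
inductive Value
  | bit (f : List Bool → Bool)
  | qubit (q : Qubit)

/-- Concrete data: bits and qubit names. -/
inductive Datum
  | bit (b : Bool)
  | qubit (q : Qubit)

def Datum.toValue : Datum → Value
  | .bit b => .bit fun _ => b
  | .qubit q => .qubit q

def Ty.Accepts : Ty → Value → Prop
  | .bit, .bit _ => True
  | .qbit, .qubit _ => True
  | _, _ => False

/-- Channels: variables of channel type, global channel names, and references to the enclosing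
`new` binders (de Bruijn indices, `loc 0` being the innermost binder). -/
inductive Chan
  | var (x : Var)
  | name (n : ℕ)
  | loc (i : ℕ)

/-- The same channel, seen from below one more `new` binder. -/
def Chan.lift : Chan → Chan
  | .loc i => .loc (i + 1)
  | c => c

/-- Expressions: variables, values, negation and conjunction of bits. -/
inductive Expr
  | var (x : Var)
  | val (v : Value)
  | neg (e : Expr)
  | conj (e f : Expr)

/-- Output arguments: an expression, or `measure e`. -/
inductive Arg
  | expr (e : Expr)
  | measure (e : Expr)

/-- Actions: `e *= H`, `e *= X^c`, `e,f *= CNot`, `measure e`. -/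
inductive Action
  | had (e : Expr)
  | xpow (e c : Expr)
  | cnot (e f : Expr)
  | measure (e : Expr)

/-- Process terms: `0`, `P ∥ Q`, `c?[x₁:T₁,…].P`, `c![e₁,…].P`, `{A}.P`, `(new c)P`,
`(qbit x₁,…)P`. -/
inductive Proc
  | nil
  | par (P Q : Proc)
  | inp (c : Chan) (xs : List (Var × Ty)) (P : Proc)
  | out (c : Chan) (es : List Arg) (P : Proc)
  | act (A : Action) (P : Proc)
  | new (P : Proc)
  | qbit (xs : List Var) (P : Proc)

/-! ## Substitution and evaluation

Only closed values are substituted, so no variable capture can occur. -/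

def Chan.subst (η : Var → Option ℕ) : Chan → Chan
  | .var x => (η x).elim (.var x) .name
  | c => c

def Expr.subst (θ : Var → Option Value) : Expr → Expr
  | .var x => (θ x).elim (.var x) .val
  | .val v => .val v
  | .neg e => .neg (e.subst θ)
  | .conj e f => .conj (e.subst θ) (f.subst θ)

def Arg.subst (θ : Var → Option Value) : Arg → Arg
  | .expr e => .expr (e.subst θ)
  | .measure e => .measure (e.subst θ)

def Action.subst (θ : Var → Option Value) : Action → Action
  | .had e => .had (e.subst θ)
  | .xpow e c => .xpow (e.subst θ) (c.subst θ)
  | .cnot e f => .cnot (e.subst θ) (f.subst θ)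
  | .measure e => .measure (e.subst θ)

/-- The substitution `θ` below a binder of the variables `xs`. -/
def hide (xs : List Var) (θ : Var → Option Value) : Var → Option Value :=
  fun x => if x ∈ xs then none else θ x

/-- `θ` acts on data variables and `η` on channel variables. -/
def Proc.subst (θ : Var → Option Value) (η : Var → Option ℕ) : Proc → Proc
  | .nil => .nil
  | .par P Q => .par (P.subst θ η) (Q.subst θ η)
  | .inp c xs P => .inp (c.subst η) xs (P.subst (hide (xs.map Prod.fst) θ) η)
  | .out c es P => .out (c.subst η) (es.map (Arg.subst θ)) (P.subst θ η)
  | .act A P => .act (A.subst θ) (P.subst θ η)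
  | .new P => .new (P.subst θ η)
  | .qbit xs P => .qbit xs (P.subst (hide xs θ) η)

/-- `P{vs/xs}`. -/
def Proc.inst (xs : List Var) (vs : List Value) (P : Proc) : Proc :=
  P.subst (fun x => (xs.zip vs).lookup x) (fun _ => none)

/-- Evaluation; `none` if a free variable or an ill-typed operation is met. -/
def Expr.eval : Expr → Option Value
  | .var _ => none
  | .val v => some v
  | .neg e =>
    match e.eval with
    | some (.bit f) => some (.bit fun w => !f w)
    | _ => none
  | .conj e₁ e₂ =>
    match e₁.eval, e₂.eval with
    | some (.bit f), some (.bit g) => some (.bit fun w => f w && g w)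
    | _, _ => none

/-! ## Transitions of process terms -/

/-- Gates applied to actual qubits. The exponent of `X` may depend on the component `w`. -/
inductive Gate
  | had (q : Qubit)
  | xpow (q : Qubit) (f : List Bool → Bool)
  | cnot (q r : Qubit)

def Gate.qubits : Gate → Finset Qubit
  | .had q => {q}
  | .xpow q _ => {q}
  | .cnot q r => {q, r}

/-- The effect of the gate on the state of the component with index `w`. -/
noncomputable def Gate.run (w : List Bool) : Gate → Ket → Ket
  | .had q, ψ => ψ.had q
  | .xpow q f, ψ => if f w then ψ.flip q else ψ
  | .cnot q r, ψ => ψ.cnot q r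

/-- What a process term does in one step; the last four are internal to the process. -/
inductive Step
  | recv (c : Chan) (ms : List Value)
  | send (c : Chan) (ms : List Value)
  | comm
  | gate (G : Gate)
  | meas (q : Qubit)
  | alloc (qs : List Qubit)

/-- The step as seen from outside a `new` binder; communication on the bound channel with the
outside is impossible. -/
def Step.restrict : Step → Option Step
  | .recv (.loc 0) _ => none
  | .recv (.loc (i + 1)) ms => some (.recv (.loc i) ms)
  | .send (.loc 0) _ => none
  | .send (.loc (i + 1)) ms => some (.send (.loc i) ms)
  | a => some a

/-- `P.Tr k a P'`: the term `P` does `a` and becomes `P'`, where `k` measurements have been made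
before, so that the outcome of the next one is entry `k` of the vector `w` of outcomes. -/
inductive Proc.Tr (k : ℕ) : Proc → Step → Proc → Prop
  | recv {c : Chan} {xs : List (Var × Ty)} {ms : List Value} {P : Proc}
      (hty : List.Forall₂ Ty.Accepts (xs.map Prod.snd) ms) :
      Tr k (.inp c xs P) (.recv c ms) (P.inst (xs.map Prod.fst) ms)
  | send {c : Chan} {es : List Expr} {ms : List Value} {P : Proc}
      (hev : List.Forall₂ (fun e m => e.eval = some m) es ms) :
      Tr k (.out c (es.map .expr) P) (.send c ms) P
  | sendMeas {c : Chan} {es : List Expr} {e : Expr} {rest : List Arg} {q : Qubit} {P : Proc}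
      (hev : e.eval = some (.qubit q)) :
      Tr k (.out c (es.map .expr ++ .measure e :: rest) P) (.meas q)
        (.out c (es.map .expr ++ .expr (.val (.bit fun w => w.getD k false)) :: rest) P)
  | had {e : Expr} {q : Qubit} {P : Proc} (he : e.eval = some (.qubit q)) :
      Tr k (.act (.had e) P) (.gate (.had q)) P
  | xpow {e c : Expr} {q : Qubit} {f : List Bool → Bool} {P : Proc}
      (he : e.eval = some (.qubit q)) (hc : c.eval = some (.bit f)) :
      Tr k (.act (.xpow e c) P) (.gate (.xpow q f)) P
  | cnot {e f : Expr} {q r : Qubit} {P : Proc} (he : e.eval = some (.qubit q))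
      (hf : f.eval = some (.qubit r)) (hqr : q ≠ r) :
      Tr k (.act (.cnot e f) P) (.gate (.cnot q r)) P
  | meas {e : Expr} {q : Qubit} {P : Proc} (he : e.eval = some (.qubit q)) :
      Tr k (.act (.measure e) P) (.meas q) P
  | qbit {xs : List Var} {qs : List Qubit} {P : Proc} (hlen : xs.length = qs.length) :
      Tr k (.qbit xs P) (.alloc qs) (P.inst xs (qs.map .qubit))
  | parL {P P' Q : Proc} {a : Step} (h : Tr k P a P') : Tr k (.par P Q) a (.par P' Q)
  | parR {P Q Q' : Proc} {a : Step} (h : Tr k Q a Q') : Tr k (.par P Q) a (.par P Q')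
  | comL {P P' Q Q' : Proc} {c : Chan} {ms : List Value}
      (hP : Tr k P (.send c ms) P') (hQ : Tr k Q (.recv c ms) Q') :
      Tr k (.par P Q) .comm (.par P' Q')
  | comR {P P' Q Q' : Proc} {c : Chan} {ms : List Value}
      (hP : Tr k P (.recv c ms) P') (hQ : Tr k Q (.send c ms) Q') :
      Tr k (.par P Q) .comm (.par P' Q')
  | res {P P' : Proc} {a a' : Step} (h : Tr k P a P') (ha : a.restrict = some a') :
      Tr k (.new P) a' (.new P')

/-! ## Configurations -/

/-- A mixed configuration `⊕_{w ∈ index} weight w • ([qubits ↦ ket w]; owned; proc at w)`.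
The components are indexed by the vector of the outcomes of the `depth` measurements made so far.
A pure configuration is one with a single component. -/
structure Mixed where
  qubits : List Qubit
  owned : Finset Qubit
  depth : ℕ
  index : Finset (List Bool)
  weight : List Bool → ℝ
  ket : List Bool → Ket
  proc : Proc

/-- The pure configuration `(σ; ω; P)`. -/
def Mixed.pure (σ : QState) (ω : Finset Qubit) (P : Proc) : Mixed where
  qubits := σ.qubits
  owned := ω
  depth := 0
  index := {[]}
  weight := fun _ => 1
  ket := fun _ => σ.ket
  proc := P

/-- Measurement of `q` in every component; outcomes of probability zero give no component. -/
noncomputable def Mixed.measure (m : Mixed) (q : Qubit) : Mixed :=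
  { m with
    depth := m.depth + 1
    index := ((m.index ×ˢ Finset.univ).filter
        fun wb => (m.ket wb.1).born m.qubits q wb.2 ≠ 0).image fun wb => wb.1 ++ [wb.2]
    weight := fun w =>
      m.weight w.dropLast * (m.ket w.dropLast).born m.qubits q (w.getLastD false)
    ket := fun w => (m.ket w.dropLast).collapse m.qubits q (w.getLastD false) }

/-- The set of components in which the classical data `val w` are equal to `v`. -/
def Mixed.fiber (m : Mixed) (val : List Bool → List Bool) (v : List Bool) :
    Finset (List Bool) :=
  m.index.filter fun w => val w = v

/-- The probability with which the classical data `val w` are equal to `v`. -/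
noncomputable def Mixed.prob (m : Mixed) (val : List Bool → List Bool) (v : List Bool) : ℝ :=
  ∑ w ∈ m.fiber val v, m.weight w

/-- The mixture conditioned on the classical data `val w` being `v`. -/
noncomputable def Mixed.cond (m : Mixed) (val : List Bool → List Bool) (v : List Bool) : Mixed :=
  { m with
    index := m.fiber val v
    weight := fun w => m.weight w / m.prob val v }

/-- A configuration is a mixed configuration or a probability distribution `⊞_{v ∈ V} p v • s v`
over mixed configurations, indexed by the revealed classical data. -/
inductive Config
  | mix (m : Mixed)
  | dist (V : Finset (List Bool)) (p : List Bool → ℝ) (s : List Bool → Mixed)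

/-- The probability and the configuration of branch `v` of a configuration; a mixed configuration
counts as its only branch, of probability one. -/
def Config.branchProb : Config → List Bool → ℝ
  | .mix _, _ => 1
  | .dist _ p _, v => p v

def Config.branch : Config → List Bool → Mixed
  | .mix m, _ => m
  | .dist _ _ s, v => s v

/-! ## Transitions of configurations -/

/-- Observable labels and `τ`. In an output label, `V` is the set of possible values of the
classical part of the message, and `qs` is its list of qubits. -/
inductive Label
  | tau
  | inp (c : ℕ) (vs : List Datum)
  | out (c : ℕ) (V : Finset (List Bool)) (qs : List Qubit)

/-- The qubits of a message. -/
def msgQubits (ms : List Value) : List Qubit :=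
  ms.filterMap fun
    | .qubit q => some q
    | .bit _ => none

/-- The classical part of a message in the component with index `w`. -/
def msgBits (ms : List Value) (w : List Bool) : List Bool :=
  ms.filterMap fun
    | .qubit _ => none
    | .bit f => some (f w)

/-- Nondeterministic transitions. Only owned qubits can be manipulated or output; qubits are
input from the environment, which holds the qubits of the state that are not owned. -/
inductive Trans : Config → Label → Config → Prop
  | comm {m : Mixed} {P' : Proc} (h : m.proc.Tr m.depth .comm P') :
      Trans (.mix m) .tau (.mix { m with proc := P' })
  | gate {m : Mixed} {G : Gate} {P' : Proc} (h : m.proc.Tr m.depth (.gate G) P')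
      (hG : G.qubits ⊆ m.owned) :
      Trans (.mix m) .tau (.mix { m with ket := fun w => G.run w (m.ket w), proc := P' })
  | meas {m : Mixed} {q : Qubit} {P' : Proc} (h : m.proc.Tr m.depth (.meas q) P')
      (hq : q ∈ m.owned) :
      Trans (.mix m) .tau (.mix { m.measure q with proc := P' })
  | alloc {m : Mixed} {qs : List Qubit} {P' : Proc} (h : m.proc.Tr m.depth (.alloc qs) P')
      (hnodup : qs.Nodup) (hfresh : ∀ q ∈ qs, q ∉ m.qubits) :
      -- adjoining qubits in state `|0⟩` changes no amplitude
      Trans (.mix m) .tau (.mix { m with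
        qubits := m.qubits ++ qs, owned := m.owned ∪ qs.toFinset, proc := P' })
  | inp {m : Mixed} {c : ℕ} {vs : List Datum} {P' : Proc}
      (h : m.proc.Tr m.depth (.recv (.name c) (vs.map Datum.toValue)) P')
      (hnodup : (msgQubits (vs.map Datum.toValue)).Nodup)
      (henv : ∀ q ∈ msgQubits (vs.map Datum.toValue), q ∈ m.qubits ∧ q ∉ m.owned) :
      Trans (.mix m) (.inp c vs) (.mix { m with
        owned := m.owned ∪ (msgQubits (vs.map Datum.toValue)).toFinset, proc := P' })
  | outOne {m : Mixed} {c : ℕ} {ms : List Value} {P' : Proc} {v : List Bool}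
      (h : m.proc.Tr m.depth (.send (.name c) ms) P')
      (hnodup : (msgQubits ms).Nodup) (hown : (msgQubits ms).toFinset ⊆ m.owned)
      (hV : m.index.image (msgBits ms) = {v}) :
      Trans (.mix m) (.out c {v} (msgQubits ms)) (.mix { m.cond (msgBits ms) v with
        owned := m.owned \ (msgQubits ms).toFinset, proc := P' })
  | outMany {m : Mixed} {c : ℕ} {ms : List Value} {P' : Proc}
      (h : m.proc.Tr m.depth (.send (.name c) ms) P')
      (hnodup : (msgQubits ms).Nodup) (hown : (msgQubits ms).toFinset ⊆ m.owned)
      (hV : 1 < (m.index.image (msgBits ms)).card) :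
      Trans (.mix m) (.out c (m.index.image (msgBits ms)) (msgQubits ms))
        (.dist (m.index.image (msgBits ms)) (m.prob (msgBits ms)) fun v =>
          { m.cond (msgBits ms) v with
            owned := m.owned \ (msgQubits ms).toFinset, proc := P' })

/-- Probabilistic transitions `⊞_v p v • s v ⇝ s v`, with probability `p v`. -/
inductive ProbTrans : Config → ℝ → Config → Prop
  | pick {V : Finset (List Bool)} {p : List Bool → ℝ} {s : List Bool → Mixed} {v : List Bool}
      (hp : ∀ u ∈ V, p u < 1) (hv : v ∈ V) : ProbTrans (.dist V p s) (p v) (.mix (s v))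

/-- The set `𝒮ₚ` of probabilistic configurations; its complement is `𝒮ₙ`. -/
def Config.IsProb (s : Config) : Prop :=
  ∃ π : ℝ, 0 < π ∧ π ≤ 1 ∧ ∃ t, ProbTrans s π t

open Classical in
/-- `μ(s, D)`: the probability of reaching the set `D` from `s` in one probabilistic step; a
nondeterministic configuration stays where it is with probability one. -/
noncomputable def mu (s : Config) (D : Set Config) : ℝ :=
  if s.IsProb then
    match s with
    | .dist V p t => ∑ v ∈ V with Config.mix (t v) ∈ D, p v
    | .mix _ => 0
  else if s ∈ D then 1 else 0

/-- `s ⟹ t`: zero or more `τ` transitions. -/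
def Weak : Config → Config → Prop :=
  Relation.ReflTransGen fun s t => Trans s .tau t

/-! ## Reduced density matrices -/

/-- The basis vector of the qubits `r` that is given by the bits `a`. -/
def basisSet {n : ℕ} (r : Fin n → Qubit) (a : Fin n → Bool) : Finset Qubit :=
  (Finset.univ.filter fun i => a i = true).image r

/-- `ρ^r(s)`: the reduced density matrix of the list `r` of qubits, all other qubits of the state
being traced out and the components of the mixture weighted. It comes with its size, so that
matrices for different lists can be compared. -/
noncomputable def Mixed.density (m : Mixed) (r : List Qubit) :
    Σ n : ℕ, Matrix (Fin n → Bool) (Fin n → Bool) ℂ :=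
  ⟨r.length, fun a b => ∑ w ∈ m.index, (m.weight w : ℂ) *
    ∑ D ∈ (m.qubits.toFinset \ r.toFinset).powerset,
      m.ket w (basisSet r.get a ∪ D) * (starRingEnd ℂ) (m.ket w (basisSet r.get b ∪ D))⟩

/-- `ρ_E(s)`: the reduced density matrix of the environment qubits, those that are not owned. -/
noncomputable def Mixed.envDensity (m : Mixed) :
    Σ n : ℕ, Matrix (Fin n → Bool) (Fin n → Bool) ℂ :=
  m.density (m.qubits.filter fun q => q ∉ m.owned)

/-- `ρ^r` for configurations; only mixed configurations have output transitions. -/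
noncomputable def Config.density (s : Config) (r : List Qubit) :
    Σ n : ℕ, Matrix (Fin n → Bool) (Fin n → Bool) ℂ :=
  match s with
  | .mix m => m.density r
  | .dist _ _ _ => ⟨0, 0⟩

/-! ## Probabilistic branching bisimilarity -/

/-- Probabilistic branching bisimulations. -/
structure IsBisimulation (R : Config → Config → Prop) : Prop where
  equiv : Equivalence R
  tau : ∀ s t, R s t → ∀ s', ¬ s.IsProb → Trans s .tau s' →
    ∃ t' t'', Weak t t' ∧ (t'' = t' ∨ Trans t' .tau t'') ∧ R s t' ∧ R s' t''
  -- the output qubits may have different names, but must be in the same state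
  out : ∀ s t, R s t → ∀ c V qs₁ s', Trans s (.out c V qs₁) s' →
    ∃ t' t'' qs₂, Weak t t' ∧ Trans t' (.out c V qs₂) t'' ∧ R s t' ∧
      s.density qs₁ = t'.density qs₂ ∧
      ∀ v ∈ V, s'.branchProb v = t''.branchProb v ∧
        (s'.branch v).envDensity = (t''.branch v).envDensity ∧
        R (.mix (s'.branch v)) (.mix (t''.branch v))
  inp : ∀ s t, R s t → ∀ c vs s', Trans s (.inp c vs) s' →
    ∃ t' t'', Weak t t' ∧ Trans t' (.inp c vs) t'' ∧ R s t' ∧ R s' t''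
  prob : ∀ s t, R s t → s.IsProb → ∀ u, mu s {x | R u x} = mu t {x | R u x}

/-- Probabilistic branching bisimilarity of configurations. -/
def Bisimilar (s t : Config) : Prop :=
  ∃ R, IsBisimulation R ∧ R s t

/-- Substitutions of data for data variables and of channel names for channel variables. -/
structure Subst where
  data : Var → Option Datum
  chan : Var → Option ℕ

/-- `Pκ`. -/
def Proc.apply (P : Proc) (κ : Subst) : Proc :=
  P.subst (fun x => (κ.data x).map Datum.toValue) κ.chan

/-- Full probabilistic branching bisimilarity of processes: for all substitutions `κ`, all quantum
states `σ` and all lists `ω` of qubits of `σ`, the configurations `(σ; ω; Pκ)` and `(σ; ω; Qκ)`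
are bisimilar. -/
def FullBisimilar (P Q : Proc) : Prop :=
  ∀ (κ : Subst) (σ : QState) (ω : Finset Qubit), ω ⊆ σ.qubits.toFinset →
    Bisimilar (.mix (.pure σ ω (P.apply κ))) (.mix (.pure σ ω (Q.apply κ)))

/-! ## The error correction system -/

namespace Name

abbrev x : Var := 0
abbrev y : Var := 1
abbrev z : Var := 2
abbrev u : Var := 3
abbrev v : Var := 4
abbrev s : Var := 5
abbrev t : Var := 6
abbrev j : Var := 7
abbrev k : Var := 8

end Name

open Name

/-- `(qbit y,z) a?[x:Qbit].{x,z *= CNot}.{x,y *= CNot}.b![x,y,z].0` -/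
def Alice (a b : Chan) : Proc :=
  .qbit [y, z] <|
  .inp a [(x, .qbit)] <|
  .act (.cnot (.var x) (.var z)) <|
  .act (.cnot (.var x) (.var y)) <|
  .out b [.expr (.var x), .expr (.var y), .expr (.var z)] .nil

/-- `(qbit u,v) {u *= H}.{v *= H}.p![measure u, measure v].0` -/
def NoiseRnd (p : Chan) : Proc :=
  .qbit [u, v] <|
  .act (.had (.var u)) <|
  .act (.had (.var v)) <|
  .out p [.measure (.var u), .measure (.var v)] .nil

/-- `{x *= X^(jk)}.{y *= X^(j k̄)}.{z *= X^(j̄ k)}.P` -/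
def flips (P : Proc) : Proc :=
  .act (.xpow (.var x) (.conj (.var j) (.var k))) <|
  .act (.xpow (.var y) (.conj (.var j) (.neg (.var k)))) <|
  .act (.xpow (.var z) (.conj (.neg (.var j)) (.var k))) P

/-- `b?[x,y,z:Qbit].p?[j,k:bit].{x *= X^(jk)}.{y *= X^(j k̄)}.{z *= X^(j̄ k)}.c![x,y,z].0` -/
def NoiseErr (b p c : Chan) : Proc :=
  .inp b [(x, .qbit), (y, .qbit), (z, .qbit)] <|
  .inp p [(j, .bit), (k, .bit)] <|
  flips <|
  .out c [.expr (.var x), .expr (.var y), .expr (.var z)] .nil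

/-- `(new p)(NoiseRnd(p) ∥ NoiseErr(b,p,c))` -/
def Noise (b c : Chan) : Proc :=
  .new (.par (NoiseRnd (.loc 0)) (NoiseErr b.lift (.loc 0) c.lift))

/-- `(qbit s,t) c?[x,y,z:Qbit].{x,s *= CNot}.{y,s *= CNot}.{x,t *= CNot}.{z,t *= CNot}.`
`p![x,y,z,measure s,measure t].0` -/
def BobRec (c p : Chan) : Proc :=
  .qbit [s, t] <|
  .inp c [(x, .qbit), (y, .qbit), (z, .qbit)] <|
  .act (.cnot (.var x) (.var s)) <|
  .act (.cnot (.var y) (.var s)) <|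
  .act (.cnot (.var x) (.var t)) <|
  .act (.cnot (.var z) (.var t)) <|
  .out p [.expr (.var x), .expr (.var y), .expr (.var z), .measure (.var s), .measure (.var t)] .nil

/-- `p?[x,y,z:Qbit,j,k:bit].{x *= X^(jk)}.{y *= X^(j k̄)}.{z *= X^(j̄ k)}.`
`{x,y *= CNot}.{x,z *= CNot}.d![x].0` -/
def BobCorr (p d : Chan) : Proc :=
  .inp p [(x, .qbit), (y, .qbit), (z, .qbit), (j, .bit), (k, .bit)] <|
  flips <|
  .act (.cnot (.var x) (.var y)) <|
  .act (.cnot (.var x) (.var z)) <|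
  .out d [.expr (.var x)] .nil

/-- `(new p)(BobRec(c,p) ∥ BobCorr(p,d))` -/
def Bob (c d : Chan) : Proc :=
  .new (.par (BobRec c.lift (.loc 0)) (BobCorr (.loc 0) d.lift))

/-- `(new b,c)(Alice(a,b) ∥ Noise(b,c) ∥ Bob(c,d))`, where `b` is `loc 1` and `c` is `loc 0`. -/
def QECC (a d : Chan) : Proc :=
  .new (.new (.par (.par (Alice a.lift.lift (.loc 1)) (Noise (.loc 1) (.loc 0)))
    (Bob (.loc 0) d.lift.lift)))

/-- `a?[x:Qbit].d![x].0` -/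
def Identity (a d : Chan) : Proc :=
  .inp a [(x, .qbit)] <| .out d [.expr (.var x)] .nil

end CQP

namespace CQP

/-! ## Inversion of term transitions -/

/-! All that can be observed of the system is that one qubit `x` is taken from the environment and
later given back. Accordingly, configurations fall into three phases: waiting for input, holding
`x`, finished. The bisimulation `SamePhase` relates configurations that are equal or in the same
phase. An internal step never leaves its phase (`phase_tau`), so the other side answers it by
standing still. A visible action is answered by first letting the other side run until it is ready
for the same action. This run exists because every internal step shrinks the term (`Trans.size_lt`)
and because the system does not get stuck (`early_none_progress`, `busy_progress`); `exists_weak`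
combines the two. The only message sent to the outside has no classical part, so no probability
distribution is ever produced.

The quantum content is that `x` is returned in its original state, including its entanglement with
the environment. Let `b` be the bit of `x` in a basis vector. After encoding, `y` and `z` carry `b`
as well. The noise bits `j`, `k` select at most one of the three qubits to be flipped, and in all
four cases `y` then carries `b ⊕ j` and `z` carries `b ⊕ k`, where `b` is the current bit of `x`. So
the parities computed into `s` and `t` are `j` and `k` independently of `b`: the syndrome
measurement is deterministic in every component, disturbs nothing, and reveals exactly which flip
has to be repeated. After correction and decoding every ancilla has a definite bit. In each
component the state is then the original one times a basis vector of the ancillas, and tracing these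
out gives the original reduced density matrices (`Restored.density_eq`,
`OutputReady.envDensity_eq`).

The five threads interleave freely, so the states have to be described for all orders of execution.
`Early` covers everything before the random bits are used: the ket is a product of the noise source
and a main part. `Mid` and `Late` are mixtures of four components (`Branches`), whose kets are
described by what they become after the gates still to be applied. The kets themselves are of the
form `code`, on which each gate acts as a Boolean computation. Closure under internal steps is
`early_tau`, `mid_tau` and `late_tau`. -/

@[simp] theorem tr_nil {k : ℕ} {s : Step} {P' : Proc} : ¬ Proc.Tr k .nil s P' := by
  intro h; cases h

/-- Inversion is stated as an equivalence, so that rewriting serves both to enumerate the steps of a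
term and to construct one. -/
theorem tr_par_iff {k : ℕ} {P Q R : Proc} {s : Step} :
    Proc.Tr k (.par P Q) s R ↔
      (∃ P', Proc.Tr k P s P' ∧ R = .par P' Q) ∨ (∃ Q', Proc.Tr k Q s Q' ∧ R = .par P Q') ∨
      (s = .comm ∧ ∃ c ms P' Q', R = .par P' Q' ∧
        (Proc.Tr k P (.send c ms) P' ∧ Proc.Tr k Q (.recv c ms) Q' ∨
          Proc.Tr k P (.recv c ms) P' ∧ Proc.Tr k Q (.send c ms) Q')) := by
  constructor
  · intro h
    cases h with
    | parL h => exact .inl ⟨_, h, rfl⟩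
    | parR h => exact .inr (.inl ⟨_, h, rfl⟩)
    | comL hP hQ => exact .inr (.inr ⟨rfl, _, _, _, _, rfl, .inl ⟨hP, hQ⟩⟩)
    | comR hP hQ => exact .inr (.inr ⟨rfl, _, _, _, _, rfl, .inr ⟨hP, hQ⟩⟩)
  · rintro (⟨P', h, rfl⟩ | ⟨Q', h, rfl⟩ | ⟨rfl, c, ms, P', Q', rfl, ⟨hP, hQ⟩ | ⟨hP, hQ⟩⟩)
    exacts [.parL h, .parR h, .comL hP hQ, .comR hP hQ]

theorem tr_new_iff {k : ℕ} {P R : Proc} {s : Step} :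
    Proc.Tr k (.new P) s R ↔ ∃ s₁ P', Proc.Tr k P s₁ P' ∧ s₁.restrict = some s ∧ R = .new P' := by
  constructor
  · intro h
    cases h with
    | res h hs => exact ⟨_, _, h, hs, rfl⟩
  · rintro ⟨s₁, P', h, hs, rfl⟩
    exact .res h hs

theorem tr_inp_iff {k : ℕ} {c : Chan} {xs : List (Var × Ty)} {P R : Proc} {s : Step} :
    Proc.Tr k (.inp c xs P) s R ↔
      ∃ ms, List.Forall₂ Ty.Accepts (xs.map Prod.snd) ms ∧ s = .recv c ms ∧
        R = P.inst (xs.map Prod.fst) ms := by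
  constructor
  · intro h
    cases h with
    | recv h => exact ⟨_, h, rfl, rfl⟩
  · rintro ⟨ms, h, rfl, rfl⟩
    exact .recv h

theorem tr_qbit_iff {k : ℕ} {xs : List Var} {P R : Proc} {s : Step} :
    Proc.Tr k (.qbit xs P) s R ↔
      ∃ qs : List Qubit, xs.length = qs.length ∧ s = .alloc qs ∧
        R = P.inst xs (qs.map .qubit) := by
  constructor
  · intro h
    cases h with
    | qbit h => exact ⟨_, h, rfl, rfl⟩
  · rintro ⟨qs, h, rfl, rfl⟩
    exact .qbit h

theorem map_expr_injective : Function.Injective (List.map Arg.expr) :=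
  List.map_injective_iff.2 fun _ _ h => by injection h

/-- This separates the two rules for outputs: a message is sent only when no argument is left to be
measured. -/
theorem map_expr_ne_append_measure (es es' : List Expr) (e : Expr) (rest : List Arg) :
    es.map Arg.expr ≠ es'.map Arg.expr ++ Arg.measure e :: rest := by
  intro h
  have : Arg.measure e ∈ es.map Arg.expr := by rw [h]; simp
  simp at this

/-- The first `measure` in the list is determined by the list. Hence the arguments of an output are
measured from left to right, without any choice. -/
theorem map_expr_append_measure_inj {es es' : List Expr} {e e' : Expr} {rest rest' : List Arg}
    (h : es.map Arg.expr ++ Arg.measure e :: rest = es'.map Arg.expr ++ Arg.measure e' :: rest') :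
    es = es' ∧ e = e' ∧ rest = rest' := by
  induction es generalizing es' with
  | nil => cases es' <;> simp_all
  | cons a es ih =>
    cases es' with
    | nil => simp at h
    | cons a' es' =>
      simp only [List.map_cons, List.cons_append, List.cons.injEq, Arg.expr.injEq] at h
      obtain ⟨h1, h2, h3⟩ := ih h.2
      exact ⟨by rw [h.1, h1], h2, h3⟩

theorem tr_out_iff {k : ℕ} {c : Chan} {es : List Expr} {P R : Proc} {s : Step} :
    Proc.Tr k (.out c (es.map .expr) P) s R ↔
      ∃ ms, List.Forall₂ (fun e m => e.eval = some m) es ms ∧ s = .send c ms ∧ R = P := by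
  constructor
  · intro h
    -- The argument list is not a constructor pattern, so the term is generalized before the case
    -- distinction and its equation is analysed afterwards.
    generalize hX : Proc.out c (es.map .expr) P = X at h
    cases h <;> simp only [Proc.out.injEq, reduceCtorEq] at hX
    case send es' ms P hev =>
      obtain ⟨rfl, h, rfl⟩ := hX
      obtain rfl := map_expr_injective h
      exact ⟨_, hev, rfl, rfl⟩
    case sendMeas => exact absurd hX.2.1 (map_expr_ne_append_measure _ _ _ _)
  · rintro ⟨ms, h, rfl, rfl⟩
    exact .send h

theorem tr_out_measure_iff {k : ℕ} {c : Chan} {es : List Expr} {e : Expr} {rest : List Arg}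
    {P R : Proc} {s : Step} :
    Proc.Tr k (.out c (es.map .expr ++ .measure e :: rest) P) s R ↔
      ∃ q, e.eval = some (.qubit q) ∧ s = .meas q ∧
        R = .out c (es.map .expr ++ .expr (.val (.bit fun w => w.getD k false)) :: rest) P := by
  constructor
  · intro h
    generalize hX : Proc.out c (es.map .expr ++ .measure e :: rest) P = X at h
    cases h <;> simp only [Proc.out.injEq, reduceCtorEq] at hX
    case send => exact absurd hX.2.1.symm (map_expr_ne_append_measure _ _ _ _)
    case sendMeas hev =>
      obtain ⟨rfl, h, rfl⟩ := hX
      obtain ⟨rfl, rfl, rfl⟩ := map_expr_append_measure_inj h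
      exact ⟨_, hev, rfl, rfl⟩
  · rintro ⟨q, h, rfl, rfl⟩
    exact .sendMeas h

/-- The action `A` is the application of the gate `G`. -/
def Action.IsGate (A : Action) (G : Gate) : Prop :=
  ∀ k P s R, Proc.Tr k (.act A P) s R ↔ s = .gate G ∧ R = P

theorem isGate_had {e : Expr} {q : Qubit} (he : e.eval = some (.qubit q)) :
    (Action.had e).IsGate (.had q) := by
  intro k P s R
  constructor
  · intro h
    cases h with
    | had h => simp_all
  · rintro ⟨rfl, rfl⟩
    exact .had he

theorem isGate_xpow {e c : Expr} {q : Qubit} {f : List Bool → Bool}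
    (he : e.eval = some (.qubit q)) (hc : c.eval = some (.bit f)) :
    (Action.xpow e c).IsGate (.xpow q f) := by
  intro k P s R
  constructor
  · intro h
    cases h with
    | xpow h h' => simp_all
  · rintro ⟨rfl, rfl⟩
    exact .xpow he hc

theorem isGate_cnot {e f : Expr} {q r : Qubit} (he : e.eval = some (.qubit q))
    (hf : f.eval = some (.qubit r)) (hqr : q ≠ r) : (Action.cnot e f).IsGate (.cnot q r) := by
  intro k P s R
  constructor
  · intro h
    cases h with
    | cnot h h' => simp_all
  · rintro ⟨rfl, rfl⟩
    exact .cnot he hf hqr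

/-! ## Channels and restriction -/

-- A channel coming from outside a `new` binder is never the bound one. Together with the next
-- lemmas this keeps `a` and `d`, whatever they are, apart from the private channels.
@[simp] theorem Chan.lift_ne_loc_zero (c : Chan) : c.lift ≠ .loc 0 := by
  cases c <;> simp [Chan.lift]

@[simp] theorem Chan.lift_eq_loc_succ (c : Chan) (i : ℕ) : c.lift = .loc (i + 1) ↔ c = .loc i := by
  cases c <;> simp [Chan.lift]

@[simp] theorem Chan.lift_eq_loc_one (c : Chan) : c.lift = .loc 1 ↔ c = .loc 0 :=
  c.lift_eq_loc_succ 0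

@[simp] theorem Chan.lift_inj {c c' : Chan} : c.lift = c'.lift ↔ c = c' := by
  cases c <;> cases c' <;> simp [Chan.lift]

@[simp] theorem Chan.lift_eq_name {c : Chan} {n : ℕ} : c.lift = .name n ↔ c = .name n := by
  cases c <;> simp [Chan.lift]

@[simp] theorem Chan.name_eq_lift {c : Chan} {n : ℕ} : .name n = c.lift ↔ c = .name n := by
  cases c <;> simp [Chan.lift, eq_comm]

theorem Chan.subst_lift (η : Var → Option ℕ) (c : Chan) :
    c.lift.subst η = (c.subst η).lift := by
  cases c with
  | var x => simp only [Chan.lift, Chan.subst]; cases η x <;> rfl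
  | name n => rfl
  | loc i => rfl

@[simp] theorem restrict_eq_comm {s : Step} : s.restrict = some .comm ↔ s = .comm := by
  rcases s with ⟨_ | _ | _ | _, _⟩ | ⟨_ | _ | _ | _, _⟩ | _ | _ | _ | _ <;> simp [Step.restrict]

@[simp] theorem restrict_eq_gate {s : Step} {G : Gate} :
    s.restrict = some (.gate G) ↔ s = .gate G := by
  rcases s with ⟨_ | _ | _ | _, _⟩ | ⟨_ | _ | _ | _, _⟩ | _ | _ | _ | _ <;> simp [Step.restrict]

@[simp] theorem restrict_eq_meas {s : Step} {q : Qubit} :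
    s.restrict = some (.meas q) ↔ s = .meas q := by
  rcases s with ⟨_ | _ | _ | _, _⟩ | ⟨_ | _ | _ | _, _⟩ | _ | _ | _ | _ <;> simp [Step.restrict]

@[simp] theorem restrict_eq_alloc {s : Step} {qs : List Qubit} :
    s.restrict = some (.alloc qs) ↔ s = .alloc qs := by
  rcases s with ⟨_ | _ | _ | _, _⟩ | ⟨_ | _ | _ | _, _⟩ | _ | _ | _ | _ <;> simp [Step.restrict]

@[simp] theorem restrict_eq_send {s : Step} {c : Chan} {ms : List Value} :
    s.restrict = some (.send c ms) ↔ s = .send c.lift ms := by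
  rcases s with ⟨_ | _ | _ | _, _⟩ | ⟨_ | _ | _ | _, _⟩ | _ | _ | _ | _ <;> cases c <;>
    simp [Step.restrict, Chan.lift]

@[simp] theorem restrict_eq_recv {s : Step} {c : Chan} {ms : List Value} :
    s.restrict = some (.recv c ms) ↔ s = .recv c.lift ms := by
  rcases s with ⟨_ | _ | _ | _, _⟩ | ⟨_ | _ | _ | _, _⟩ | _ | _ | _ | _ <;> cases c <;>
    simp [Step.restrict, Chan.lift]

/-! ## The network of the five threads of the error correction system -/

/-- The five sequential threads of `QECC`, inside their restrictions. -/
def net (A N E R C : Proc) : Proc :=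
  .new (.new (.par (.par A (.new (.par N E))) (.new (.par R C))))

theorem qecc_eq_net (a d : Chan) :
    QECC a d = net (Alice a.lift.lift (.loc 1)) (NoiseRnd (.loc 0))
      (NoiseErr (.loc 2) (.loc 0) (.loc 1)) (BobRec (.loc 1) (.loc 0))
      (BobCorr (.loc 0) d.lift.lift.lift) := rfl

/-- `s` is visible unchanged outside restrictions, and is not a communication. -/
def Step.Rigid (s : Step) : Prop :=
  s ≠ .comm ∧ ∀ s₁ : Step, s₁.restrict = some s ↔ s₁ = s

theorem rigid_gate (G : Gate) : (Step.gate G).Rigid := ⟨by simp, by simp⟩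
theorem rigid_meas (q : Qubit) : (Step.meas q).Rigid := ⟨by simp, by simp⟩
theorem rigid_alloc (qs : List Qubit) : (Step.alloc qs).Rigid := ⟨by simp, by simp⟩
theorem rigid_send_name (n : ℕ) (ms : List Value) : (Step.send (.name n) ms).Rigid :=
  ⟨by simp, by simp⟩
theorem rigid_recv_name (n : ℕ) (ms : List Value) : (Step.recv (.name n) ms).Rigid :=
  ⟨by simp, by simp⟩

theorem Step.Rigid.tr_new_iff {k : ℕ} {P R : Proc} {s : Step} (hs : s.Rigid) :
    Proc.Tr k (.new P) s R ↔ ∃ P', Proc.Tr k P s P' ∧ R = .new P' := by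
  simp [CQP.tr_new_iff, hs.2]

theorem Step.Rigid.tr_par_iff {k : ℕ} {P Q R : Proc} {s : Step} (hs : s.Rigid) :
    Proc.Tr k (.par P Q) s R ↔
      (∃ P', Proc.Tr k P s P' ∧ R = .par P' Q) ∨ (∃ Q', Proc.Tr k Q s Q' ∧ R = .par P Q') := by
  simp [CQP.tr_par_iff, hs.1]

/-- A rigid step passes through all restrictions and is no synchronization, so exactly one thread
makes it and the other four are untouched. -/
theorem net_step_iff {k : ℕ} {A N E R C X : Proc} {s : Step} (hs : s.Rigid) :
    Proc.Tr k (net A N E R C) s X ↔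
      (∃ A', Proc.Tr k A s A' ∧ X = net A' N E R C) ∨
      (∃ N', Proc.Tr k N s N' ∧ X = net A N' E R C) ∨
      (∃ E', Proc.Tr k E s E' ∧ X = net A N E' R C) ∨
      (∃ R', Proc.Tr k R s R' ∧ X = net A N E R' C) ∨
      (∃ C', Proc.Tr k C s C' ∧ X = net A N E R C') := by
  simp only [net, hs.tr_new_iff, hs.tr_par_iff]
  constructor
  · rintro ⟨_, ⟨_, ⟨_, ⟨A', h, rfl⟩ | ⟨_, ⟨_, ⟨N', h, rfl⟩ | ⟨E', h, rfl⟩, rfl⟩, rfl⟩, rfl⟩ |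
      ⟨_, ⟨_, ⟨R', h, rfl⟩ | ⟨C', h, rfl⟩, rfl⟩, rfl⟩, rfl⟩, rfl⟩
    · exact .inl ⟨A', h, rfl⟩
    · exact .inr (.inl ⟨N', h, rfl⟩)
    · exact .inr (.inr (.inl ⟨E', h, rfl⟩))
    · exact .inr (.inr (.inr (.inl ⟨R', h, rfl⟩)))
    · exact .inr (.inr (.inr (.inr ⟨C', h, rfl⟩)))
  · rintro (⟨A', h, rfl⟩ | ⟨N', h, rfl⟩ | ⟨E', h, rfl⟩ | ⟨R', h, rfl⟩ | ⟨C', h, rfl⟩)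
    · exact ⟨_, ⟨_, .inl ⟨_, .inl ⟨_, h, rfl⟩, rfl⟩, rfl⟩, rfl⟩
    · exact ⟨_, ⟨_, .inl ⟨_, .inr ⟨_, ⟨_, .inl ⟨_, h, rfl⟩, rfl⟩, rfl⟩, rfl⟩, rfl⟩, rfl⟩
    · exact ⟨_, ⟨_, .inl ⟨_, .inr ⟨_, ⟨_, .inr ⟨_, h, rfl⟩, rfl⟩, rfl⟩, rfl⟩, rfl⟩, rfl⟩
    · exact ⟨_, ⟨_, .inr ⟨_, ⟨_, .inl ⟨_, h, rfl⟩, rfl⟩, rfl⟩, rfl⟩, rfl⟩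
    · exact ⟨_, ⟨_, .inr ⟨_, ⟨_, .inr ⟨_, h, rfl⟩, rfl⟩, rfl⟩, rfl⟩, rfl⟩

theorem tr_new_comm_iff {k : ℕ} {P R : Proc} :
    Proc.Tr k (.new P) .comm R ↔ ∃ P', Proc.Tr k P .comm P' ∧ R = .new P' := by
  simp [tr_new_iff]

theorem tr_new_send_iff {k : ℕ} {P R : Proc} {c : Chan} {ms : List Value} :
    Proc.Tr k (.new P) (.send c ms) R ↔ ∃ P', Proc.Tr k P (.send c.lift ms) P' ∧ R = .new P' := by
  simp [tr_new_iff]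

theorem tr_new_recv_iff {k : ℕ} {P R : Proc} {c : Chan} {ms : List Value} :
    Proc.Tr k (.new P) (.recv c ms) R ↔ ∃ P', Proc.Tr k P (.recv c.lift ms) P' ∧ R = .new P' := by
  simp [tr_new_iff]

theorem tr_par_send_iff {k : ℕ} {P Q R : Proc} {c : Chan} {ms : List Value} :
    Proc.Tr k (.par P Q) (.send c ms) R ↔ (∃ P', Proc.Tr k P (.send c ms) P' ∧ R = .par P' Q) ∨
      (∃ Q', Proc.Tr k Q (.send c ms) Q' ∧ R = .par P Q') := by
  simp [tr_par_iff]

theorem tr_par_recv_iff {k : ℕ} {P Q R : Proc} {c : Chan} {ms : List Value} :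
    Proc.Tr k (.par P Q) (.recv c ms) R ↔ (∃ P', Proc.Tr k P (.recv c ms) P' ∧ R = .par P' Q) ∨
      (∃ Q', Proc.Tr k Q (.recv c ms) Q' ∧ R = .par P Q') := by
  simp [tr_par_iff]

theorem tr_par_comm_iff {k : ℕ} {P Q R : Proc} :
    Proc.Tr k (.par P Q) .comm R ↔
      (∃ P', Proc.Tr k P .comm P' ∧ R = .par P' Q) ∨ (∃ Q', Proc.Tr k Q .comm Q' ∧ R = .par P Q') ∨
      (∃ c ms P' Q', Proc.Tr k P (.send c ms) P' ∧ Proc.Tr k Q (.recv c ms) Q' ∧ R = .par P' Q') ∨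
      (∃ c ms P' Q', Proc.Tr k P (.recv c ms) P' ∧ Proc.Tr k Q (.send c ms) Q' ∧
        R = .par P' Q') := by
  rw [tr_par_iff]
  constructor
  · rintro (h | h | ⟨-, c, ms, P', Q', rfl, h | h⟩)
    exacts [.inl h, .inr (.inl h), .inr (.inr (.inl ⟨c, ms, P', Q', h.1, h.2, rfl⟩)),
      .inr (.inr (.inr ⟨c, ms, P', Q', h.1, h.2, rfl⟩))]
  · rintro (h | h | ⟨c, ms, P', Q', h, h', rfl⟩ | ⟨c, ms, P', Q', h, h', rfl⟩)
    exacts [.inl h, .inr (.inl h), .inr (.inr ⟨rfl, c, ms, P', Q', rfl, .inl ⟨h, h'⟩⟩),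
      .inr (.inr ⟨rfl, c, ms, P', Q', rfl, .inr ⟨h, h'⟩⟩)]

/-- The channels that the threads use. -/
structure Wired (k : ℕ) (a d : Chan) (A N E R C : Proc) : Prop where
  A_comm : ∀ {X}, ¬ Proc.Tr k A .comm X
  N_comm : ∀ {X}, ¬ Proc.Tr k N .comm X
  E_comm : ∀ {X}, ¬ Proc.Tr k E .comm X
  R_comm : ∀ {X}, ¬ Proc.Tr k R .comm X
  C_comm : ∀ {X}, ¬ Proc.Tr k C .comm X
  A_send : ∀ {c ms X}, Proc.Tr k A (.send c ms) X → c = .loc 1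
  A_recv : ∀ {c ms X}, Proc.Tr k A (.recv c ms) X → c = a.lift.lift
  N_send : ∀ {c ms X}, Proc.Tr k N (.send c ms) X → c = .loc 0
  N_recv : ∀ {c ms X}, ¬ Proc.Tr k N (.recv c ms) X
  E_send : ∀ {c ms X}, Proc.Tr k E (.send c ms) X → c = .loc 1
  E_recv : ∀ {c ms X}, Proc.Tr k E (.recv c ms) X → c = .loc 2 ∨ c = .loc 0
  R_send : ∀ {c ms X}, Proc.Tr k R (.send c ms) X → c = .loc 0
  R_recv : ∀ {c ms X}, Proc.Tr k R (.recv c ms) X → c = .loc 1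
  C_send : ∀ {c ms X}, Proc.Tr k C (.send c ms) X → c = d.lift.lift.lift
  C_recv : ∀ {c ms X}, Proc.Tr k C (.recv c ms) X → c = .loc 0
  -- The channels `a` and `d` may be equal. Bob's output could then be received by Alice; this is
  -- excluded because Alice has long finished when Bob is able to send.
  A_or_C : (∀ {c ms X}, ¬ Proc.Tr k A (.recv c ms) X) ∨ ∀ {c ms X}, ¬ Proc.Tr k C (.send c ms) X

/-- Comparing the channels on which the threads send and receive leaves only the four intended
communications. The index of a channel depends on the depth: `b` is `loc 1` for Alice but `loc 2`
below the additional `new` of the noise. -/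
theorem net_comm_cases {k : ℕ} {a d : Chan} {A N E R C X : Proc} (hw : Wired k a d A N E R C)
    (h : Proc.Tr k (net A N E R C) .comm X) :
    (∃ ms N' E', Proc.Tr k N (.send (.loc 0) ms) N' ∧ Proc.Tr k E (.recv (.loc 0) ms) E' ∧
      X = net A N' E' R C) ∨
    (∃ ms R' C', Proc.Tr k R (.send (.loc 0) ms) R' ∧ Proc.Tr k C (.recv (.loc 0) ms) C' ∧
      X = net A N E R' C') ∨
    (∃ ms A' E', Proc.Tr k A (.send (.loc 1) ms) A' ∧ Proc.Tr k E (.recv (.loc 2) ms) E' ∧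
      X = net A' N E' R C) ∨
    (∃ ms E' R', Proc.Tr k E (.send (.loc 1) ms) E' ∧ Proc.Tr k R (.recv (.loc 1) ms) R' ∧
      X = net A N E' R' C) := by
  simp only [net, tr_new_comm_iff] at h
  obtain ⟨_, ⟨_, h, rfl⟩, rfl⟩ := h
  simp only [tr_par_comm_iff, tr_par_send_iff, tr_par_recv_iff, tr_new_comm_iff, tr_new_send_iff,
    tr_new_recv_iff, hw.A_comm, hw.N_comm, hw.E_comm, hw.R_comm, hw.C_comm, hw.N_recv,
    false_and, exists_false, false_or, or_false] at h
  rcases h with ⟨_, h, rfl⟩ | ⟨_, ⟨_, h, rfl⟩, rfl⟩ | ⟨c, ms, _, _, h, ⟨_, h2, rfl⟩, rfl⟩ |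
    ⟨c, ms, _, _, h, ⟨_, h2, rfl⟩, rfl⟩
  · rcases h with ⟨_, ⟨_, ⟨c, ms, N', E', h1, h2, rfl⟩, rfl⟩, rfl⟩ |
      ⟨c, ms, A', _, h1, ⟨_, ⟨E', h2, rfl⟩, rfl⟩, rfl⟩ | ⟨c, ms, A', _, h1, ⟨_, h2, rfl⟩, rfl⟩
    · obtain rfl := hw.N_send h1
      exact .inl ⟨ms, N', E', h1, h2, rfl⟩
    · obtain rfl := hw.A_send h1
      exact .inr (.inr (.inl ⟨ms, _, E', h1, h2, rfl⟩))
    · obtain rfl := hw.A_recv h1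
      obtain ⟨_, h2, rfl⟩ | ⟨_, h2, rfl⟩ := h2
      · simpa using hw.N_send h2
      · simpa using hw.E_send h2
  · obtain ⟨c, ms, R', C', h1, h2, rfl⟩ | ⟨c, ms, R', C', h1, h2, rfl⟩ := h
    · obtain rfl := hw.R_send h1
      exact .inr (.inl ⟨ms, R', C', h1, h2, rfl⟩)
    · have := (hw.R_recv h1).symm.trans (hw.C_send h2)
      simp [eq_comm] at this
  · obtain ⟨R', h2, rfl⟩ | ⟨C', h2, rfl⟩ := h2
    · have hc := hw.R_recv h2
      simp only [Chan.lift_eq_loc_one] at hc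
      subst hc
      obtain ⟨_, h1, rfl⟩ | ⟨_, ⟨_, ⟨_, h1, rfl⟩ | ⟨E', h1, rfl⟩, rfl⟩, rfl⟩ := h
      · simpa using hw.A_send h1
      · simpa using hw.N_send h1
      · exact .inr (.inr (.inr ⟨ms, E', R', h1, h2, rfl⟩))
    · simpa using hw.C_recv h2
  · obtain ⟨R', h2, rfl⟩ | ⟨C', h2, rfl⟩ := h2
    · simpa using hw.R_send h2
    · have hc := hw.C_send h2
      simp only [Chan.lift_inj] at hc
      subst hc
      obtain ⟨_, h1, rfl⟩ | ⟨_, ⟨_, ⟨E', h1, rfl⟩, rfl⟩, rfl⟩ := h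
      · exact (hw.A_or_C.elim (fun h => h h1) fun h => h h2).elim
      · simpa [eq_comm] using hw.E_recv h1

theorem net_comm_noise {k : ℕ} {A N E R C N' E' : Proc} {ms : List Value}
    (h1 : Proc.Tr k N (.send (.loc 0) ms) N') (h2 : Proc.Tr k E (.recv (.loc 0) ms) E') :
    Proc.Tr k (net A N E R C) .comm (net A N' E' R C) :=
  .res (.res (.parL (.parR (.res (.comL h1 h2) rfl))) rfl) rfl

theorem net_comm_bob {k : ℕ} {A N E R C R' C' : Proc} {ms : List Value}
    (h1 : Proc.Tr k R (.send (.loc 0) ms) R') (h2 : Proc.Tr k C (.recv (.loc 0) ms) C') :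
    Proc.Tr k (net A N E R C) .comm (net A N E R' C') :=
  .res (.res (.parR (.res (.comL h1 h2) rfl)) rfl) rfl

theorem net_comm_alice_noise {k : ℕ} {A N E R C A' E' : Proc} {ms : List Value}
    (h1 : Proc.Tr k A (.send (.loc 1) ms) A') (h2 : Proc.Tr k E (.recv (.loc 2) ms) E') :
    Proc.Tr k (net A N E R C) .comm (net A' N E' R C) :=
  .res (.res (.parL (.comL h1 (.res (.parR h2) rfl))) rfl) rfl

theorem net_comm_noise_bob {k : ℕ} {A N E R C E' R' : Proc} {ms : List Value}
    (h1 : Proc.Tr k E (.send (.loc 1) ms) E') (h2 : Proc.Tr k R (.recv (.loc 1) ms) R') :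
    Proc.Tr k (net A N E R C) .comm (net A N E' R' C) :=
  .res (.res (.comL (.parR (.res (.parR h1) rfl)) (.res (.parL h2) rfl)) rfl) rfl

/-! ## Kets -/

/-- `ψ` is a unit vector of the space of the qubits `Q`. -/
structure Ket.IsState (Q : Finset Qubit) (ψ : Ket) : Prop where
  supp : ∀ B, ¬ B ⊆ Q → ψ B = 0
  norm : ∑ B ∈ Q.powerset, ‖ψ B‖ ^ 2 = 1

theorem Ket.IsState.mono {Q Q' : Finset Qubit} {ψ : Ket} (h : ψ.IsState Q) (hQ : Q ⊆ Q') :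
    ψ.IsState Q' where
  supp B hB := h.supp B fun h' => hB (h'.trans hQ)
  norm := by
    rw [← h.norm]
    refine (Finset.sum_subset (Finset.powerset_mono.2 hQ) fun B _ hB => ?_).symm
    rw [h.supp B (by simpa using hB)]
    simp

theorem Ket.IsState.eq_zero_of_mem {Q B : Finset Qubit} {ψ : Ket} (h : ψ.IsState Q) {r : Qubit}
    (hr : r ∈ B) (hr' : r ∉ Q) : ψ B = 0 :=
  h.supp B fun h' => hr' (h' hr)

theorem QState.isState (σ : QState) : σ.ket.IsState σ.qubits.toFinset :=
  ⟨σ.supported, σ.normalized⟩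

/-- The symmetric difference treats both cases of the definition uniformly, which makes flips easy
to commute with restrictions of `B`. -/
theorem Ket.flip_apply (q : Qubit) (ψ : Ket) (B : Finset Qubit) :
    ψ.flip q B = ψ (symmDiff B {q}) := by
  unfold Ket.flip
  split_ifs with h <;> congr 1 <;> ext r <;> by_cases hr : r = q <;>
    simp [Finset.mem_symmDiff, hr, h]

/-- The measurement of a qubit that has the definite value `β`. -/
theorem Ket.born_of_definite {qs : List Qubit} {ψ : Ket} (h : ψ.IsState qs.toFinset) {q : Qubit}
    {β : Bool} (hβ : ∀ B, ψ B ≠ 0 → decide (q ∈ B) = β) (b : Bool) :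
    ψ.born qs q b = if b = β then 1 else 0 := by
  unfold Ket.born
  split_ifs with hb
  · rw [← h.norm]
    refine Finset.sum_subset (Finset.filter_subset _ _) fun B h1 h2 => ?_
    have : ψ B = 0 := by
      by_contra h0
      exact h2 (Finset.mem_filter.2 ⟨h1, (hβ B h0).trans hb.symm⟩)
    simp [this]
  · refine Finset.sum_eq_zero fun B h1 => ?_
    have : ψ B = 0 := by
      by_contra h0
      exact hb ((Finset.mem_filter.1 h1).2.symm.trans (hβ B h0))
    simp [this]

theorem Ket.collapse_of_definite {qs : List Qubit} {ψ : Ket} (h : ψ.IsState qs.toFinset) {q : Qubit}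
    {β : Bool} (hβ : ∀ B, ψ B ≠ 0 → decide (q ∈ B) = β) : ψ.collapse qs q β = ψ := by
  funext B
  simp only [Ket.collapse, Ket.born_of_definite h hβ, if_true, Real.sqrt_one, Complex.ofReal_one,
    div_one, ite_eq_left_iff]
  intro h1
  by_contra h0
  exact h1 (hβ B (Ne.symm h0))

/-! ### Product kets -/

/-- The product of `ν` on the qubits `F` and `Φ` on the other qubits. -/
def tens (F : Finset Qubit) (ν Φ : Ket) : Ket := fun B => ν (B ∩ F) * Φ (B \ F)

theorem tens_empty {ν Φ : Ket} (h : ν ∅ = 1) : tens ∅ ν Φ = Φ := by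
  funext B
  simp [tens, h]

/-- Fresh qubits are in the state `|0⟩`, and `Φ` has no amplitude on basis vectors that use them.
This turns an allocation, which leaves the ket unchanged, into a new tensor factor. -/
theorem tens_ground {F Q : Finset Qubit} {ν Φ : Ket} (hΦ : Φ.IsState Q) (hF : Disjoint Q F)
    (h1 : ν ∅ = 1) (h0 : ∀ S ⊆ F, S ≠ ∅ → ν S = 0) : tens F ν Φ = Φ := by
  funext B
  unfold tens
  by_cases h : B ∩ F = ∅
  · rw [h, h1, one_mul, Finset.sdiff_eq_self_of_disjoint (Finset.disjoint_iff_inter_eq_empty.2 h)]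
  · rw [h0 _ Finset.inter_subset_right h, zero_mul]
    obtain ⟨r, hr⟩ := Finset.nonempty_iff_ne_empty.2 h
    rw [Finset.mem_inter] at hr
    exact (hΦ.eq_zero_of_mem hr.1 (Finset.disjoint_right.1 hF hr.2)).symm

theorem tens_flip {F : Finset Qubit} {ν Φ : Ket} {q : Qubit} (hq : q ∉ F) :
    (tens F ν Φ).flip q = tens F ν (Φ.flip q) := by
  funext B
  simp only [tens, Ket.flip_apply]
  congr 2 <;> ext r <;> by_cases hr : r = q <;> simp [Finset.mem_symmDiff, hr, hq]

theorem tens_cnot {F : Finset Qubit} {ν Φ : Ket} {q r : Qubit} (hq : q ∉ F) (hr : r ∉ F) :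
    (tens F ν Φ).cnot q r = tens F ν (Φ.cnot q r) := by
  funext B
  have h := congrFun (tens_flip (ν := ν) (Φ := Φ) hr) B
  simp only [tens] at h
  simp only [Ket.cnot, tens, Finset.mem_sdiff, hq, not_false_iff, and_true]
  split_ifs
  · exact h
  · rfl

theorem tens_had {F : Finset Qubit} {ν Φ : Ket} {q : Qubit} (hq : q ∈ F) :
    (tens F ν Φ).had q = tens F (ν.had q) Φ := by
  funext B
  simp only [tens, Ket.had, Finset.mem_inter, hq, and_true]
  have h1 : B.erase q ∩ F = (B ∩ F).erase q := by ext r; simp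
  have h2 : insert q B ∩ F = insert q (B ∩ F) := by
    ext r; by_cases hr : r = q <;> simp [hr, hq]
  have h3 : B.erase q \ F = B \ F := by
    ext r; by_cases hr : r = q <;> simp [hr, hq]
  have h4 : insert q B \ F = B \ F := by
    ext r; by_cases hr : r = q <;> simp [hr, hq]
  rw [h1, h2, h3, h4]
  ring

/-- A basis vector `B` splits uniquely into `B ∩ F` and `B \ F`. The sum factorizes, and the factor
of `Φ` is its norm, which is one. -/
theorem sum_powerset_tens {F Q : Finset Qubit} {ν Φ : Ket} (hΦ : Φ.IsState Q) (hF : Disjoint Q F)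
    (p : Finset Qubit → Prop) [DecidablePred p] :
    ∑ B ∈ (Q ∪ F).powerset with p (B ∩ F), ‖tens F ν Φ B‖ ^ 2 =
      ∑ S ∈ F.powerset with p S, ‖ν S‖ ^ 2 := by
  have : ∑ S ∈ F.powerset with p S, ‖ν S‖ ^ 2 =
      ∑ SD ∈ (F.powerset.filter p) ×ˢ Q.powerset, ‖ν SD.1‖ ^ 2 * ‖Φ SD.2‖ ^ 2 := by
    rw [Finset.sum_product]
    simp only [← Finset.mul_sum, hΦ.norm, mul_one]
  rw [this]
  refine Finset.sum_nbij' (fun B => (B ∩ F, B \ F)) (fun SD => SD.1 ∪ SD.2) ?_ ?_ ?_ ?_ ?_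
  · intro B hB
    simp only [Finset.mem_filter, Finset.mem_powerset, Finset.mem_product] at hB ⊢
    refine ⟨⟨Finset.inter_subset_right, hB.2⟩, fun r hr => ?_⟩
    rw [Finset.mem_sdiff] at hr
    exact (Finset.mem_union.1 (hB.1 hr.1)).resolve_right hr.2
  · rintro ⟨S, D⟩ h
    simp only [Finset.mem_filter, Finset.mem_powerset, Finset.mem_product] at h ⊢
    have : (S ∪ D) ∩ F = S := by
      ext r
      have := @h.1.1 r
      have h0 := Finset.disjoint_left.1 hF
      have h' := @h0 r
      have h'' := @h.2 r
      simp only [Finset.mem_inter, Finset.mem_union]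
      tauto
    rw [this]
    exact ⟨Finset.union_comm Q F ▸ Finset.union_subset_union h.1.1 h.2, h.1.2⟩
  · intro B _
    exact sup_inf_sdiff B F
  · rintro ⟨S, D⟩ h
    simp only [Finset.mem_filter, Finset.mem_powerset, Finset.mem_product] at h
    have h1 := fun r => @h.1.1 r
    have h2 := Finset.disjoint_left.1 hF
    have h3 := fun r => @h.2 r
    ext r <;> have := h1 r <;> have := @h2 r <;> have := h3 r <;>
      simp only [Finset.mem_inter, Finset.mem_union, Finset.mem_sdiff] <;> tauto
  · intro B _
    simp [tens, mul_pow]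

theorem born_tens {F Q : Finset Qubit} {ν Φ : Ket} (hΦ : Φ.IsState Q) (hF : Disjoint Q F)
    {qs : List Qubit} (hqs : qs.toFinset = Q ∪ F) {q : Qubit} (hq : q ∈ F) (b : Bool) :
    (tens F ν Φ).born qs q b = ∑ S ∈ F.powerset with decide (q ∈ S) = b, ‖ν S‖ ^ 2 := by
  rw [← sum_powerset_tens hΦ hF, Ket.born, hqs]
  simp [hq]

theorem collapse_tens {F : Finset Qubit} {ν Φ : Ket} {qs : List Qubit} {q : Qubit} (hq : q ∈ F)
    (b : Bool) :
    (tens F ν Φ).collapse qs q b = tens F (fun S => if decide (q ∈ S) = b then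
      ν S / (Real.sqrt ((tens F ν Φ).born qs q b) : ℂ) else 0) Φ := by
  funext B
  simp only [Ket.collapse, tens, Finset.mem_inter, hq, and_true]
  split_ifs
  · ring
  · simp

/-! ### Affine codes -/

/-- The state `ψ`, possibly with an `X` error on the qubit `x`, together with ancillas `G` the bits
of which are functions `f` of the bit of `x`. -/
def code (ψ : Ket) (x : Qubit) (G : Finset Qubit) (err : Bool) (f : Qubit → Bool → Bool) : Ket :=
  fun B => if ∀ r ∈ G, decide (r ∈ B) = f r (decide (x ∈ B)) then
    ψ (if err then symmDiff (B \ G) {x} else B \ G) else 0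

theorem code_congr {ψ : Ket} {x : Qubit} {G : Finset Qubit} {err : Bool} {f g : Qubit → Bool → Bool}
    (h : ∀ r ∈ G, ∀ b, f r b = g r b) : code ψ x G err f = code ψ x G err g := by
  funext B
  unfold code
  congr 1
  exact propext (forall₂_congr fun r hr => by rw [h r hr])

theorem code_empty (ψ : Ket) (x : Qubit) (f : Qubit → Bool → Bool) : code ψ x ∅ false f = ψ := by
  funext B
  simp [code]

/-- The ancilla bits are functions of the current bit of `x`. When that bit is flipped the ancillas
stay as they are, so the functions have to be precomposed with negation. -/
theorem code_flip_core {ψ : Ket} {x : Qubit} {G : Finset Qubit} {err : Bool}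
    {f : Qubit → Bool → Bool} (hx : x ∉ G) :
    (code ψ x G err f).flip x = code ψ x G (!err) fun r b => f r (!b) := by
  funext B
  rw [Ket.flip_apply]
  unfold code
  congr 1
  · refine propext (forall₂_congr fun r hr => ?_)
    have hrx : r ≠ x := fun h => hx (h ▸ hr)
    by_cases hB : x ∈ B <;> simp [Finset.mem_symmDiff, hrx, hB]
  · have : symmDiff B {x} \ G = symmDiff (B \ G) {x} := by
      ext r; by_cases hr : r = x <;> simp [Finset.mem_symmDiff, hr, hx]
    rw [this]
    cases err <;> simp

theorem code_flip_ancilla {ψ : Ket} {x r : Qubit} {G : Finset Qubit} {err : Bool}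
    {f : Qubit → Bool → Bool} (hx : x ∉ G) (hr : r ∈ G) :
    (code ψ x G err f).flip r = code ψ x G err (Function.update f r fun b => !f r b) := by
  funext B
  have hxr : x ≠ r := fun h => hx (h ▸ hr)
  rw [Ket.flip_apply]
  unfold code
  congr 1
  · refine propext (forall₂_congr fun r' hr' => ?_)
    by_cases h : r' = r
    · subst h
      cases h : f r' (decide (x ∈ B)) <;>
        by_cases hB : r' ∈ B <;> simp [Finset.mem_symmDiff, hxr, hB, h]
    · simp [Finset.mem_symmDiff, hxr, h]
  · have : symmDiff B {r} \ G = B \ G := by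
      ext r'; by_cases h : r' = r <;> simp [Finset.mem_symmDiff, h, hr]
    rw [this]

theorem code_cnot_core {ψ : Ket} {x r : Qubit} {G : Finset Qubit} {err : Bool}
    {f : Qubit → Bool → Bool} (hx : x ∉ G) (hr : r ∈ G) :
    (code ψ x G err f).cnot x r = code ψ x G err (Function.update f r fun b => f r b ^^ b) := by
  funext B
  unfold Ket.cnot
  rw [code_flip_ancilla hx hr]
  have hxr : x ≠ r := fun h => hx (h ▸ hr)
  split_ifs with hB <;> unfold code <;> congr 1 <;>
    refine propext (forall₂_congr fun r' hr' => ?_) <;>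
    by_cases h : r' = r <;> simp [h, hB]

/-- On the support of the code the control bit equals `f q b`, so the target receives this function
of `b`. -/
theorem code_cnot_ancilla {ψ : Ket} {x q r : Qubit} {G : Finset Qubit} {err : Bool}
    {f : Qubit → Bool → Bool} (hx : x ∉ G) (hq : q ∈ G) (hr : r ∈ G) (hqr : q ≠ r) :
    (code ψ x G err f).cnot q r =
      code ψ x G err (Function.update f r fun b => f r b ^^ f q b) := by
  funext B
  unfold Ket.cnot
  rw [code_flip_ancilla hx hr]
  by_cases hc : decide (q ∈ B) = f q (decide (x ∈ B))
  · split_ifs with hB <;> unfold code <;> congr 1 <;>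
      refine propext (forall₂_congr fun r' hr' => ?_) <;>
      by_cases h : r' = r <;> simp [h, ← hc, hB]
  -- Here `B` violates the condition on `q`. Updating `f` at the target `r ≠ q` does not affect this
  -- condition, so all codes involved vanish at `B`.
  · have h0 : ∀ g : Qubit → Bool → Bool, g q = f q → code ψ x G err g B = 0 := by
      intro g hg
      unfold code
      rw [if_neg]
      intro h
      exact hc (hg ▸ h q hq)
    rw [h0 _ (Function.update_of_ne hqr _ _), h0 _ rfl, h0 _ (Function.update_of_ne hqr _ _),
      ite_self]

theorem code_xpow_core {ψ : Ket} {x : Qubit} {G : Finset Qubit} {err : Bool}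
    {f : Qubit → Bool → Bool} (hx : x ∉ G) (c : Bool) :
    (if c then (code ψ x G err f).flip x else code ψ x G err f) =
      code ψ x G (err ^^ c) fun r b => f r (b ^^ c) := by
  cases c <;> simp [code_flip_core hx]

theorem code_xpow_ancilla {ψ : Ket} {x r : Qubit} {G : Finset Qubit} {err : Bool}
    {f : Qubit → Bool → Bool} (hx : x ∉ G) (hr : r ∈ G) (c : Bool) :
    (if c then (code ψ x G err f).flip r else code ψ x G err f) =
      code ψ x G err (Function.update f r fun b => f r b ^^ c) := by
  cases c <;> simp [code_flip_ancilla hx hr]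

/-- No basis vector with a nonzero amplitude contains a qubit outside `Q ∪ G`. So fresh qubits may
be counted among the ancillas, with the constant bit zero. -/
theorem code_extend {ψ : Ket} {Q : Finset Qubit} (hψ : ψ.IsState Q) {x : Qubit} {G S : Finset Qubit}
    {err : Bool} {f : Qubit → Bool → Bool} (hx : x ∈ Q) (hQ : Disjoint Q S) (hG : Disjoint G S) :
    code ψ x G err f = code ψ x (G ∪ S) err fun r b => if r ∈ S then false else f r b := by
  funext B
  by_cases hB : ∃ r ∈ S, r ∈ B
  · obtain ⟨r, hr, hrB⟩ := hB
    have h1 : r ∉ Q := Finset.disjoint_right.1 hQ hr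
    have h2 : r ∉ G := Finset.disjoint_right.1 hG hr
    have h3 : r ≠ x := fun h => h1 (h ▸ hx)
    trans (0 : ℂ)
    · unfold code
      rw [ite_eq_right_iff]
      intro _
      refine hψ.eq_zero_of_mem (r := r) ?_ h1
      split_ifs <;> simp [Finset.mem_symmDiff, *]
    · unfold code
      rw [if_neg]
      intro h
      simpa [hr, hrB] using h r (Finset.mem_union_right _ hr)
  · push Not at hB
    unfold code
    congr 1
    · refine propext ⟨fun h r hr => ?_, fun h r hr => ?_⟩
      · dsimp only
        split_ifs with hS
        · simp [hB r hS]
        · exact h r ((Finset.mem_union.1 hr).resolve_right hS)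
      · simpa [Finset.disjoint_left.1 hG hr] using h r (Finset.mem_union_left _ hr)
    · have : B \ (G ∪ S) = B \ G := by
        ext r
        have := hB r
        simp only [Finset.mem_sdiff, Finset.mem_union]
        tauto
      rw [this]

/-- A tensor factor in a computational basis state amounts to further ancillas with constant bits.
This absorbs the measured noise qubits into the code. -/
theorem tens_code {ψ ν : Ket} {x : Qubit} {Y F : Finset Qubit} {err : Bool}
    {f : Qubit → Bool → Bool} {c : Qubit → Bool} (hx : x ∉ F) (hYF : Disjoint Y F)
    (hν : ∀ S, ν S = if ∀ r ∈ F, decide (r ∈ S) = c r then 1 else 0) :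
    tens F ν (code ψ x Y err f) = code ψ x (Y ∪ F) err fun r b => if r ∈ F then c r else f r b := by
  funext B
  have h1 : (∀ r ∈ F, decide (r ∈ B ∩ F) = c r) ↔ ∀ r ∈ F, decide (r ∈ B) = c r :=
    forall₂_congr fun r hr => by simp [hr]
  have h2 : (∀ r ∈ Y, decide (r ∈ B \ F) = f r (decide (x ∈ B \ F))) ↔
      ∀ r ∈ Y, decide (r ∈ B) = f r (decide (x ∈ B)) :=
    forall₂_congr fun r hr => by simp [Finset.disjoint_left.1 hYF hr, hx]
  have h3 : (∀ r ∈ Y ∪ F, decide (r ∈ B) = if r ∈ F then c r else f r (decide (x ∈ B))) ↔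
      (∀ r ∈ F, decide (r ∈ B) = c r) ∧ ∀ r ∈ Y, decide (r ∈ B) = f r (decide (x ∈ B)) := by
    constructor
    · refine fun h => ⟨fun r hr => ?_, fun r hr => ?_⟩
      · simpa [hr] using h r (Finset.mem_union_right _ hr)
      · simpa [Finset.disjoint_left.1 hYF hr] using h r (Finset.mem_union_left _ hr)
    · rintro ⟨h, h'⟩ r hr
      split_ifs with hF
      · exact h r hF
      · exact h' r ((Finset.mem_union.1 hr).resolve_right hF)
  have h4 : (B \ F) \ Y = B \ (Y ∪ F) := by ext r; simp; tauto
  simp only [tens, code, hν, h1, h2, h3, h4]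
  split_ifs <;> simp_all

theorem code_isState {ψ : Ket} {Q : Finset Qubit} (hψ : ψ.IsState Q) {x : Qubit} {G : Finset Qubit}
    (hx : x ∈ Q) (hG : Disjoint Q G) (err : Bool) (f : Qubit → Bool → Bool) :
    (code ψ x G err f).IsState (Q ∪ G) where
  supp B hB := by
    unfold code
    rw [ite_eq_right_iff]
    intro _
    obtain ⟨r, hr, hr'⟩ := Finset.not_subset.1 hB
    simp only [Finset.mem_union, not_or] at hr'
    have h3 : r ≠ x := fun h => hr'.1 (h ▸ hx)
    refine hψ.eq_zero_of_mem (r := r) ?_ hr'.1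
    split_ifs <;> simp [Finset.mem_symmDiff, *]
  norm := by
    have hxG := Finset.disjoint_left.1 hG hx
    have h1 : ∀ C ⊆ Q, (if err then symmDiff C {x} else C) ⊆ Q := by
      intro C hC
      split_ifs
      · intro r hr
        simp only [Finset.mem_symmDiff, Finset.mem_singleton] at hr
        rcases hr with hr | hr
        · exact hC hr.1
        · exact hr.1 ▸ hx
      · exact hC
    have h2 : ∀ C : Finset Qubit, (if err then symmDiff (if err then symmDiff C {x} else C) {x}
        else (if err then symmDiff C {x} else C)) = C := by
      intro C
      cases err <;> simp
    rw [← hψ.norm]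
    have h0 : ∀ B, ‖code ψ x G err f B‖ ^ 2 =
        if ∀ r ∈ G, decide (r ∈ B) = f r (decide (x ∈ B)) then
          ‖ψ (if err then symmDiff (B \ G) {x} else B \ G)‖ ^ 2 else 0 := by
      intro B
      unfold code
      split_ifs <;> simp
    simp only [h0]
    rw [← Finset.sum_filter]
    -- A basis vector in the support is determined by its part outside `G`. Conversely, every subset
    -- of `Q` is completed by the ancilla bits that `f` prescribes, after the error has been put
    -- back.
    refine Finset.sum_nbij' (fun B => if err then symmDiff (B \ G) {x} else B \ G)
      (fun C => (if err then symmDiff C {x} else C) ∪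
        G.filter fun r => f r (decide (x ∈ (if err then symmDiff C {x} else C))) = true)
      ?_ ?_ ?_ ?_ ?_
    · intro B hB
      simp only [Finset.mem_filter, Finset.mem_powerset] at hB ⊢
      refine h1 _ fun r hr => ?_
      rw [Finset.mem_sdiff] at hr
      exact (Finset.mem_union.1 (hB.1 hr.1)).resolve_right hr.2
    · intro C hC
      rw [Finset.mem_powerset] at hC
      have h := h1 C hC
      generalize (if err then symmDiff C {x} else C) = D at h
      simp only [Finset.mem_filter, Finset.mem_powerset]
      refine ⟨Finset.union_subset_union h (Finset.filter_subset _ _), fun r hr => ?_⟩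
      have h3 : r ∉ D := fun h' => Finset.disjoint_left.1 hG (h h') hr
      simp [hr, hxG, h3]
    · intro B hB
      simp only [Finset.mem_filter, Finset.mem_powerset] at hB ⊢
      rw [h2]
      ext r
      have := hB.2 r
      by_cases hr : r ∈ G
      · simp [hr, hxG, ← this hr]
      · simp [hr]
    · intro C hC
      rw [Finset.mem_powerset] at hC
      have h := h1 C hC
      have h3 := h2 C
      generalize (if err then symmDiff C {x} else C) = D at h h3
      have : (D ∪ G.filter fun r => f r (decide (x ∈ D)) = true) \ G = D := by
        ext r
        have h' := @h r
        have h0 := Finset.disjoint_left.1 hG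
        have h'' := @h0 r
        simp only [Finset.mem_sdiff, Finset.mem_union, Finset.mem_filter]
        tauto
      rw [this]
      exact h3
    · intro B _
      rfl

/-! ## The random bits of the noise source -/

theorem norm_inv_sqrt_two_sq : ‖(1 : ℂ) / (Real.sqrt 2 : ℂ)‖ ^ 2 = 1 / 2 := by
  rw [norm_div, norm_one, Complex.norm_real, div_pow, Real.norm_eq_abs, sq_abs,
    Real.sq_sqrt (by norm_num), one_pow]

theorem sqrt_two_mul_self : (Real.sqrt 2 : ℂ) * (Real.sqrt 2 : ℂ) = 2 := by
  rw [← Complex.ofReal_mul, Real.mul_self_sqrt (by norm_num)]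
  norm_num

theorem sqrt_two_ne_zero : (Real.sqrt 2 : ℂ) ≠ 0 := by
  intro h
  have := sqrt_two_mul_self
  simp [h] at this

theorem sqrt_half : (Real.sqrt (1 / 2) : ℂ) = 1 / (Real.sqrt 2 : ℂ) := by
  rw [Real.sqrt_div (by norm_num)]
  simp

/-- `|00⟩` -/
noncomputable def rnd00 (u v : Qubit) : Ket := fun S => if u ∈ S ∨ v ∈ S then 0 else 1

/-- `|+0⟩` -/
noncomputable def rndPlus0 (v : Qubit) : Ket :=
  fun S => if v ∈ S then 0 else 1 / (Real.sqrt 2 : ℂ)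

/-- `|++⟩` -/
noncomputable def rndPlusPlus : Ket := fun _ => 1 / 2

/-- `|j+⟩` -/
noncomputable def rndBitPlus (u : Qubit) (j : Bool) : Ket :=
  fun S => if decide (u ∈ S) = j then 1 / (Real.sqrt 2 : ℂ) else 0

/-- `|jk⟩` -/
noncomputable def rndBits (u v : Qubit) (j k : Bool) : Ket :=
  fun S => if decide (u ∈ S) = j ∧ decide (v ∈ S) = k then 1 else 0

theorem had_rnd00 {u v : Qubit} (huv : u ≠ v) : (rnd00 u v).had u = rndPlus0 v := by
  funext S
  simp only [Ket.had, rnd00, rndPlus0, Finset.mem_erase, Finset.mem_insert]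
  by_cases h : v ∈ S <;> simp [h, huv.symm]

theorem had_rndPlus0 (v : Qubit) : (rndPlus0 v).had v = rndPlusPlus := by
  funext S
  have := sqrt_two_ne_zero
  simp only [Ket.had, rndPlus0, rndPlusPlus, Finset.mem_erase, Finset.mem_insert]
  simp only [ne_eq, not_true_eq_false, false_and, if_false, true_or, if_true, mul_zero, add_zero,
    div_div, sqrt_two_mul_self]

theorem sum_powerset_pair {u v : Qubit} (huv : u ≠ v) (g : Finset Qubit → ℝ) :
    ∑ S ∈ ({u, v} : Finset Qubit).powerset, g S = g ∅ + g {v} + (g {u} + g {u, v}) := by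
  have h1 : ∀ g : Finset Qubit → ℝ, ∑ S ∈ ({v} : Finset Qubit).powerset, g S = g ∅ + g {v} := by
    intro g
    rw [← insert_empty_eq v, Finset.sum_powerset_insert (Finset.notMem_empty v)]
    simp
  rw [Finset.sum_powerset_insert (by simpa using huv), h1, h1]
  simp

theorem born_rndPlusPlus {u v : Qubit} (huv : u ≠ v) (b : Bool) :
    ∑ S ∈ ({u, v} : Finset Qubit).powerset with decide (u ∈ S) = b,
      ‖rndPlusPlus S‖ ^ 2 = 1 / 2 := by
  rw [Finset.sum_filter, sum_powerset_pair huv]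
  cases b <;> simp [rndPlusPlus, huv] <;> norm_num

/-- The number `1 / 2` under the root is the Born probability found in `born_rndPlusPlus`; it
renormalizes the amplitude `1/2` to `1/√2`. -/
theorem collapse_rndPlusPlus (u : Qubit) (b : Bool) :
    (fun S => if decide (u ∈ S) = b then rndPlusPlus S / (Real.sqrt (1 / 2) : ℂ) else 0) =
      rndBitPlus u b := by
  funext S
  have h := sqrt_two_ne_zero
  simp only [rndPlusPlus, rndBitPlus, sqrt_half]
  congr 1
  field_simp
  rw [sq, sqrt_two_mul_self]

theorem born_rndBitPlus {u v : Qubit} (huv : u ≠ v) (j b : Bool) :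
    ∑ S ∈ ({u, v} : Finset Qubit).powerset with decide (v ∈ S) = b, ‖rndBitPlus u j S‖ ^ 2 =
      1 / 2 := by
  rw [Finset.sum_filter, sum_powerset_pair huv]
  have h := norm_inv_sqrt_two_sq
  have h' : (0 : ℝ) = ‖(0 : ℂ)‖ ^ 2 := by simp
  cases b <;> cases j <;> simp only [rndBitPlus, Finset.notMem_empty, Finset.mem_singleton,
    Finset.mem_insert, huv, huv.symm, decide_false, decide_true, if_true, or_true,
    or_false, reduceCtorEq, if_false, h, ← h'] <;> norm_num

theorem collapse_rndBitPlus (u v : Qubit) (j b : Bool) :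
    (fun S => if decide (v ∈ S) = b then rndBitPlus u j S / (Real.sqrt (1 / 2) : ℂ) else 0) =
      rndBits u v j b := by
  funext S
  have h := sqrt_two_ne_zero
  simp only [rndBits, rndBitPlus, sqrt_half]
  by_cases h1 : decide (v ∈ S) = b <;> by_cases h2 : decide (u ∈ S) = j <;> simp [h1, h2, h]

/-! ## Measurements of mixtures -/

/-- The new outcome is appended to the label of a component, so `dropLast` and `getLastD` recover
the old label and the outcome. -/
theorem measure_ket_append (m : Mixed) (q : Qubit) (w : List Bool) (b : Bool) :
    (m.measure q).ket (w ++ [b]) = (m.ket w).collapse m.qubits q b := by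
  simp [Mixed.measure]

theorem measure_weight_append (m : Mixed) (q : Qubit) (w : List Bool) (b : Bool) :
    (m.measure q).weight (w ++ [b]) = m.weight w * (m.ket w).born m.qubits q b := by
  simp [Mixed.measure]

/-- Both outcomes have nonzero probability, so every component splits in two; the next lemma is the
opposite case, in which no component splits. -/
theorem measure_index_uniform {m : Mixed} {q : Qubit}
    (h : ∀ w ∈ m.index, ∀ b, (m.ket w).born m.qubits q b = 1 / 2) :
    (m.measure q).index = (m.index ×ˢ Finset.univ).image fun wb => wb.1 ++ [wb.2] := by
  simp only [Mixed.measure]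
  rw [Finset.filter_true_of_mem]
  rintro ⟨w, b⟩ hw
  rw [h w (Finset.mem_product.1 hw).1 b]
  norm_num

theorem measure_index_definite {m : Mixed} {q : Qubit} {β : List Bool → Bool}
    (h : ∀ w ∈ m.index, ∀ b, (m.ket w).born m.qubits q b = if b = β w then 1 else 0) :
    (m.measure q).index = m.index.image fun w => w ++ [β w] := by
  ext w'
  simp only [Mixed.measure, Finset.mem_image, Finset.mem_filter, Finset.mem_product,
    Finset.mem_univ, and_true, Prod.exists]
  constructor
  · rintro ⟨w, b, ⟨hw, hb⟩, rfl⟩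
    rw [h w hw] at hb
    have : b = β w := by by_contra hne; simp [hne] at hb
    exact ⟨w, hw, by rw [this]⟩
  · rintro ⟨w, hw, rfl⟩
    exact ⟨w, _, ⟨hw, by simp [h w hw]⟩, rfl⟩

/-! ## Reduced density matrices -/

/-- Without an error and with ancilla bits independent of `x`, the ancillas are no longer entangled
with the data: they are in one basis state. -/
theorem code_const {ψ : Ket} {x : Qubit} {G : Finset Qubit} {f : Qubit → Bool → Bool}
    (hf : ∀ r ∈ G, ∀ b, f r b = f r false) (B : Finset Qubit) :
    code ψ x G false f B =
      if B ∩ G = G.filter (fun r => f r false = true) then ψ (B \ G) else 0 := by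
  unfold code
  have : (∀ r ∈ G, decide (r ∈ B) = f r (decide (x ∈ B))) ↔
      B ∩ G = G.filter (fun r => f r false = true) := by
    constructor
    · intro h
      ext r
      by_cases hr : r ∈ G
      · simp [hr, ← hf r hr (decide (x ∈ B)), ← h r hr]
      · simp [hr]
    · intro h r hr
      have := congrArg (r ∈ ·) h
      simp only [Finset.mem_inter, hr, and_true, Finset.mem_filter, true_and, eq_iff_iff] at this
      rw [hf r hr, Bool.eq_iff_iff]
      simpa using this
  simp only [this]
  rfl

/-- The qubits of `σ` are in the state `σ`, and in every component the other qubits are in a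
computational basis state. -/
structure Restored (σ : QState) (L : List Qubit) (m : Mixed) : Prop where
  qubits : m.qubits = σ.qubits ++ L
  disj : Disjoint σ.qubits.toFinset L.toFinset
  ket : ∀ w ∈ m.index, ∃ S ⊆ L.toFinset, ∀ B,
    m.ket w B = if B ∩ L.toFinset = S then σ.ket (B \ L.toFinset) else 0
  weight : ∑ w ∈ m.index, m.weight w = 1

/-- Since `A` and `A'` avoid the ancillas `L`, a term is nonzero only if `D` meets `L` exactly in
`S`. Such `D` correspond to the subsets of `Q \ r` by removing `L` and adding `S`. Tracing out `L`
therefore has no effect. -/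
theorem sum_restored {ψ : Ket} {Q L S r A A' : Finset Qubit} (hS : S ⊆ L) (hQ : Disjoint Q L)
    (hr : r ⊆ Q) (hA : A ⊆ r) (hA' : A' ⊆ r) {φ : Ket}
    (hφ : ∀ B, φ B = if B ∩ L = S then ψ (B \ L) else 0) :
    ∑ D ∈ ((Q ∪ L) \ r).powerset, φ (A ∪ D) * (starRingEnd ℂ) (φ (A' ∪ D)) =
      ∑ D ∈ (Q \ r).powerset, ψ (A ∪ D) * (starRingEnd ℂ) (ψ (A' ∪ D)) := by
  have hL := Finset.disjoint_left.1 hQ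
  have key : ∀ A ⊆ r, ∀ D, φ (A ∪ D) = if D ∩ L = S then ψ (A ∪ (D \ L)) else 0 := by
    intro A hA D
    have h1 : (A ∪ D) ∩ L = D ∩ L := by
      ext t
      have := fun h => @hL t (hr (hA h))
      simp only [Finset.mem_inter, Finset.mem_union]
      tauto
    have h2 : (A ∪ D) \ L = A ∪ (D \ L) := by
      ext t
      have := fun h => @hL t (hr (hA h))
      simp only [Finset.mem_sdiff, Finset.mem_union]
      tauto
    rw [hφ, h1, h2]
  have key2 : ∀ D, φ (A ∪ D) * (starRingEnd ℂ) (φ (A' ∪ D)) = if D ∩ L = S then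
      ψ (A ∪ (D \ L)) * (starRingEnd ℂ) (ψ (A' ∪ (D \ L))) else 0 := by
    intro D
    rw [key A hA, key A' hA']
    split_ifs <;> simp
  simp only [key2]
  rw [← Finset.sum_filter]
  have hD : ∀ D ⊆ Q \ r, (D ∪ S) ∩ L = S ∧ (D ∪ S) \ L = D := by
    intro D hD
    constructor <;> ext t <;> have h1 := @hD t <;> have h2 := @hS t <;> have h3 := @hL t <;>
      simp only [Finset.mem_inter, Finset.mem_sdiff, Finset.mem_union] at h1 ⊢ <;> tauto
  refine Finset.sum_nbij' (fun D => D \ L) (fun D => D ∪ S) ?_ ?_ ?_ ?_ fun _ _ => rfl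
  · intro D hD
    simp only [Finset.mem_filter, Finset.mem_powerset] at hD ⊢
    intro t ht
    have := @hD.1 t
    simp only [Finset.mem_sdiff, Finset.mem_union] at this ht ⊢
    tauto
  · intro D h
    simp only [Finset.mem_filter, Finset.mem_powerset] at h ⊢
    refine ⟨fun t ht => ?_, (hD D h).1⟩
    have h1 := @h t
    have h2 := @hS t
    have h3 := @hL t
    have h4 := @hr t
    simp only [Finset.mem_sdiff, Finset.mem_union] at h1 ht ⊢
    tauto
  · intro D h
    simp only [Finset.mem_filter] at h
    rw [← h.2]
    exact (Finset.union_comm _ _).trans (sup_inf_sdiff D L)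
  · intro D h
    exact (hD D (Finset.mem_powerset.1 h)).2

theorem basisSet_subset (r : List Qubit) (a : Fin r.length → Bool) :
    basisSet r.get a ⊆ r.toFinset := by
  intro t ht
  simp only [basisSet, Finset.mem_image] at ht
  obtain ⟨i, -, rfl⟩ := ht
  simp

/-- All components have the same reduced matrix, and their weights add up to one. The pure
configuration on the right serves as a reference only: its owned qubits and its term do not enter
`density`. -/
theorem Restored.density_eq {σ : QState} {L : List Qubit} {m : Mixed} (h : Restored σ L m)
    {r : List Qubit} (hr : r ⊆ σ.qubits) :
    m.density r = (Mixed.pure σ ∅ .nil).density r := by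
  have hr' : r.toFinset ⊆ σ.qubits.toFinset := fun t ht => by
    simpa using hr (by simpa using ht)
  unfold Mixed.density
  congr 1
  funext a b
  have h1 : ∀ w ∈ m.index, (m.weight w : ℂ) *
      ∑ D ∈ (m.qubits.toFinset \ r.toFinset).powerset,
        m.ket w (basisSet r.get a ∪ D) * (starRingEnd ℂ) (m.ket w (basisSet r.get b ∪ D)) =
      (m.weight w : ℂ) * ∑ D ∈ (σ.qubits.toFinset \ r.toFinset).powerset,
        σ.ket (basisSet r.get a ∪ D) * (starRingEnd ℂ) (σ.ket (basisSet r.get b ∪ D)) := by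
    intro w hw
    obtain ⟨S, hS, hk⟩ := h.ket w hw
    rw [h.qubits, List.toFinset_append,
      sum_restored hS h.disj hr' (basisSet_subset r a) (basisSet_subset r b) hk]
  rw [Finset.sum_congr rfl h1, ← Finset.sum_mul, ← Complex.ofReal_sum, h.weight]
  simp [Mixed.pure]

/-- A message without classical information conditions on an event of probability one. -/
theorem Restored.cond {σ : QState} {L : List Qubit} {m : Mixed} (h : Restored σ L m)
    {val : List Bool → List Bool} {v : List Bool} (hv : ∀ w, val w = v) :
    Restored σ L (m.cond val v) := by
  have hf : m.fiber val v = m.index := by simp [Mixed.fiber, hv]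
  have hp : m.prob val v = 1 := by rw [Mixed.prob, hf, h.weight]
  refine ⟨h.qubits, h.disj, ?_, ?_⟩
  · simpa only [Mixed.cond, hf] using h.ket
  · simpa only [Mixed.cond, hf, hp, div_one] using h.weight

theorem Restored.nonempty {σ : QState} {L : List Qubit} {m : Mixed} (h : Restored σ L m) :
    m.index.Nonempty := by
  rw [Finset.nonempty_iff_ne_empty]
  intro h0
  have := h.weight
  simp [h0] at this

theorem Restored.update {σ : QState} {L : List Qubit} {m : Mixed} (h : Restored σ L m)
    (o : Finset Qubit) (P : Proc) : Restored σ L { m with owned := o, proc := P } :=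
  ⟨h.qubits, h.disj, h.ket, h.weight⟩

theorem restored_pure (σ : QState) (o : Finset Qubit) (P : Proc) :
    Restored σ [] (Mixed.pure σ o P) := by
  refine ⟨by simp [Mixed.pure], by simp, fun w _ => ⟨∅, by simp, fun B => ?_⟩, by simp [Mixed.pure]⟩
  simp [Mixed.pure]

/-! ## The threads of the error correction system -/

/-- The actions `As`, followed by `P`. -/
def acts (As : List Action) (P : Proc) : Proc := As.foldr .act P

@[simp] theorem acts_nil (P : Proc) : acts [] P = P := rfl

/-- Actions and their gates are kept in two parallel lists, so that a thread in the middle of a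
computation is described by what remains to be done. -/
theorem tr_acts_iff {k : ℕ} {As : List Action} {Gs : List Gate} {P R : Proc} {s : Step}
    (h : List.Forall₂ Action.IsGate As Gs) :
    Proc.Tr k (acts As P) s R ↔ (As = [] ∧ Gs = [] ∧ Proc.Tr k P s R) ∨
      ∃ A As' G Gs', As = A :: As' ∧ Gs = G :: Gs' ∧ List.Forall₂ Action.IsGate As' Gs' ∧
        s = .gate G ∧ R = acts As' P := by
  cases h with
  | nil => simp
  | @cons A G As Gs hA h =>
    have := hA k (acts As P) s R
    simp only [acts, List.foldr_cons] at this ⊢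
    rw [this]
    simp only [reduceCtorEq, false_and, false_or]
    constructor
    · rintro ⟨rfl, rfl⟩
      exact ⟨_, _, _, _, rfl, rfl, h, rfl, rfl⟩
    · rintro ⟨_, _, _, _, h1, h2, -, rfl, rfl⟩
      cases h1
      cases h2
      exact ⟨rfl, rfl⟩

/-- A qubit as an expression. -/
abbrev qv (x : Qubit) : Expr := .val (.qubit x)

/-- The outcome of measurement number `i` as a value. -/
abbrev outcome (i : ℕ) : Value := .bit fun w => w.getD i false

/-- `c![x,y,z].0` -/
def out3 (c : Chan) (x y z : Qubit) : Proc := .out c ([qv x, qv y, qv z].map .expr) .nil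

/-- `c![x].0` -/
def out1 (c : Chan) (x : Qubit) : Proc := .out c ([qv x].map .expr) .nil

def encodeActs (x y z : Qubit) : List Action := [.cnot (qv x) (qv z), .cnot (qv x) (qv y)]

def flipActs (x y z : Qubit) (j k : Value) : List Action :=
  [.xpow (qv x) (.conj (.val j) (.val k)), .xpow (qv y) (.conj (.val j) (.neg (.val k))),
    .xpow (qv z) (.conj (.neg (.val j)) (.val k))]

def syndromeActs (x y z s t : Qubit) : List Action :=
  [.cnot (qv x) (qv s), .cnot (qv y) (qv s), .cnot (qv x) (qv t), .cnot (qv z) (qv t)]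

def decodeActs (x y z : Qubit) : List Action := [.cnot (qv x) (qv y), .cnot (qv x) (qv z)]

/-- Alice, waiting for input. -/
def aliceIn (a b : Chan) (y z : Qubit) : Proc :=
  (Proc.inp a [(Name.x, .qbit)] <|
    .act (.cnot (.var Name.x) (qv z)) <| .act (.cnot (.var Name.x) (qv y)) <|
    .out b [.expr (.var Name.x), .expr (qv y), .expr (qv z)] .nil)

/-- The argument lists here and below are split at the first measurement, in the form to which
`tr_out_measure_iff` applies. -/
def rndHad1 (p : Chan) (u v : Qubit) : Proc :=
  .act (.had (qv u)) <| .act (.had (qv v)) <|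
    .out p ([].map .expr ++ .measure (qv u) :: [.measure (qv v)]) .nil

def rndHad2 (p : Chan) (u v : Qubit) : Proc :=
  .act (.had (qv v)) <| .out p ([].map .expr ++ .measure (qv u) :: [.measure (qv v)]) .nil

def rndMeas1 (p : Chan) (u v : Qubit) : Proc :=
  .out p ([].map .expr ++ .measure (qv u) :: [.measure (qv v)]) .nil

def rndMeas2 (p : Chan) (v : Qubit) (j : Value) : Proc :=
  .out p ([Expr.val j].map .expr ++ .measure (qv v) :: []) .nil

def rndOut (p : Chan) (j k : Value) : Proc :=
  .out p ([Expr.val j, Expr.val k].map .expr) .nil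

/-- The erroneous channel, waiting for the random bits. -/
def errIn (p c : Chan) (x y z : Qubit) : Proc :=
  .inp p [(Name.j, .bit), (Name.k, .bit)] <|
  .act (.xpow (qv x) (.conj (.var Name.j) (.var Name.k))) <|
  .act (.xpow (qv y) (.conj (.var Name.j) (.neg (.var Name.k)))) <|
  .act (.xpow (qv z) (.conj (.neg (.var Name.j)) (.var Name.k))) <| out3 c x y z

/-- The syndrome measurement, waiting for input. -/
def recIn (c p : Chan) (s t : Qubit) : Proc :=
  .inp c [(Name.x, .qbit), (Name.y, .qbit), (Name.z, .qbit)] <|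
  .act (.cnot (.var Name.x) (qv s)) <| .act (.cnot (.var Name.y) (qv s)) <|
  .act (.cnot (.var Name.x) (qv t)) <| .act (.cnot (.var Name.z) (qv t)) <|
  .out p [.expr (.var Name.x), .expr (.var Name.y), .expr (.var Name.z), .measure (qv s),
    .measure (qv t)] .nil

def recMeas1 (p : Chan) (x y z s t : Qubit) : Proc :=
  .out p ([qv x, qv y, qv z].map .expr ++ .measure (qv s) :: [.measure (qv t)]) .nil

def recMeas2 (p : Chan) (x y z t : Qubit) (j : Value) : Proc :=
  .out p ([qv x, qv y, qv z, .val j].map .expr ++ .measure (qv t) :: []) .nil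

def recOut (p : Chan) (x y z : Qubit) (j k : Value) : Proc :=
  .out p ([qv x, qv y, qv z, .val j, .val k].map .expr) .nil

theorem forall₂_eval_iff {vs ms : List Value} :
    List.Forall₂ (fun e m => Expr.eval e = some m) (vs.map .val) ms ↔ ms = vs := by
  induction vs generalizing ms with
  | nil => simp
  | cons v vs ih =>
    cases ms with
    | nil => simp
    | cons m ms =>
      rw [List.map_cons, List.forall₂_cons, ih, Expr.eval, Option.some.injEq, List.cons.injEq,
        eq_comm (a := v)]

theorem tr_out_val_iff {k : ℕ} {c : Chan} {vs : List Value} {P R : Proc} {s : Step} :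
    Proc.Tr k (.out c ((vs.map Expr.val).map .expr) P) s R ↔ s = .send c vs ∧ R = P := by
  rw [tr_out_iff]
  simp only [forall₂_eval_iff, exists_eq_left]

theorem tr_out_meas_val_iff {k : ℕ} {c : Chan} {es : List Expr} {q : Qubit} {rest : List Arg}
    {P R : Proc} {s : Step} :
    Proc.Tr k (.out c (es.map .expr ++ .measure (qv q) :: rest) P) s R ↔ s = .meas q ∧
      R = .out c (es.map .expr ++ .expr (.val (outcome k)) :: rest) P := by
  rw [tr_out_measure_iff]
  simp only [Expr.eval, Option.some.injEq, Value.qubit.injEq, exists_eq_left']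

theorem accepts_qbit_iff {m : Value} : Ty.Accepts .qbit m ↔ ∃ q, m = .qubit q := by
  cases m <;> simp [Ty.Accepts]

theorem accepts_bit_iff {m : Value} : Ty.Accepts .bit m ↔ ∃ f, m = .bit f := by
  cases m <;> simp [Ty.Accepts]

theorem two_eq_length {α : Type*} {l : List α} : 2 = l.length ↔ ∃ a b, l = [a, b] := by
  rw [eq_comm, List.length_eq_two]

/-! ### Instances of the continuations -/

@[simp] theorem Chan.subst_none (c : Chan) : c.subst (fun _ => none) = c := by
  cases c <;> rfl

theorem inst_alice (a b : Chan) (y z : Qubit) :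
    Proc.inst [Name.y, Name.z] [.qubit y, .qubit z]
      (.inp a [(Name.x, .qbit)] <| .act (.cnot (.var Name.x) (.var Name.z)) <|
        .act (.cnot (.var Name.x) (.var Name.y)) <|
        .out b [.expr (.var Name.x), .expr (.var Name.y), .expr (.var Name.z)] .nil) =
      aliceIn a b y z := by
  -- Substitution into an unknown channel does not reduce by computation, so it is removed first;
  -- everything else then holds definitionally.
  simp only [Proc.inst, Proc.subst, Chan.subst_none]
  rfl

theorem inst_aliceIn (b : Chan) (x y z : Qubit) :
    Proc.inst [Name.x] [.qubit x] (.act (.cnot (.var Name.x) (qv z)) <|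
      .act (.cnot (.var Name.x) (qv y)) <|
      .out b [.expr (.var Name.x), .expr (qv y), .expr (qv z)] .nil) =
      acts (encodeActs x y z) (out3 b x y z) := by
  simp only [Proc.inst, Proc.subst, Chan.subst_none]
  rfl

theorem inst_noiseRnd (p : Chan) (u v : Qubit) :
    Proc.inst [Name.u, Name.v] [.qubit u, .qubit v] (.act (.had (.var Name.u)) <|
      .act (.had (.var Name.v)) <| .out p [.measure (.var Name.u), .measure (.var Name.v)] .nil) =
      rndHad1 p u v := by
  simp only [Proc.inst, Proc.subst, Chan.subst_none]
  rfl

theorem inst_noiseErr (p c : Chan) (x y z : Qubit) :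
    Proc.inst [Name.x, Name.y, Name.z] [.qubit x, .qubit y, .qubit z]
      (.inp p [(Name.j, .bit), (Name.k, .bit)] <| flips <|
        .out c [.expr (.var Name.x), .expr (.var Name.y), .expr (.var Name.z)] .nil) =
      errIn p c x y z := by
  simp only [Proc.inst, Proc.subst, Chan.subst_none, flips]
  rfl

theorem inst_errIn (c : Chan) (x y z : Qubit) (j k : Value) :
    Proc.inst [Name.j, Name.k] [j, k]
      (.act (.xpow (qv x) (.conj (.var Name.j) (.var Name.k))) <|
        .act (.xpow (qv y) (.conj (.var Name.j) (.neg (.var Name.k)))) <|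
        .act (.xpow (qv z) (.conj (.neg (.var Name.j)) (.var Name.k))) <| out3 c x y z) =
      acts (flipActs x y z j k) (out3 c x y z) := by
  simp only [Proc.inst, Proc.subst, out3, Chan.subst_none]
  rfl

theorem inst_bobRec (c p : Chan) (s t : Qubit) :
    Proc.inst [Name.s, Name.t] [.qubit s, .qubit t]
      (.inp c [(Name.x, .qbit), (Name.y, .qbit), (Name.z, .qbit)] <|
        .act (.cnot (.var Name.x) (.var Name.s)) <| .act (.cnot (.var Name.y) (.var Name.s)) <|
        .act (.cnot (.var Name.x) (.var Name.t)) <| .act (.cnot (.var Name.z) (.var Name.t)) <|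
        .out p [.expr (.var Name.x), .expr (.var Name.y), .expr (.var Name.z),
          .measure (.var Name.s), .measure (.var Name.t)] .nil) =
      recIn c p s t := by
  simp only [Proc.inst, Proc.subst, Chan.subst_none]
  rfl

theorem inst_recIn (p : Chan) (x y z s t : Qubit) :
    Proc.inst [Name.x, Name.y, Name.z] [.qubit x, .qubit y, .qubit z]
      (.act (.cnot (.var Name.x) (qv s)) <| .act (.cnot (.var Name.y) (qv s)) <|
        .act (.cnot (.var Name.x) (qv t)) <| .act (.cnot (.var Name.z) (qv t)) <|
        .out p [.expr (.var Name.x), .expr (.var Name.y), .expr (.var Name.z), .measure (qv s),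
          .measure (qv t)] .nil) =
      acts (syndromeActs x y z s t) (recMeas1 p x y z s t) := by
  simp only [Proc.inst, Proc.subst, Chan.subst_none]
  rfl

theorem inst_bobCorr (d : Chan) (x y z : Qubit) (j k : Value) :
    Proc.inst [Name.x, Name.y, Name.z, Name.j, Name.k] [.qubit x, .qubit y, .qubit z, j, k]
      (flips <| .act (.cnot (.var Name.x) (.var Name.y)) <|
        .act (.cnot (.var Name.x) (.var Name.z)) <| .out d [.expr (.var Name.x)] .nil) =
      acts (flipActs x y z j k ++ decodeActs x y z) (out1 d x) := by
  simp only [Proc.inst, Proc.subst, Chan.subst_none, flips]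
  rfl

theorem inst_identity (d : Chan) (x : Qubit) :
    Proc.inst [Name.x] [.qubit x] (.out d [.expr (.var Name.x)] .nil) = out1 d x := by
  simp only [Proc.inst, Proc.subst, Chan.subst_none]
  rfl

/-! ### Transitions of the individual threads -/

section Threads

variable {k : ℕ} {a b c d p : Chan} {R : Proc} {S : Step} {x y z u v s t : Qubit} {i j : Value}

theorem tr_alice_iff : Proc.Tr k (Alice a b) S R ↔
    ∃ y z, S = .alloc [y, z] ∧ R = aliceIn a b y z := by
  rw [Alice, tr_qbit_iff]
  simp only [List.length_cons, List.length_nil, zero_add, Nat.reduceAdd, two_eq_length]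
  constructor
  · rintro ⟨_, ⟨y, z, rfl⟩, rfl, rfl⟩
    exact ⟨y, z, rfl, inst_alice _ _ _ _⟩
  · rintro ⟨y, z, rfl, rfl⟩
    exact ⟨_, ⟨y, z, rfl⟩, rfl, (inst_alice _ _ _ _).symm⟩

theorem tr_aliceIn_iff : Proc.Tr k (aliceIn a b y z) S R ↔
    ∃ x, S = .recv a [.qubit x] ∧ R = acts (encodeActs x y z) (out3 b x y z) := by
  rw [aliceIn, tr_inp_iff]
  simp only [List.map_cons, List.map_nil, List.forall₂_cons_left_iff, List.forall₂_nil_left_iff,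
    accepts_qbit_iff]
  constructor
  · rintro ⟨_, ⟨_, _, ⟨x, rfl⟩, rfl, rfl⟩, rfl, rfl⟩
    exact ⟨x, rfl, inst_aliceIn _ _ _ _⟩
  · rintro ⟨x, rfl, rfl⟩
    exact ⟨_, ⟨_, _, ⟨x, rfl⟩, rfl, rfl⟩, rfl, (inst_aliceIn _ _ _ _).symm⟩

theorem tr_out3_iff : Proc.Tr k (out3 c x y z) S R ↔
    S = .send c [.qubit x, .qubit y, .qubit z] ∧ R = .nil :=
  tr_out_val_iff (vs := [.qubit x, .qubit y, .qubit z])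

theorem tr_out1_iff : Proc.Tr k (out1 c x) S R ↔ S = .send c [.qubit x] ∧ R = .nil :=
  tr_out_val_iff (vs := [.qubit x])

theorem tr_noiseRnd_iff : Proc.Tr k (NoiseRnd p) S R ↔
    ∃ u v, S = .alloc [u, v] ∧ R = rndHad1 p u v := by
  rw [NoiseRnd, tr_qbit_iff]
  simp only [List.length_cons, List.length_nil, zero_add, Nat.reduceAdd, two_eq_length]
  constructor
  · rintro ⟨_, ⟨y, z, rfl⟩, rfl, rfl⟩
    exact ⟨y, z, rfl, inst_noiseRnd _ _ _⟩
  · rintro ⟨y, z, rfl, rfl⟩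
    exact ⟨_, ⟨y, z, rfl⟩, rfl, (inst_noiseRnd _ _ _).symm⟩

theorem tr_rndHad1_iff : Proc.Tr k (rndHad1 p u v) S R ↔
    S = .gate (.had u) ∧ R = rndHad2 p u v :=
  isGate_had rfl _ _ _ _

theorem tr_rndHad2_iff : Proc.Tr k (rndHad2 p u v) S R ↔
    S = .gate (.had v) ∧ R = rndMeas1 p u v :=
  isGate_had rfl _ _ _ _

theorem tr_rndMeas1_iff : Proc.Tr k (rndMeas1 p u v) S R ↔
    S = .meas u ∧ R = rndMeas2 p v (outcome k) :=
  tr_out_meas_val_iff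

theorem tr_rndMeas2_iff : Proc.Tr k (rndMeas2 p v i) S R ↔
    S = .meas v ∧ R = rndOut p i (outcome k) :=
  tr_out_meas_val_iff

theorem tr_rndOut_iff : Proc.Tr k (rndOut p i j) S R ↔ S = .send p [i, j] ∧ R = .nil :=
  tr_out_val_iff (vs := [i, j])

theorem tr_noiseErr_iff : Proc.Tr k (NoiseErr b p c) S R ↔
    ∃ x y z, S = .recv b [.qubit x, .qubit y, .qubit z] ∧ R = errIn p c x y z := by
  rw [NoiseErr, tr_inp_iff]
  simp only [List.map_cons, List.map_nil, List.forall₂_cons_left_iff, List.forall₂_nil_left_iff,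
    accepts_qbit_iff]
  constructor
  · rintro ⟨_, ⟨_, _, ⟨x, rfl⟩, ⟨_, _, ⟨y, rfl⟩, ⟨_, _, ⟨z, rfl⟩, rfl, rfl⟩, rfl⟩, rfl⟩, rfl, rfl⟩
    exact ⟨x, y, z, rfl, inst_noiseErr _ _ _ _ _⟩
  · rintro ⟨x, y, z, rfl, rfl⟩
    exact ⟨_, ⟨_, _, ⟨x, rfl⟩, ⟨_, _, ⟨y, rfl⟩, ⟨_, _, ⟨z, rfl⟩, rfl, rfl⟩, rfl⟩, rfl⟩, rfl,
      (inst_noiseErr _ _ _ _ _).symm⟩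

theorem tr_errIn_iff : Proc.Tr k (errIn p c x y z) S R ↔
    ∃ f g, S = .recv p [.bit f, .bit g] ∧
      R = acts (flipActs x y z (.bit f) (.bit g)) (out3 c x y z) := by
  rw [errIn, tr_inp_iff]
  simp only [List.map_cons, List.map_nil, List.forall₂_cons_left_iff, List.forall₂_nil_left_iff,
    accepts_bit_iff]
  constructor
  · rintro ⟨_, ⟨_, _, ⟨x, rfl⟩, ⟨_, _, ⟨y, rfl⟩, rfl, rfl⟩, rfl⟩, rfl, rfl⟩
    exact ⟨x, y, rfl, inst_errIn _ _ _ _ _ _⟩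
  · rintro ⟨x, y, rfl, rfl⟩
    exact ⟨_, ⟨_, _, ⟨x, rfl⟩, ⟨_, _, ⟨y, rfl⟩, rfl, rfl⟩, rfl⟩, rfl, (inst_errIn _ _ _ _ _ _).symm⟩

theorem tr_bobRec_iff : Proc.Tr k (BobRec c p) S R ↔
    ∃ s t, S = .alloc [s, t] ∧ R = recIn c p s t := by
  rw [BobRec, tr_qbit_iff]
  simp only [List.length_cons, List.length_nil, zero_add, Nat.reduceAdd, two_eq_length]
  constructor
  · rintro ⟨_, ⟨y, z, rfl⟩, rfl, rfl⟩
    exact ⟨y, z, rfl, inst_bobRec _ _ _ _⟩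
  · rintro ⟨y, z, rfl, rfl⟩
    exact ⟨_, ⟨y, z, rfl⟩, rfl, (inst_bobRec _ _ _ _).symm⟩

theorem tr_recIn_iff : Proc.Tr k (recIn c p s t) S R ↔
    ∃ x y z, S = .recv c [.qubit x, .qubit y, .qubit z] ∧
      R = acts (syndromeActs x y z s t) (recMeas1 p x y z s t) := by
  rw [recIn, tr_inp_iff]
  simp only [List.map_cons, List.map_nil, List.forall₂_cons_left_iff, List.forall₂_nil_left_iff,
    accepts_qbit_iff]
  constructor
  · rintro ⟨_, ⟨_, _, ⟨x, rfl⟩, ⟨_, _, ⟨y, rfl⟩, ⟨_, _, ⟨z, rfl⟩, rfl, rfl⟩, rfl⟩, rfl⟩, rfl, rfl⟩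
    exact ⟨x, y, z, rfl, inst_recIn _ _ _ _ _ _⟩
  · rintro ⟨x, y, z, rfl, rfl⟩
    exact ⟨_, ⟨_, _, ⟨x, rfl⟩, ⟨_, _, ⟨y, rfl⟩, ⟨_, _, ⟨z, rfl⟩, rfl, rfl⟩, rfl⟩, rfl⟩, rfl,
      (inst_recIn _ _ _ _ _ _).symm⟩

theorem tr_recMeas1_iff : Proc.Tr k (recMeas1 p x y z s t) S R ↔
    S = .meas s ∧ R = recMeas2 p x y z t (outcome k) :=
  tr_out_meas_val_iff

theorem tr_recMeas2_iff : Proc.Tr k (recMeas2 p x y z t i) S R ↔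
    S = .meas t ∧ R = recOut p x y z i (outcome k) :=
  tr_out_meas_val_iff

theorem tr_recOut_iff : Proc.Tr k (recOut p x y z i j) S R ↔
    S = .send p [.qubit x, .qubit y, .qubit z, i, j] ∧ R = .nil :=
  tr_out_val_iff (vs := [.qubit x, .qubit y, .qubit z, i, j])

theorem tr_bobCorr_iff : Proc.Tr k (BobCorr p d) S R ↔
    ∃ x y z f g, S = .recv p [.qubit x, .qubit y, .qubit z, .bit f, .bit g] ∧
      R = acts (flipActs x y z (.bit f) (.bit g) ++ decodeActs x y z) (out1 d x) := by
  rw [BobCorr, tr_inp_iff]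
  simp only [List.map_cons, List.map_nil, List.forall₂_cons_left_iff, List.forall₂_nil_left_iff,
    accepts_bit_iff, accepts_qbit_iff]
  constructor
  · rintro ⟨_, ⟨_, _, ⟨x, rfl⟩, ⟨_, _, ⟨y, rfl⟩, ⟨_, _, ⟨z, rfl⟩, ⟨_, _, ⟨f, rfl⟩,
      ⟨_, _, ⟨g, rfl⟩, rfl, rfl⟩, rfl⟩, rfl⟩, rfl⟩, rfl⟩, rfl, rfl⟩
    exact ⟨x, y, z, f, g, rfl, inst_bobCorr _ _ _ _ _ _⟩
  · rintro ⟨x, y, z, f, g, rfl, rfl⟩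
    exact ⟨_, ⟨_, _, ⟨x, rfl⟩, ⟨_, _, ⟨y, rfl⟩, ⟨_, _, ⟨z, rfl⟩, ⟨_, _, ⟨f, rfl⟩,
      ⟨_, _, ⟨g, rfl⟩, rfl, rfl⟩, rfl⟩, rfl⟩, rfl⟩, rfl⟩, rfl, (inst_bobCorr _ _ _ _ _ _).symm⟩

theorem tr_identity_iff : Proc.Tr k (Identity a d) S R ↔
    ∃ x, S = .recv a [.qubit x] ∧ R = out1 d x := by
  rw [Identity, tr_inp_iff]
  simp only [List.map_cons, List.map_nil, List.forall₂_cons_left_iff, List.forall₂_nil_left_iff,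
    accepts_qbit_iff]
  constructor
  · rintro ⟨_, ⟨_, _, ⟨x, rfl⟩, rfl, rfl⟩, rfl, rfl⟩
    exact ⟨x, rfl, inst_identity _ _⟩
  · rintro ⟨x, rfl, rfl⟩
    exact ⟨_, ⟨_, _, ⟨x, rfl⟩, rfl, rfl⟩, rfl, (inst_identity _ _).symm⟩

end Threads

/-! ### Gates of the threads -/

def encodeGates (x y z : Qubit) : List Gate := [.cnot x z, .cnot x y]

def flipGates (x y z : Qubit) (f g : List Bool → Bool) : List Gate :=
  [.xpow x fun w => f w && g w, .xpow y fun w => f w && !g w, .xpow z fun w => !f w && g w]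

def syndromeGates (x y z s t : Qubit) : List Gate := [.cnot x s, .cnot y s, .cnot x t, .cnot z t]

def decodeGates (x y z : Qubit) : List Gate := [.cnot x y, .cnot x z]

theorem encodeActs_isGate {x y z : Qubit} (hy : x ≠ y) (hz : x ≠ z) :
    List.Forall₂ Action.IsGate (encodeActs x y z) (encodeGates x y z) :=
  .cons (isGate_cnot rfl rfl hz) (.cons (isGate_cnot rfl rfl hy) .nil)

theorem flipActs_isGate (x y z : Qubit) (f g : List Bool → Bool) :
    List.Forall₂ Action.IsGate (flipActs x y z (.bit f) (.bit g)) (flipGates x y z f g) :=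
  .cons (isGate_xpow rfl rfl) (.cons (isGate_xpow rfl rfl) (.cons (isGate_xpow rfl rfl) .nil))

theorem syndromeActs_isGate {x y z s t : Qubit} (hxs : x ≠ s) (hys : y ≠ s) (hxt : x ≠ t)
    (hzt : z ≠ t) :
    List.Forall₂ Action.IsGate (syndromeActs x y z s t) (syndromeGates x y z s t) :=
  .cons (isGate_cnot rfl rfl hxs) (.cons (isGate_cnot rfl rfl hys)
    (.cons (isGate_cnot rfl rfl hxt) (.cons (isGate_cnot rfl rfl hzt) .nil)))

theorem decodeActs_isGate {x y z : Qubit} (hy : x ≠ y) (hz : x ≠ z) :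
    List.Forall₂ Action.IsGate (decodeActs x y z) (decodeGates x y z) :=
  .cons (isGate_cnot rfl rfl hy) (.cons (isGate_cnot rfl rfl hz) .nil)

theorem forall₂_append {α β : Type*} {r : α → β → Prop} {l₁ l₂ : List α} {m₁ m₂ : List β}
    (h₁ : List.Forall₂ r l₁ m₁) (h₂ : List.Forall₂ r l₂ m₂) :
    List.Forall₂ r (l₁ ++ l₂) (m₁ ++ m₂) := by
  induction h₁ with
  | nil => exact h₂
  | cons h _ ih => exact .cons h ih

/-- The effect of a sequence of gates on the component with index `w`. -/
noncomputable def runAll (w : List Bool) (Gs : List Gate) (ψ : Ket) : Ket :=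
  Gs.foldl (fun φ G => G.run w φ) ψ

theorem runAll_cons (w : List Bool) (G : Gate) (Gs : List Gate) (ψ : Ket) :
    runAll w (G :: Gs) ψ = runAll w Gs (G.run w ψ) := rfl

theorem runAll_nil (w : List Bool) (ψ : Ket) : runAll w [] ψ = ψ := rfl

theorem runAll_append (w : List Bool) (Gs Gs' : List Gate) (ψ : Ket) :
    runAll w (Gs ++ Gs') ψ = runAll w Gs' (runAll w Gs ψ) := List.foldl_append

/-! ### Effect of the gate sequences on codes -/

section Codes

variable {ψ : Ket} {G : Finset Qubit} {x y z s t : Qubit} {err : Bool} {f : Qubit → Bool → Bool}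
  {w : List Bool}

theorem runAll_encode (hx : x ∉ G) (hy : y ∈ G) (hz : z ∈ G) :
    runAll w (encodeGates x y z) (code ψ x G err f) = code ψ x G err
      (Function.update (Function.update f z fun b => f z b ^^ b) y
        fun b => Function.update f z (fun b => f z b ^^ b) y b ^^ b) := by
  simp only [encodeGates, runAll_cons, runAll_nil, Gate.run, code_cnot_core hx hy,
    code_cnot_core hx hz]

/-- The three exponents exclude each other, so at most one qubit is flipped. A flip of `x` changes
the argument of every ancilla function, a flip of `y` or `z` only the value of its own. The
resulting `g` is recorded only through the values needed later. -/
theorem runAll_flips (hx : x ∉ G) (hy : y ∈ G) (hz : z ∈ G) (hyz : y ≠ z)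
    (j k : List Bool → Bool) :
    ∃ g, runAll w (flipGates x y z j k) (code ψ x G err f) = code ψ x G (err ^^ (j w && k w)) g ∧
      (∀ b, g y b = (f y (b ^^ (j w && k w)) ^^ (j w && !k w))) ∧
      (∀ b, g z b = (f z (b ^^ (j w && k w)) ^^ (!j w && k w))) ∧
      ∀ r, r ≠ y → r ≠ z → ∀ b, g r b = f r (b ^^ (j w && k w)) := by
  simp only [flipGates, runAll_cons, runAll_nil, Gate.run, code_xpow_core hx,
    code_xpow_ancilla hx hy, code_xpow_ancilla hx hz]
  refine ⟨_, rfl, fun b => ?_, fun b => ?_, fun r h1 h2 b => ?_⟩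
  · simp [hyz]
  · simp [hyz.symm]
  · simp [h1, h2]

/-- Two gates add the bits of `x` and `y` to `s`, and two add those of `x` and `z` to `t`. -/
theorem runAll_syndrome (hx : x ∉ G) (hy : y ∈ G) (hz : z ∈ G) (hs : s ∈ G) (ht : t ∈ G)
    (hys : y ≠ s) (hzs : z ≠ s) (hzt : z ≠ t) (hst : s ≠ t) :
    ∃ g, runAll w (syndromeGates x y z s t) (code ψ x G err f) = code ψ x G err g ∧
      (∀ b, g s b = ((f s b ^^ b) ^^ f y b)) ∧ (∀ b, g t b = ((f t b ^^ b) ^^ f z b)) ∧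
      ∀ r, r ≠ s → r ≠ t → g r = f r := by
  simp only [syndromeGates, runAll_cons, runAll_nil, Gate.run, code_cnot_core hx hs,
    code_cnot_core hx ht, code_cnot_ancilla hx hy hs hys, code_cnot_ancilla hx hz ht hzt]
  refine ⟨_, rfl, fun b => ?_, fun b => ?_, fun r h1 h2 => ?_⟩
  · simp [hst, hys]
  · simp [hst.symm, hzt, hzs]
  · simp [h1, h2]

/-- Adding the bit `b` of `x` turns an exact copy of `b` into a constant, which disentangles `y` and
`z`. -/
theorem runAll_decode (hx : x ∉ G) (hy : y ∈ G) (hz : z ∈ G) (hyz : y ≠ z) :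
    ∃ g, runAll w (decodeGates x y z) (code ψ x G err f) = code ψ x G err g ∧
      (∀ b, g y b = (f y b ^^ b)) ∧ (∀ b, g z b = (f z b ^^ b)) ∧
      ∀ r, r ≠ y → r ≠ z → g r = f r := by
  simp only [decodeGates, runAll_cons, runAll_nil, Gate.run, code_cnot_core hx hy,
    code_cnot_core hx hz]
  refine ⟨_, rfl, fun b => ?_, fun b => ?_, fun r h1 h2 => ?_⟩
  · simp [hyz]
  · simp [hyz.symm]
  · simp [h1, h2]

end Codes

/-! ### Channels used by the threads -/

/-- `s` is no communication, and it can only send on the channels `snd` and receive on `rcv`. -/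
def Step.Within (snd rcv : Chan → Prop) : Step → Prop
  | .recv c _ => rcv c
  | .send c _ => snd c
  | .comm => False
  | _ => True

def Proc.Uses (P : Proc) (snd rcv : Chan → Prop) : Prop :=
  ∀ k s X, Proc.Tr k P s X → s.Within snd rcv

theorem uses_nil (snd rcv : Chan → Prop) : Proc.nil.Uses snd rcv := fun _ _ _ h => absurd h tr_nil

theorem uses_acts {As : List Action} {Gs : List Gate} {P : Proc} {snd rcv : Chan → Prop}
    (h : List.Forall₂ Action.IsGate As Gs) (hP : P.Uses snd rcv) : (acts As P).Uses snd rcv := by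
  intro k s X hX
  rw [tr_acts_iff h] at hX
  obtain ⟨-, -, hX⟩ | ⟨_, _, _, _, -, -, -, rfl, -⟩ := hX
  · exact hP _ _ _ hX
  · trivial

theorem wired_of_uses {k : ℕ} {a d : Chan} {A N E R C : Proc}
    (hA : A.Uses (· = .loc 1) (· = a.lift.lift)) (hN : N.Uses (· = .loc 0) fun _ => False)
    (hE : E.Uses (· = .loc 1) fun c => c = .loc 2 ∨ c = .loc 0)
    (hR : R.Uses (· = .loc 0) (· = .loc 1)) (hC : C.Uses (· = d.lift.lift.lift) (· = .loc 0))
    (hAC : A = .nil ∨ C = BobCorr (.loc 0) d.lift.lift.lift) : Wired k a d A N E R C where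
  A_comm h := hA _ _ _ h
  N_comm h := hN _ _ _ h
  E_comm h := hE _ _ _ h
  R_comm h := hR _ _ _ h
  C_comm h := hC _ _ _ h
  A_send h := hA _ _ _ h
  A_recv h := hA _ _ _ h
  N_send h := hN _ _ _ h
  N_recv h := hN _ _ _ h
  E_send h := hE _ _ _ h
  E_recv h := hE _ _ _ h
  R_send h := hR _ _ _ h
  R_recv h := hR _ _ _ h
  C_send h := hC _ _ _ h
  C_recv h := hC _ _ _ h
  A_or_C := by
    rcases hAC with rfl | rfl
    · exact .inl fun h => tr_nil h
    · refine .inr fun h => ?_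
      rw [tr_bobCorr_iff] at h
      obtain ⟨_, _, _, _, _, h, -⟩ := h
      simp at h

/-! ## Internal transitions terminate -/

def Arg.size : Arg → ℕ
  | .expr _ => 0
  | .measure _ => 1

/-- The number of prefixes and measurements of a term. -/
def Proc.size : Proc → ℕ
  | .nil => 0
  | .par P Q => P.size + Q.size
  | .inp _ _ P => P.size + 1
  | .out _ es P => P.size + (es.map Arg.size).sum + 1
  | .act _ P => P.size + 1
  | .new P => P.size
  | .qbit _ P => P.size + 1

theorem Proc.size_subst (P : Proc) (θ : Var → Option Value) (η : Var → Option ℕ) :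
    (P.subst θ η).size = P.size := by
  have h : ∀ (θ : Var → Option Value), Arg.size ∘ Arg.subst θ = Arg.size := by
    intro θ
    funext e
    cases e <;> rfl
  induction P generalizing θ <;> simp_all [Proc.subst, Proc.size]

/-- There is no recursion: a step consumes a prefix or turns a measured argument into a plain one.
Measurements are counted separately because the latter keeps the output prefix. -/
theorem Proc.Tr.size_lt {k : ℕ} {P P' : Proc} {s : Step} (h : P.Tr k s P') : P'.size < P.size := by
  induction h <;> simp_all [Proc.size, Proc.inst, Proc.size_subst, Arg.size] <;> omega

theorem Trans.size_lt {m m' : Mixed} (h : Trans (.mix m) .tau (.mix m')) :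
    m'.proc.size < m.proc.size := by
  cases h with
  | comm h => exact h.size_lt
  | gate h _ => exact h.size_lt
  | meas h _ => exact h.size_lt
  | alloc h _ _ => exact h.size_lt

/-- If a set of configurations is closed under `τ` and all its members outside `T` have `τ`
transitions, then `T` can be reached. -/
theorem exists_weak {K T : Mixed → Prop}
    (hK : ∀ m s, K m → Trans (.mix m) .tau s → ∃ m', s = .mix m' ∧ K m')
    (hT : ∀ m, K m → T m ∨ ∃ s, Trans (.mix m) .tau s) {m : Mixed} (hm : K m) :
    ∃ m', Weak (.mix m) (.mix m') ∧ K m' ∧ T m' := by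
  -- The size of the term decreases with each internal step, which makes the induction well founded.
  induction hn : m.proc.size using Nat.strong_induction_on generalizing m with
  | _ n ih =>
    subst hn
    rcases hT m hm with h | ⟨s, hs⟩
    · exact ⟨m, .refl, hm, h⟩
    · obtain ⟨m₁, rfl, h₁⟩ := hK m s hm hs
      obtain ⟨m₂, hw, h₂⟩ := ih _ hs.size_lt h₁ rfl
      exact ⟨m₂, .head hs hw, h₂⟩

/-! ## Qubits of reachable configurations -/

/-- The qubits of `m` are those of `σ`, of which `ω` are owned, and the owned ancillas `G`. -/
structure Layout (σ : QState) (ω : Finset Qubit) (m : Mixed) (G : Finset Qubit) : Prop where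
  qubits : ∃ L, m.qubits = σ.qubits ++ L ∧ L.toFinset = G
  disj : Disjoint σ.qubits.toFinset G
  owned : m.owned = ω ∪ G

section Layout

variable {σ : QState} {ω G : Finset Qubit} {m : Mixed}

theorem Layout.toFinset (h : Layout σ ω m G) : m.qubits.toFinset = σ.qubits.toFinset ∪ G := by
  obtain ⟨L, h1, h2⟩ := h.qubits
  rw [h1, List.toFinset_append, h2]

theorem Layout.subset_owned (h : Layout σ ω m G) : G ⊆ m.owned :=
  h.owned ▸ Finset.subset_union_right

theorem Layout.base_subset_owned (h : Layout σ ω m G) : ω ⊆ m.owned :=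
  h.owned ▸ Finset.subset_union_left

theorem Layout.notMem (h : Layout σ ω m G) {x : Qubit} (hx : x ∈ σ.qubits) : x ∉ G :=
  Finset.disjoint_left.1 h.disj (by simpa using hx)

theorem Layout.alloc (h : Layout σ ω m G) {qs : List Qubit} (hqs : ∀ q ∈ qs, q ∉ m.qubits)
    (P : Proc) :
    Layout σ ω { m with qubits := m.qubits ++ qs, owned := m.owned ∪ qs.toFinset, proc := P }
      (G ∪ qs.toFinset) where
  qubits := by
    obtain ⟨L, h1, h2⟩ := h.qubits
    exact ⟨L ++ qs, by simp [h1], by simp [h2]⟩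
  disj := by
    rw [Finset.disjoint_union_right]
    refine ⟨h.disj, Finset.disjoint_left.2 fun q h1 h2 => hqs q (by simpa using h2) ?_⟩
    obtain ⟨L, h3, -⟩ := h.qubits
    rw [h3]
    exact List.mem_append_left _ (by simpa using h1)
  owned := by simp [h.owned, Finset.union_assoc]

theorem Layout.disjoint_fresh (h : Layout σ ω m G) {qs : List Qubit}
    (hqs : ∀ q ∈ qs, q ∉ m.qubits) : Disjoint G qs.toFinset := by
  refine Finset.disjoint_left.2 fun q h1 h2 => hqs q (by simpa using h2) ?_
  obtain ⟨L, h3, h4⟩ := h.qubits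
  rw [h3]
  refine List.mem_append_right _ ?_
  rw [← h4] at h1
  simpa using h1

theorem exists_fresh_pair (l : List Qubit) :
    ∃ y z, [y, z].Nodup ∧ ∀ q ∈ [y, z], q ∉ l := by
  obtain ⟨y, hy⟩ := Infinite.exists_notMem_finset l.toFinset
  obtain ⟨z, hz⟩ := Infinite.exists_notMem_finset (insert y l.toFinset)
  simp only [List.mem_toFinset, Finset.mem_insert, not_or] at hy hz
  exact ⟨y, z, by simpa using Ne.symm hz.1, by simp [hy, hz.2]⟩

end Layout

/-! ## Mixtures over two random bits -/

/-- `m` is a mixture with four components, given by two random bits `j`, `k`, such that after the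
remaining gates `Gs` the components are codes. -/
structure Branches (σ : QState) (ω : Finset Qubit) (x : Qubit) (m : Mixed) (G H : Finset Qubit)
    (n : ℕ) (e : Bool → Bool → List Bool) (Gs : List Gate) (err : Bool → Bool → Bool)
    (good : Bool → Bool → (Qubit → Bool → Bool) → Prop) : Prop where
  layout : Layout σ ω m G
  mem_qubits : x ∈ σ.qubits
  mem_owned : x ∈ ω
  subset : H ⊆ G
  depth : m.depth = n
  index : m.index = Finset.univ.image fun jk : Bool × Bool => e jk.1 jk.2
  weight : ∀ j k, m.weight (e j k) = 1 / 4
  gates : ∀ g ∈ Gs, g.qubits ⊆ insert x H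
  ket : ∀ j k, ∃ f, runAll (e j k) Gs (m.ket (e j k)) = code σ.ket x H (err j k) f ∧ good j k f

section Branches

variable {σ : QState} {ω : Finset Qubit} {x : Qubit} {m : Mixed} {G H : Finset Qubit} {n : ℕ}
  {e : Bool → Bool → List Bool} {g : Gate} {Gs : List Gate} {err : Bool → Bool → Bool}
  {good : Bool → Bool → (Qubit → Bool → Bool) → Prop}

theorem Branches.gate_owned (h : Branches σ ω x m G H n e Gs err good) (hg : g ∈ Gs) :
    g.qubits ⊆ m.owned := by
  refine (h.gates g hg).trans (Finset.insert_subset ?_ (h.subset.trans h.layout.subset_owned))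
  exact h.layout.base_subset_owned h.mem_owned

/-- The invariant describes each ket after the remaining gates. Performing the first of them only
moves it from the list into the ket, so the statement about kets stays the same. -/
theorem Branches.gate (h : Branches σ ω x m G H n e (g :: Gs) err good) (P : Proc) :
    Branches σ ω x { m with ket := fun w => g.run w (m.ket w), proc := P } G H n e Gs err good where
  layout := ⟨h.layout.qubits, h.layout.disj, h.layout.owned⟩
  mem_qubits := h.mem_qubits
  mem_owned := h.mem_owned
  subset := h.subset
  depth := h.depth
  index := h.index
  weight := h.weight
  gates g' hg' := h.gates g' (List.mem_cons_of_mem _ hg')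
  ket := h.ket

/-- New qubits enlarge the owned ancillas `G` but not the ancillas `H` of the code; `Branches.next`
admits them when they are first used. -/
theorem Branches.alloc (h : Branches σ ω x m G H n e Gs err good) {qs : List Qubit}
    (hqs : ∀ q ∈ qs, q ∉ m.qubits) (P : Proc) :
    Branches σ ω x { m with
      qubits := m.qubits ++ qs, owned := m.owned ∪ qs.toFinset, proc := P }
      (G ∪ qs.toFinset) H n e Gs err good where
  layout := h.layout.alloc hqs P
  mem_qubits := h.mem_qubits
  mem_owned := h.mem_owned
  subset := h.subset.trans Finset.subset_union_left
  depth := h.depth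
  index := h.index
  weight := h.weight
  gates := h.gates
  ket := h.ket

/-- When all gates have been applied, further gates can be considered. -/
theorem Branches.next (h : Branches σ ω x m G H n e [] err good) {H' : Finset Qubit} (hH' : H' ⊆ G)
    {Gs' : List Gate} (hG : ∀ g ∈ Gs', g.qubits ⊆ insert x H') {err' : Bool → Bool → Bool}
    {good' : Bool → Bool → (Qubit → Bool → Bool) → Prop}
    (hk : ∀ j k f, good j k f → ∃ f', runAll (e j k) Gs' (code σ.ket x H (err j k) f) =
      code σ.ket x H' (err' j k) f' ∧ good' j k f') (P : Proc) :
    Branches σ ω x { m with proc := P } G H' n e Gs' err' good' where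
  layout := ⟨h.layout.qubits, h.layout.disj, h.layout.owned⟩
  mem_qubits := h.mem_qubits
  mem_owned := h.mem_owned
  subset := hH'
  depth := h.depth
  index := h.index
  weight := h.weight
  gates := hG
  ket j k := by
    obtain ⟨f, h1, h2⟩ := h.ket j k
    obtain ⟨f', h3, h4⟩ := hk j k f h2
    refine ⟨f', ?_, h4⟩
    rw [← h3, ← h1]
    rfl

/-- The measurement of a qubit that has a definite value in every component. -/
theorem Branches.measure (h : Branches σ ω x m G G n e [] err good) {s : Qubit} (hs : s ∈ G)
    {β : Bool → Bool → Bool} (hβ : ∀ j k f, good j k f → ∀ b, f s b = β j k)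
    (hinj : ∀ j k j' k', e j k = e j' k' → j = j' ∧ k = k') (P : Proc) :
    Branches σ ω x { m.measure s with proc := P } G G (n + 1) (fun j k => e j k ++ [β j k]) []
      err good := by
  have hst : ∀ j k, (m.ket (e j k)).IsState m.qubits.toFinset := by
    intro j k
    obtain ⟨f, h1, -⟩ := h.ket j k
    rw [runAll_nil] at h1
    rw [h1, h.layout.toFinset]
    exact code_isState σ.isState (by simpa using h.mem_qubits) h.layout.disj _ _
  have hdef : ∀ j k B, m.ket (e j k) B ≠ 0 → decide (s ∈ B) = β j k := by
    intro j k B hB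
    obtain ⟨f, h1, h2⟩ := h.ket j k
    rw [runAll_nil] at h1
    rw [h1] at hB
    unfold code at hB
    rw [ne_eq, ite_eq_right_iff, Classical.not_imp] at hB
    rw [hB.1 s hs, hβ j k f h2]
  have hborn : ∀ j k b, (m.ket (e j k)).born m.qubits s b = if b = β j k then 1 else 0 :=
    fun j k b => Ket.born_of_definite (hst j k) (hdef j k) b
  -- The outcome is needed as a function of the label of the component. Since distinct `(j, k)` have
  -- distinct labels, it extends to all labels.
  obtain ⟨γ, hγ⟩ : ∃ γ : List Bool → Bool, ∀ j k, γ (e j k) = β j k := by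
    have hinj' : Function.Injective fun jk : Bool × Bool => e jk.1 jk.2 := by
      rintro ⟨j, k⟩ ⟨j', k'⟩ h
      obtain ⟨rfl, rfl⟩ := hinj _ _ _ _ h
      rfl
    exact ⟨Function.extend _ (fun jk : Bool × Bool => β jk.1 jk.2) fun _ => false,
      fun j k => hinj'.extend_apply _ _ (j, k)⟩
  exact
  { layout := ⟨h.layout.qubits, h.layout.disj, h.layout.owned⟩
    mem_qubits := h.mem_qubits
    mem_owned := h.mem_owned
    subset := h.subset
    depth := congrArg (· + 1) h.depth
    index := by
      have := measure_index_definite (m := m) (q := s) (β := γ) (by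
        intro w hw b
        rw [h.index, Finset.mem_image] at hw
        obtain ⟨⟨j, k⟩, -, rfl⟩ := hw
        rw [hborn, hγ])
      dsimp only
      rw [this, h.index, Finset.image_image]
      congr 1
      funext jk
      simp [hγ]
    weight := fun j k => by
      dsimp only
      rw [measure_weight_append, hborn, h.weight]
      simp
    gates := by simp
    ket := fun j k => by
      obtain ⟨f, h1, h2⟩ := h.ket j k
      refine ⟨f, ?_, h2⟩
      rw [← h1, runAll_nil, runAll_nil]
      dsimp only
      rw [measure_ket_append, Ket.collapse_of_definite (hst j k) (hdef j k)] }

/-- With the error flag cleared and constant ancilla bits, `code_const` gives the basis state of the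
ancillas, which may differ from component to component. The four weights `1/4` add up to one. -/
theorem Branches.restored (h : Branches σ ω x m G G n e [] (fun _ _ => false) good)
    (hgood : ∀ j k f, good j k f → ∀ r ∈ G, ∀ b, f r b = f r false)
    (hinj : ∀ j k j' k', e j k = e j' k' → j = j' ∧ k = k') :
    ∃ L, L.toFinset = G ∧ Restored σ L m := by
  obtain ⟨L, h1, h2⟩ := h.layout.qubits
  refine ⟨L, h2, h1, h2 ▸ h.layout.disj, fun w hw => ?_, ?_⟩
  · rw [h.index, Finset.mem_image] at hw
    obtain ⟨⟨j, k⟩, -, rfl⟩ := hw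
    obtain ⟨f, h3, h4⟩ := h.ket j k
    rw [runAll_nil] at h3
    rw [h2]
    refine ⟨G.filter fun r => f r false = true, Finset.filter_subset _ _, fun B => ?_⟩
    dsimp only
    rw [h3, code_const (hgood j k f h4)]
  · rw [h.index, Finset.sum_image]
    · simp only [h.weight]
      simp
    · rintro ⟨j, k⟩ - ⟨j', k'⟩ - h
      obtain ⟨rfl, rfl⟩ := hinj _ _ _ _ h
      rfl

end Branches

/-! ## Configurations of the system before the random bits are used -/

/-- The main thread before the random bits are used: the terms of Alice and of the erroneous
channel, the ancillas of the code and the main part of the state. The first argument is the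
qubit that has been input. -/
inductive EarlyMain (σ : QState) (a : Chan) :
    Option Qubit → Proc → Proc → Finset Qubit → Ket → Prop
  | start : EarlyMain σ a none (Alice a.lift.lift (.loc 1)) (NoiseErr (.loc 2) (.loc 0) (.loc 1))
      ∅ σ.ket
  | ready {y z : Qubit} (hyz : y ≠ z) : EarlyMain σ a none (aliceIn a.lift.lift (.loc 1) y z)
      (NoiseErr (.loc 2) (.loc 0) (.loc 1)) {y, z} σ.ket
  | encode {x y z : Qubit} {As : List Action} {Gs : List Gate} {err : Bool}
      {f : Qubit → Bool → Bool} (hyz : y ≠ z)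
      (hx : x ∈ σ.qubits) (hAs : List.Forall₂ Action.IsGate As Gs)
      (hGs : ∀ g ∈ Gs, ∃ r ∈ ({y, z} : Finset Qubit), g = .cnot x r)
      (hrun : runAll [] Gs (code σ.ket x {y, z} err f) =
        code σ.ket x {y, z} false fun _ b => b) :
      EarlyMain σ a (some x) (acts As (out3 (.loc 1) x y z))
        (NoiseErr (.loc 2) (.loc 0) (.loc 1)) {y, z} (code σ.ket x {y, z} err f)
  | sent {x y z : Qubit} (hyz : y ≠ z) (hx : x ∈ σ.qubits) :
      EarlyMain σ a (some x) .nil (errIn (.loc 0) (.loc 1) x y z) {y, z}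
        (code σ.ket x {y, z} false fun _ b => b)

/-- The noise source: its term, its qubits, the mixture and the state of its qubits. -/
inductive Rnd :
    Proc → Finset Qubit → Finset (List Bool) → ℝ → ℕ → (List Bool → Ket) → Prop
  | start : Rnd (NoiseRnd (.loc 0)) ∅ {[]} 1 0 fun _ _ => 1
  | had1 {u v : Qubit} (huv : u ≠ v) :
      Rnd (rndHad1 (.loc 0) u v) {u, v} {[]} 1 0 fun _ => rnd00 u v
  | had2 {u v : Qubit} (huv : u ≠ v) :
      Rnd (rndHad2 (.loc 0) u v) {u, v} {[]} 1 0 fun _ => rndPlus0 v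
  | meas1 {u v : Qubit} (huv : u ≠ v) :
      Rnd (rndMeas1 (.loc 0) u v) {u, v} {[]} 1 0 fun _ => rndPlusPlus
  | meas2 {u v : Qubit} (huv : u ≠ v) :
      Rnd (rndMeas2 (.loc 0) v (outcome 0)) {u, v} (Finset.univ.image fun j => [j]) (1 / 2) 1
        fun w => rndBitPlus u (w.getD 0 false)
  | out {u v : Qubit} (huv : u ≠ v) :
      Rnd (rndOut (.loc 0) (outcome 0) (outcome 1)) {u, v}
        (Finset.univ.image fun jk : Bool × Bool => [jk.1, jk.2]) (1 / 4) 2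
        fun w => rndBits u v (w.getD 0 false) (w.getD 1 false)

/-- The syndrome measurement before it is used. -/
inductive Rec : Proc → Finset Qubit → Prop
  | start : Rec (BobRec (.loc 1) (.loc 0)) ∅
  | ready {s t : Qubit} (hst : s ≠ t) : Rec (recIn (.loc 1) (.loc 0) s t) {s, t}

/-- The final correction before it is used. -/
abbrev corr (d : Chan) : Proc := BobCorr (.loc 0) d.lift.lift.lift

/-- The sets `Y`, `F`, `S` contain the ancillas of Alice, of the noise source and of Bob. All
components have the same weight and the same main part `Φ`; only the factor `ν w` of the noise
source depends on the outcomes. Bob's qubits are still in the ground state and need no factor. -/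
structure EarlyData (σ : QState) (ω : Finset Qubit) (m : Mixed) (Y F S : Finset Qubit)
    (I : Finset (List Bool)) (wt : ℝ) (n : ℕ) (ν : List Bool → Ket) (Φ : Ket) : Prop where
  layout : Layout σ ω m (Y ∪ F ∪ S)
  YF : Disjoint Y F
  YS : Disjoint Y S
  FS : Disjoint F S
  depth : m.depth = n
  index : m.index = I
  weight : ∀ w ∈ I, m.weight w = wt
  ket : ∀ w ∈ I, m.ket w = tens F (ν w) Φ

def inputSet (q : Option Qubit) : Finset Qubit := q.elim ∅ fun x => {x}

/-- The configurations of the system before the random bits are used. -/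
def Early (σ : QState) (ω : Finset Qubit) (a d : Chan) (q : Option Qubit) (m : Mixed) : Prop :=
  ∃ A N E R Y F S I wt n ν Φ, m.proc = net A N E R (corr d) ∧ EarlyMain σ a q A E Y Φ ∧
    Rnd N F I wt n ν ∧ Rec R S ∧ EarlyData σ (ω ∪ inputSet q) m Y F S I wt n ν Φ

/-- What is known about the code after the errors. -/
def GoodErr (y z u v : Qubit) (j k : Bool) (f : Qubit → Bool → Bool) : Prop :=
  (∀ b, f y b = (b ^^ j)) ∧ (∀ b, f z b = (b ^^ k)) ∧ (∀ b, f u b = j) ∧ ∀ b, f v b = k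

/-- The configurations in which the erroneous channel works. -/
def Mid (σ : QState) (ω : Finset Qubit) (d : Chan) (x : Qubit) (m : Mixed) : Prop :=
  ∃ y z u v R S As Gs, m.proc = net .nil .nil (acts As (out3 (.loc 1) x y z)) R (corr d) ∧
    y ≠ z ∧ u ≠ v ∧ Disjoint ({y, z} : Finset Qubit) {u, v} ∧ Disjoint ({y, z} ∪ {u, v}) S ∧
    Rec R S ∧ List.Forall₂ Action.IsGate As Gs ∧
    Branches σ (ω ∪ {x}) x m ({y, z} ∪ {u, v} ∪ S) ({y, z} ∪ {u, v}) 2 (fun j k => [j, k]) Gs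
      (fun j k => j && k) (GoodErr y z u v)

/-! ### Single operations before the random bits are used -/

section Early

variable {σ : QState} {ω : Finset Qubit} {m : Mixed} {Y F S : Finset Qubit}
  {I : Finset (List Bool)} {wt : ℝ} {n : ℕ} {ν : List Bool → Ket} {Φ : Ket}

theorem EarlyMain.isState {a : Chan} {q : Option Qubit} {A E : Proc}
    (h : EarlyMain σ a q A E Y Φ) (hY : Disjoint σ.qubits.toFinset Y) :
    Φ.IsState (σ.qubits.toFinset ∪ Y) := by
  cases h with
  | start => exact σ.isState.mono Finset.subset_union_left
  | ready => exact σ.isState.mono Finset.subset_union_left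
  | encode _ hx => exact code_isState σ.isState (by simpa using hx) hY _ _
  | sent _ hx => exact code_isState σ.isState (by simpa using hx) hY _ _

theorem EarlyData.disjoint_Y (h : EarlyData σ ω m Y F S I wt n ν Φ) :
    Disjoint σ.qubits.toFinset Y :=
  h.layout.disj.mono_right (Finset.subset_union_left.trans Finset.subset_union_left)

theorem EarlyData.disjoint_F (h : EarlyData σ ω m Y F S I wt n ν Φ) :
    Disjoint (σ.qubits.toFinset ∪ Y ∪ S) F := by
  simp only [Finset.disjoint_union_left]
  exact ⟨⟨h.layout.disj.mono_right (Finset.subset_union_right.trans Finset.subset_union_left),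
    h.YF⟩, h.FS.symm⟩

theorem EarlyData.toFinset (h : EarlyData σ ω m Y F S I wt n ν Φ) :
    m.qubits.toFinset = σ.qubits.toFinset ∪ Y ∪ S ∪ F := by
  rw [h.layout.toFinset]
  ext
  simp
  tauto

theorem EarlyData.update (h : EarlyData σ ω m Y F S I wt n ν Φ) (P : Proc) :
    EarlyData σ ω { m with proc := P } Y F S I wt n ν Φ :=
  ⟨⟨h.layout.qubits, h.layout.disj, h.layout.owned⟩, h.YF, h.YS, h.FS, h.depth, h.index, h.weight,
    h.ket⟩

theorem EarlyData.alloc_Y (h : EarlyData σ ω m ∅ F S I wt n ν Φ) {qs : List Qubit}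
    (hqs : ∀ q ∈ qs, q ∉ m.qubits) (P : Proc) :
    EarlyData σ ω { m with
      qubits := m.qubits ++ qs, owned := m.owned ∪ qs.toFinset, proc := P }
      qs.toFinset F S I wt n ν Φ := by
  have h1 := h.layout.alloc hqs P
  have h2 := (h.layout.disjoint_fresh hqs).symm
  rw [Finset.disjoint_union_right, Finset.disjoint_union_right] at h2
  rw [show ∅ ∪ F ∪ S ∪ qs.toFinset = qs.toFinset ∪ F ∪ S by ext; simp; tauto] at h1
  exact ⟨h1, h2.1.2, h2.2, h.FS, h.depth, h.index, h.weight, h.ket⟩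

theorem EarlyData.alloc_S (h : EarlyData σ ω m Y F ∅ I wt n ν Φ) {qs : List Qubit}
    (hqs : ∀ q ∈ qs, q ∉ m.qubits) (P : Proc) :
    EarlyData σ ω { m with
      qubits := m.qubits ++ qs, owned := m.owned ∪ qs.toFinset, proc := P }
      Y F qs.toFinset I wt n ν Φ := by
  have h1 := h.layout.alloc hqs P
  have h2 := h.layout.disjoint_fresh hqs
  rw [Finset.disjoint_union_left, Finset.disjoint_union_left] at h2
  rw [Finset.union_empty] at h1
  exact ⟨h1, h.YF, h2.1.1, h2.1.2, h.depth, h.index, h.weight, h.ket⟩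

theorem EarlyData.alloc_F (h : EarlyData σ ω m Y ∅ S {[]} wt n (fun _ _ => 1) Φ) {u v : Qubit}
    (hΦ : Φ.IsState (σ.qubits.toFinset ∪ Y))
    (hqs : ∀ q ∈ [u, v], q ∉ m.qubits) (P : Proc) :
    EarlyData σ ω { m with
      qubits := m.qubits ++ [u, v], owned := m.owned ∪ [u, v].toFinset, proc := P }
      Y {u, v} S {[]} wt n (fun _ => rnd00 u v) Φ := by
  have h1 := h.layout.alloc hqs P
  have h2 := h.layout.disjoint_fresh hqs
  rw [show [u, v].toFinset = {u, v} by simp] at h1 h2 ⊢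
  have h3 := h1.disj
  rw [Finset.disjoint_union_left, Finset.disjoint_union_left] at h2
  rw [Finset.disjoint_union_right] at h3
  rw [show Y ∪ ∅ ∪ S ∪ {u, v} = Y ∪ {u, v} ∪ S by ext; simp] at h1
  refine ⟨h1, h2.1.1, h.YS, h2.2.symm, h.depth, h.index, h.weight, fun w hw => ?_⟩
  dsimp only
  -- Before the allocation the noise factor is trivial, and afterwards it is `|00⟩`; neither changes
  -- the ket `Φ`.
  rw [h.ket w hw, tens_empty rfl, tens_ground hΦ]
  · rw [Finset.disjoint_union_left]
    exact ⟨h3.2, h2.1.1⟩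
  · simp [rnd00]
  · intro T hT hne
    obtain ⟨r, hr⟩ := Finset.nonempty_iff_ne_empty.2 hne
    have := hT hr
    simp only [Finset.mem_insert, Finset.mem_singleton] at this
    rcases this with rfl | rfl <;> simp [rnd00, hr]

theorem EarlyData.cnot (h : EarlyData σ ω m Y F S I wt n ν Φ) {x r : Qubit} (hx : x ∉ F)
    (hr : r ∉ F) (P : Proc) :
    EarlyData σ ω { m with ket := fun w => (Gate.cnot x r).run w (m.ket w), proc := P }
      Y F S I wt n ν (Φ.cnot x r) where
  layout := ⟨h.layout.qubits, h.layout.disj, h.layout.owned⟩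
  YF := h.YF
  YS := h.YS
  FS := h.FS
  depth := h.depth
  index := h.index
  weight := h.weight
  ket w hw := by
    dsimp only [Gate.run]
    rw [h.ket w hw, tens_cnot hx hr]

theorem EarlyData.had (h : EarlyData σ ω m Y F S I wt n ν Φ) {u : Qubit} (hu : u ∈ F) (P : Proc) :
    EarlyData σ ω { m with ket := fun w => (Gate.had u).run w (m.ket w), proc := P }
      Y F S I wt n (fun w => (ν w).had u) Φ where
  layout := ⟨h.layout.qubits, h.layout.disj, h.layout.owned⟩
  YF := h.YF
  YS := h.YS
  FS := h.FS
  depth := h.depth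
  index := h.index
  weight := h.weight
  ket w hw := by
    dsimp only [Gate.run]
    rw [h.ket w hw, tens_had hu]

/-- The measured qubit lies in the noise factor, so `Φ` is undisturbed. Both outcomes have
probability `1/2`, so every component splits and the common weight is halved. -/
theorem EarlyData.measure (h : EarlyData σ ω m Y F S I wt n ν Φ) {u : Qubit} (hu : u ∈ F)
    (hΦ : Φ.IsState (σ.qubits.toFinset ∪ Y))
    (hν : ∀ w b, ∑ S ∈ F.powerset with decide (u ∈ S) = b, ‖ν w S‖ ^ 2 = 1 / 2)
    {ν' : List Bool → Ket}
    (hν' : ∀ w ∈ I, ∀ b, (fun S => if decide (u ∈ S) = b then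
      ν w S / (Real.sqrt (1 / 2) : ℂ) else 0) = ν' (w ++ [b])) (P : Proc) :
    EarlyData σ ω { m.measure u with proc := P } Y F S
      ((I ×ˢ Finset.univ).image fun wb => wb.1 ++ [wb.2]) (wt / 2) (n + 1) ν' Φ := by
  have hborn : ∀ w ∈ I, ∀ b, (m.ket w).born m.qubits u b = 1 / 2 := by
    intro w hw b
    rw [h.ket w hw, born_tens (hΦ.mono Finset.subset_union_left) h.disjoint_F h.toFinset hu, hν]
  exact
  { layout := ⟨h.layout.qubits, h.layout.disj, h.layout.owned⟩
    YF := h.YF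
    YS := h.YS
    FS := h.FS
    depth := congrArg (· + 1) h.depth
    index := by
      dsimp only
      rw [measure_index_uniform (by rwa [h.index]), h.index]
    weight := by
      intro w' hw'
      rw [Finset.mem_image] at hw'
      obtain ⟨⟨w, b⟩, hw, rfl⟩ := hw'
      have hw := (Finset.mem_product.1 hw).1
      dsimp only at hw ⊢
      rw [measure_weight_append, hborn w hw, h.weight w hw]
      ring
    ket := by
      intro w' hw'
      rw [Finset.mem_image] at hw'
      obtain ⟨⟨w, b⟩, hw, rfl⟩ := hw'
      have hw := (Finset.mem_product.1 hw).1
      dsimp only at hw ⊢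
      have h1 := hborn w hw b
      rw [h.ket w hw] at h1
      rw [measure_ket_append, h.ket w hw, collapse_tens hu, h1, hν' w hw] }

theorem EarlyMain.uses {a : Chan} {q : Option Qubit} {A E : Proc} (h : EarlyMain σ a q A E Y Φ) :
    A.Uses (· = .loc 1) (· = a.lift.lift) ∧
      E.Uses (· = .loc 1) fun c => c = .loc 2 ∨ c = .loc 0 := by
  cases h with
  | start =>
    refine ⟨fun k s X h => ?_, fun k s X h => ?_⟩
    · rw [tr_alice_iff] at h
      obtain ⟨_, _, rfl, -⟩ := h
      trivial
    · rw [tr_noiseErr_iff] at h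
      obtain ⟨_, _, _, rfl, -⟩ := h
      exact .inl rfl
  | ready =>
    refine ⟨fun k s X h => ?_, fun k s X h => ?_⟩
    · rw [tr_aliceIn_iff] at h
      obtain ⟨_, rfl, -⟩ := h
      rfl
    · rw [tr_noiseErr_iff] at h
      obtain ⟨_, _, _, rfl, -⟩ := h
      exact .inl rfl
  | encode _ _ hAs =>
    refine ⟨uses_acts hAs fun k s X h => ?_, fun k s X h => ?_⟩
    · rw [tr_out3_iff] at h
      obtain ⟨rfl, -⟩ := h
      rfl
    · rw [tr_noiseErr_iff] at h
      obtain ⟨_, _, _, rfl, -⟩ := h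
      exact .inl rfl
  | sent =>
    refine ⟨uses_nil _ _, fun k s X h => ?_⟩
    rw [tr_errIn_iff] at h
    obtain ⟨_, _, rfl, -⟩ := h
    exact .inr rfl

theorem Rnd.uses {N : Proc} (h : Rnd N F I wt n ν) :
    N.Uses (· = .loc 0) fun _ => False := by
  intro k s X hX
  cases h with
  | start =>
    rw [tr_noiseRnd_iff] at hX
    obtain ⟨_, _, rfl, -⟩ := hX
    trivial
  | had1 =>
    rw [tr_rndHad1_iff] at hX
    obtain ⟨rfl, -⟩ := hX
    trivial
  | had2 =>
    rw [tr_rndHad2_iff] at hX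
    obtain ⟨rfl, -⟩ := hX
    trivial
  | meas1 =>
    rw [tr_rndMeas1_iff] at hX
    obtain ⟨rfl, -⟩ := hX
    trivial
  | meas2 =>
    rw [tr_rndMeas2_iff] at hX
    obtain ⟨rfl, -⟩ := hX
    trivial
  | out =>
    rw [tr_rndOut_iff] at hX
    obtain ⟨rfl, -⟩ := hX
    rfl

theorem Rec.uses {R : Proc} (h : Rec R S) : R.Uses (· = .loc 0) (· = .loc 1) := by
  intro k s X hX
  cases h with
  | start =>
    rw [tr_bobRec_iff] at hX
    obtain ⟨_, _, rfl, -⟩ := hX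
    trivial
  | ready =>
    rw [tr_recIn_iff] at hX
    obtain ⟨_, _, _, rfl, -⟩ := hX
    rfl

theorem corr_uses (d : Chan) : (corr d).Uses (· = d.lift.lift.lift) (· = .loc 0) := by
  intro k s X hX
  rw [tr_bobCorr_iff] at hX
  obtain ⟨_, _, _, _, _, rfl, -⟩ := hX
  rfl

end Early

/-! ### Internal steps before the random bits are used -/

section EarlySteps

variable {σ : QState} {ω : Finset Qubit} {a d : Chan} {q : Option Qubit} {m : Mixed}
  {s : Config}

theorem pair_toFinset (u v : Qubit) : [u, v].toFinset = {u, v} := by simp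

theorem early_alloc (h : Early σ ω a d q m) {qs : List Qubit} {X : Proc}
    (hX : m.proc.Tr m.depth (.alloc qs) X) (hnodup : qs.Nodup) (hqs : ∀ r ∈ qs, r ∉ m.qubits) :
    Early σ ω a d q { m with
      qubits := m.qubits ++ qs, owned := m.owned ∪ qs.toFinset, proc := X } := by
  obtain ⟨A, N, E, R, Y, F, S, I, wt, n, ν, Φ, hp, hM, hN, hR, hD⟩ := h
  rw [hp, net_step_iff (rigid_alloc qs)] at hX
  rcases hX with ⟨A', h, rfl⟩ | ⟨N', h, rfl⟩ | ⟨E', h, rfl⟩ | ⟨R', h, rfl⟩ | ⟨C', h, rfl⟩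
  · cases hM with
    | start =>
      rw [tr_alice_iff] at h
      obtain ⟨y, z, h, rfl⟩ := h
      cases h
      have := hD.alloc_Y hqs (net (aliceIn a.lift.lift (.loc 1) y z) N
        (NoiseErr (.loc 2) (.loc 0) (.loc 1)) R (corr d))
      rw [pair_toFinset] at this ⊢
      exact ⟨_, _, _, _, _, _, _, _, _, _, _, _, rfl, .ready (by simpa using hnodup), hN, hR, this⟩
    | ready => simp [tr_aliceIn_iff] at h
    | encode _ _ hAs => simp [tr_acts_iff hAs, tr_out3_iff] at h
    | sent => simp at h
  · cases hN with
    | start =>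
      rw [tr_noiseRnd_iff] at h
      obtain ⟨u, v, h, rfl⟩ := h
      cases h
      exact ⟨_, _, _, _, _, _, _, _, _, _, _, _, rfl, hM, .had1 (by simpa using hnodup), hR,
        hD.alloc_F (hM.isState hD.disjoint_Y) hqs _⟩
    | had1 => simp [tr_rndHad1_iff] at h
    | had2 => simp [tr_rndHad2_iff] at h
    | meas1 => simp [tr_rndMeas1_iff] at h
    | meas2 => simp [tr_rndMeas2_iff] at h
    | out => simp [tr_rndOut_iff] at h
  · cases hM with
    | start => simp [tr_noiseErr_iff] at h
    | ready => simp [tr_noiseErr_iff] at h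
    | encode => simp [tr_noiseErr_iff] at h
    | sent => simp [tr_errIn_iff] at h
  · cases hR with
    | start =>
      rw [tr_bobRec_iff] at h
      obtain ⟨s, t, h, rfl⟩ := h
      cases h
      have := hD.alloc_S hqs (net A N E (recIn (.loc 1) (.loc 0) s t) (corr d))
      rw [pair_toFinset] at this ⊢
      exact ⟨_, _, _, _, _, _, _, _, _, _, _, _, rfl, hM, hN, .ready (by simpa using hnodup), this⟩
    | ready => simp [tr_recIn_iff] at h
  · simp [tr_bobCorr_iff] at h

theorem early_gate (h : Early σ ω a d q m) {g : Gate} {X : Proc}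
    (hX : m.proc.Tr m.depth (.gate g) X) :
    Early σ ω a d q { m with ket := fun w => g.run w (m.ket w), proc := X } := by
  obtain ⟨A, N, E, R, Y, F, S, I, wt, n, ν, Φ, hp, hM, hN, hR, hD⟩ := h
  rw [hp, net_step_iff (rigid_gate g)] at hX
  rcases hX with ⟨A', h, rfl⟩ | ⟨N', h, rfl⟩ | ⟨E', h, rfl⟩ | ⟨R', h, rfl⟩ | ⟨C', h, rfl⟩
  · cases hM with
    | start => simp [tr_alice_iff] at h
    | ready => simp [tr_aliceIn_iff] at h
    | @encode x y z As Gs err f hyz hx hAs hGs hrun =>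
      rw [tr_acts_iff hAs] at h
      simp only [tr_out3_iff, reduceCtorEq, false_and, and_false, false_or] at h
      obtain ⟨_, As', _, Gs', rfl, rfl, hAs', h, rfl⟩ := h
      cases h
      obtain ⟨r, hr, rfl⟩ := hGs g (by simp)
      have hxY : x ∉ ({y, z} : Finset Qubit) :=
        Finset.disjoint_left.1 hD.disjoint_Y (by simpa using hx)
      have hxF : x ∉ F := Finset.disjoint_left.1 hD.disjoint_F (by simp [hx])
      have hrF : r ∉ F := Finset.disjoint_left.1 hD.YF hr
      have hD' := hD.cnot hxF hrF (net (acts As' (out3 (.loc 1) x y z)) N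
        (NoiseErr (.loc 2) (.loc 0) (.loc 1)) R (corr d))
      -- The condition on the remaining gates is inherited: the code after this gate is the new
      -- starting point.
      rw [runAll_cons, Gate.run] at hrun
      rw [code_cnot_core hxY hr] at hD' hrun
      exact ⟨_, _, _, _, _, _, _, _, _, _, _, _, rfl,
        .encode hyz hx hAs' (fun g hg => hGs g (List.mem_cons_of_mem _ hg)) hrun, hN, hR, hD'⟩
    | sent => simp at h
  · cases hN with
    | start => simp [tr_noiseRnd_iff] at h
    | @had1 u v huv =>
      rw [tr_rndHad1_iff] at h
      obtain ⟨h, rfl⟩ := h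
      cases h
      have := hD.had (u := u) (by simp) (net A (rndHad2 (.loc 0) u v) E R (corr d))
      rw [had_rnd00 huv] at this
      exact ⟨_, _, _, _, _, _, _, _, _, _, _, _, rfl, hM, .had2 huv, hR, this⟩
    | @had2 u v huv =>
      rw [tr_rndHad2_iff] at h
      obtain ⟨h, rfl⟩ := h
      cases h
      have := hD.had (u := v) (by simp) (net A (rndMeas1 (.loc 0) u v) E R (corr d))
      rw [had_rndPlus0] at this
      exact ⟨_, _, _, _, _, _, _, _, _, _, _, _, rfl, hM, .meas1 huv, hR, this⟩
    | meas1 => simp [tr_rndMeas1_iff] at h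
    | meas2 => simp [tr_rndMeas2_iff] at h
    | out => simp [tr_rndOut_iff] at h
  · cases hM with
    | start => simp [tr_noiseErr_iff] at h
    | ready => simp [tr_noiseErr_iff] at h
    | encode => simp [tr_noiseErr_iff] at h
    | sent => simp [tr_errIn_iff] at h
  · cases hR with
    | start => simp [tr_bobRec_iff] at h
    | ready => simp [tr_recIn_iff] at h
  · simp [tr_bobCorr_iff] at h

theorem image_append_nil :
    ((({[]} : Finset (List Bool)) ×ˢ (Finset.univ : Finset Bool)).image fun wb => wb.1 ++ [wb.2]) =
      Finset.univ.image fun j => [j] := by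
  decide

theorem image_append_singleton :
    (((Finset.univ.image fun j : Bool => [j]) ×ˢ (Finset.univ : Finset Bool)).image
      fun wb => wb.1 ++ [wb.2]) = Finset.univ.image fun jk : Bool × Bool => [jk.1, jk.2] := by
  decide

theorem early_meas (h : Early σ ω a d q m) {r : Qubit} {X : Proc}
    (hX : m.proc.Tr m.depth (.meas r) X) :
    Early σ ω a d q { m.measure r with proc := X } := by
  obtain ⟨A, N, E, R, Y, F, S, I, wt, n, ν, Φ, hp, hM, hN, hR, hD⟩ := h
  rw [hp, net_step_iff (rigid_meas r)] at hX
  rcases hX with ⟨A', h, rfl⟩ | ⟨N', h, rfl⟩ | ⟨E', h, rfl⟩ | ⟨R', h, rfl⟩ | ⟨C', h, rfl⟩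
  · cases hM with
    | start => simp [tr_alice_iff] at h
    | ready => simp [tr_aliceIn_iff] at h
    | encode _ _ hAs => simp [tr_acts_iff hAs, tr_out3_iff] at h
    | sent => simp at h
  · cases hN with
    | start => simp [tr_noiseRnd_iff] at h
    | had1 => simp [tr_rndHad1_iff] at h
    | had2 => simp [tr_rndHad2_iff] at h
    | @meas1 u v huv =>
      rw [tr_rndMeas1_iff, hD.depth] at h
      obtain ⟨h, rfl⟩ := h
      cases h
      have := hD.measure (u := r) (by simp) (hM.isState hD.disjoint_Y)
        (fun _ b => born_rndPlusPlus huv b) (ν' := fun w => rndBitPlus r (w.getD 0 false))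
        (by
          intro w hw b
          rw [Finset.mem_singleton] at hw
          subst hw
          exact collapse_rndPlusPlus r b)
        (net A (rndMeas2 (.loc 0) v (outcome 0)) E R (corr d))
      rw [image_append_nil] at this
      exact ⟨_, _, _, _, _, _, _, _, _, _, _, _, rfl, hM, .meas2 huv, hR, this⟩
    | @meas2 u v huv =>
      rw [tr_rndMeas2_iff, hD.depth] at h
      obtain ⟨h, rfl⟩ := h
      cases h
      have := hD.measure (u := r) (by simp) (hM.isState hD.disjoint_Y)
        (fun w b => born_rndBitPlus huv _ b)
        (ν' := fun w => rndBits u r (w.getD 0 false) (w.getD 1 false))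
        (by
          intro w hw b
          rw [Finset.mem_image] at hw
          obtain ⟨j, -, rfl⟩ := hw
          exact collapse_rndBitPlus u r j b)
        (net A (rndOut (.loc 0) (outcome 0) (outcome 1)) E R (corr d))
      rw [image_append_singleton, show (1 / 2 / 2 : ℝ) = 1 / 4 by norm_num] at this
      exact ⟨_, _, _, _, _, _, _, _, _, _, _, _, rfl, hM, .out huv, hR, this⟩
    | out => simp [tr_rndOut_iff] at h
  · cases hM with
    | start => simp [tr_noiseErr_iff] at h
    | ready => simp [tr_noiseErr_iff] at h
    | encode => simp [tr_noiseErr_iff] at h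
    | sent => simp [tr_errIn_iff] at h
  · cases hR with
    | start => simp [tr_bobRec_iff] at h
    | ready => simp [tr_recIn_iff] at h
  · simp [tr_bobCorr_iff] at h

/-- The random bits and the encoded qubit reach the erroneous channel. -/
theorem mid_of_early {x y z u v : Qubit} {R : Proc} {S : Finset Qubit} {P : Proc}
    (hyz : y ≠ z) (huv : u ≠ v) (hx : x ∈ σ.qubits) (hR : Rec R S)
    (hD : EarlyData σ (ω ∪ {x}) m {y, z} {u, v} S
      (Finset.univ.image fun jk : Bool × Bool => [jk.1, jk.2]) (1 / 4) 2
      (fun w => rndBits u v (w.getD 0 false) (w.getD 1 false))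
      (code σ.ket x {y, z} false fun _ b => b))
    (hP : P = net .nil .nil (acts (flipActs x y z (outcome 0) (outcome 1)) (out3 (.loc 1) x y z)) R
      (corr d)) :
    Mid σ ω d x { m with proc := P } := by
  have hxF : x ∉ ({u, v} : Finset Qubit) := Finset.disjoint_left.1 hD.disjoint_F (by simp [hx])
  have hxY : x ∉ ({y, z} : Finset Qubit) :=
    Finset.disjoint_left.1 hD.disjoint_Y (by simpa using hx)
  have hyF : y ∉ ({u, v} : Finset Qubit) := Finset.disjoint_left.1 hD.YF (by simp)
  have hzF : z ∉ ({u, v} : Finset Qubit) := Finset.disjoint_left.1 hD.YF (by simp)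
  have huY : u ∉ ({y, z} : Finset Qubit) := Finset.disjoint_right.1 hD.YF (by simp)
  have hvY : v ∉ ({y, z} : Finset Qubit) := Finset.disjoint_right.1 hD.YF (by simp)
  have hxG : x ∉ ({y, z} ∪ {u, v} : Finset Qubit) := by
    rw [Finset.mem_union]
    tauto
  refine ⟨y, z, u, v, R, S, _, _, hP, hyz, huv, hD.YF,
    Finset.disjoint_union_left.2 ⟨hD.YS, hD.FS⟩, hR, flipActs_isGate _ _ _ _ _, ?_⟩
  exact
  { layout := ⟨hD.layout.qubits, hD.layout.disj, hD.layout.owned⟩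
    mem_qubits := hx
    mem_owned := by simp
    subset := Finset.subset_union_left
    depth := hD.depth
    index := hD.index
    weight := fun j k => hD.weight _ (Finset.mem_image.2 ⟨(j, k), by simp⟩)
    gates := by simp [flipGates, Gate.qubits]
    ket := fun j k => by
      dsimp only
      -- The measured qubits `u` and `v` join the code as ancillas with the constant bits `j` and
      -- `k`.
      rw [hD.ket [j, k] (Finset.mem_image.2 ⟨(j, k), by simp⟩),
        tens_code (c := fun r => if r = u then j else k) hxF hD.YF]
      · obtain ⟨g, h1, h2, h3, h4⟩ := runAll_flips (w := [j, k]) (ψ := σ.ket) (err := false)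
          (f := fun r b => if r ∈ ({u, v} : Finset Qubit) then if r = u then j else k else b)
          hxG (show y ∈ _ by simp) (show z ∈ _ by simp) hyz
          (fun w => w.getD 0 false) (fun w => w.getD 1 false)
        refine ⟨g, ?_, fun b => ?_, fun b => ?_, fun b => ?_, fun b => ?_⟩
        · rw [h1]
          simp
        -- Relative to the current bit `b` of `x`, the bit of `y` is `b ⊕ jk ⊕ j k̄ = b ⊕ j`. In the
        -- same way `z` carries `b ⊕ jk ⊕ j̄ k = b ⊕ k`.
        · rw [h2, if_neg hyF]
          cases j <;> cases k <;> cases b <;> rfl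
        · rw [h3, if_neg hzF]
          cases j <;> cases k <;> cases b <;> rfl
        · simp only [Finset.mem_insert, Finset.mem_singleton, not_or] at huY
          rw [h4 _ huY.1 huY.2]
          simp
        · simp only [Finset.mem_insert, Finset.mem_singleton, not_or] at hvY
          rw [h4 _ hvY.1 hvY.2]
          simp [huv.symm]
      · intro T
        simp [rndBits, huv.symm] }

/-- Only two communications are possible here. Alice's message to the channel keeps the
configuration early; the delivery of the random bits, which requires that the encoded qubits have
arrived, starts the next stage. -/
theorem early_comm (h : Early σ ω a d q m) {X : Proc} (hX : m.proc.Tr m.depth .comm X) :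
    Early σ ω a d q { m with proc := X } ∨ ∃ x, q = some x ∧ Mid σ ω d x { m with proc := X } := by
  obtain ⟨A, N, E, R, Y, F, S, I, wt, n, ν, Φ, hp, hM, hN, hR, hD⟩ := h
  rw [hp] at hX
  rcases net_comm_cases (wired_of_uses hM.uses.1 hN.uses hM.uses.2 hR.uses (corr_uses d)
    (.inr rfl)) hX with ⟨ms, N', E', h1, h2, rfl⟩ | ⟨ms, R', C', h1, h2, rfl⟩ |
    ⟨ms, A', E', h1, h2, rfl⟩ | ⟨ms, E', R', h1, h2, rfl⟩
  · cases hM with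
    | start => simp [tr_noiseErr_iff] at h2
    | ready => simp [tr_noiseErr_iff] at h2
    | encode => simp [tr_noiseErr_iff] at h2
    | sent hyz hx =>
      cases hN with
      | start => simp [tr_noiseRnd_iff] at h1
      | had1 => simp [tr_rndHad1_iff] at h1
      | had2 => simp [tr_rndHad2_iff] at h1
      | meas1 => simp [tr_rndMeas1_iff] at h1
      | meas2 => simp [tr_rndMeas2_iff] at h1
      | out huv =>
        rw [tr_rndOut_iff] at h1
        obtain ⟨h1, rfl⟩ := h1
        cases h1
        rw [tr_errIn_iff] at h2
        obtain ⟨f, g, h2, rfl⟩ := h2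
        cases h2
        exact .inr ⟨_, rfl, mid_of_early hyz huv hx hR hD rfl⟩
  · cases hR with
    | start => simp [tr_bobRec_iff] at h1
    | ready => simp [tr_recIn_iff] at h1
  · cases hM with
    | start => simp [tr_alice_iff] at h1
    | ready => simp [tr_aliceIn_iff] at h1
    | @encode x y z As Gs err f hyz hx hAs hGs hrun =>
      rw [tr_acts_iff hAs] at h1
      simp only [reduceCtorEq, false_and, and_false, exists_false, or_false, tr_out3_iff] at h1
      obtain ⟨rfl, rfl, h1, rfl⟩ := h1
      cases h1
      rw [tr_noiseErr_iff] at h2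
      obtain ⟨x', y', z', h2, rfl⟩ := h2
      cases h2
      rw [runAll_nil] at hrun
      rw [hrun] at hD
      exact .inl ⟨_, _, _, _, _, _, _, _, _, _, _, _, rfl, .sent hyz hx, hN, hR, hD.update _⟩
    | sent => simp at h1
  · cases hM with
    | start => simp [tr_noiseErr_iff] at h1
    | ready => simp [tr_noiseErr_iff] at h1
    | encode => simp [tr_noiseErr_iff] at h1
    | sent => simp [tr_errIn_iff] at h1

theorem early_tau (h : Early σ ω a d q m) (hs : Trans (.mix m) .tau s) :
    ∃ m', s = .mix m' ∧ (Early σ ω a d q m' ∨ ∃ x, q = some x ∧ Mid σ ω d x m') := by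
  cases hs with
  | comm hX => exact ⟨_, rfl, early_comm h hX⟩
  | gate hX _ => exact ⟨_, rfl, .inl (early_gate h hX)⟩
  | meas hX _ => exact ⟨_, rfl, .inl (early_meas h hX)⟩
  | alloc hX h1 h2 => exact ⟨_, rfl, .inl (early_alloc h hX h1 h2)⟩

end EarlySteps

/-! ## Configurations of the system after the random bits are used -/

/-- The names of the ancillas are distinct. -/
def Ancillas (y z u v s t : Qubit) : Prop :=
  y ≠ z ∧ u ≠ v ∧ s ≠ t ∧ Disjoint ({y, z} : Finset Qubit) {u, v} ∧
    Disjoint ({y, z} ∪ {u, v} : Finset Qubit) {s, t}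

/-- What is known about the code after the computation of the syndrome. -/
def GoodSyndrome (y z u v s t : Qubit) (j k : Bool) (f : Qubit → Bool → Bool) : Prop :=
  GoodErr y z u v j k f ∧ (∀ b, f s b = j) ∧ ∀ b, f t b = k

/-- The ancillas `G` are in a product state. -/
def GoodFinal (G : Finset Qubit) (_ _ : Bool) (f : Qubit → Bool → Bool) : Prop :=
  ∀ r ∈ G, ∀ b, f r b = f r false

/-- The configurations in which Bob works. -/
inductive Late (σ : QState) (ω : Finset Qubit) (d : Chan) (x : Qubit) (m : Mixed) : Prop
  | syndrome {y z u v s t : Qubit} {As : List Action} {Gs : List Gate}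
      (hp : m.proc = net .nil .nil .nil (acts As (recMeas1 (.loc 0) x y z s t)) (corr d))
      (hn : Ancillas y z u v s t) (hAs : List.Forall₂ Action.IsGate As Gs)
      (hB : Branches σ (ω ∪ {x}) x m ({y, z} ∪ {u, v} ∪ {s, t}) ({y, z} ∪ {u, v} ∪ {s, t}) 2
        (fun j k => [j, k]) Gs (fun j k => j && k) (GoodSyndrome y z u v s t))
  | measured {y z u v s t : Qubit}
      (hp : m.proc = net .nil .nil .nil (recMeas2 (.loc 0) x y z t (outcome 2)) (corr d))
      (hn : Ancillas y z u v s t)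
      (hB : Branches σ (ω ∪ {x}) x m ({y, z} ∪ {u, v} ∪ {s, t}) ({y, z} ∪ {u, v} ∪ {s, t}) 3
        (fun j k => [j, k, j]) [] (fun j k => j && k) (GoodSyndrome y z u v s t))
  | sending {y z u v s t : Qubit}
      (hp : m.proc = net .nil .nil .nil (recOut (.loc 0) x y z (outcome 2) (outcome 3)) (corr d))
      (hn : Ancillas y z u v s t)
      (hB : Branches σ (ω ∪ {x}) x m ({y, z} ∪ {u, v} ∪ {s, t}) ({y, z} ∪ {u, v} ∪ {s, t}) 4
        (fun j k => [j, k, j, k]) [] (fun j k => j && k) (GoodSyndrome y z u v s t))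
  | correct {G : Finset Qubit} {As : List Action} {Gs : List Gate}
      (hp : m.proc = net .nil .nil .nil .nil (acts As (out1 d.lift.lift.lift x)))
      (hAs : List.Forall₂ Action.IsGate As Gs)
      (hB : Branches σ (ω ∪ {x}) x m G G 4 (fun j k => [j, k, j, k]) Gs (fun _ _ => false)
        (GoodFinal G))

/-! ### Internal steps after the random bits are used -/

section LateSteps

variable {σ : QState} {ω : Finset Qubit} {a d : Chan} {q : Option Qubit} {x : Qubit} {m : Mixed}
  {s : Config}

/-- The parity of `b` and `b ⊕ j` is `j`, and that of `b` and `b ⊕ k` is `k`. So `s` and `t` end up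
with definite bits that reproduce the random bits. -/
theorem late_of_mid {y z u v s t : Qubit}
    (hn : Ancillas y z u v s t)
    (hB : Branches σ (ω ∪ {x}) x m ({y, z} ∪ {u, v} ∪ {s, t}) ({y, z} ∪ {u, v}) 2
      (fun j k => [j, k]) [] (fun j k => j && k) (GoodErr y z u v)) :
    Late σ ω d x { m with
      proc := net .nil .nil .nil (acts (syndromeActs x y z s t) (recMeas1 (.loc 0) x y z s t))
        (corr d) } := by
  have hxG := hB.layout.notMem hB.mem_qubits
  have hQS : Disjoint σ.qubits.toFinset ({s, t} : Finset Qubit) :=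
    hB.layout.disj.mono_right Finset.subset_union_right
  obtain ⟨h1, h2, h3, h4, h5⟩ := id hn
  simp only [Finset.disjoint_left, Finset.mem_union, Finset.mem_insert, Finset.mem_singleton]
    at h4 h5
  have hys : y ≠ s := fun h => h5 (.inl (.inl rfl)) (.inl h)
  have hyt : y ≠ t := fun h => h5 (.inl (.inl rfl)) (.inr h)
  have hzs : z ≠ s := fun h => h5 (.inl (.inr rfl)) (.inl h)
  have hzt : z ≠ t := fun h => h5 (.inl (.inr rfl)) (.inr h)
  have hus : u ≠ s := fun h => h5 (.inr (.inl rfl)) (.inl h)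
  have hut : u ≠ t := fun h => h5 (.inr (.inl rfl)) (.inr h)
  have hvs : v ≠ s := fun h => h5 (.inr (.inr rfl)) (.inl h)
  have hvt : v ≠ t := fun h => h5 (.inr (.inr rfl)) (.inr h)
  have hxs : x ≠ s := fun h => hxG (by simp [h])
  have hxt : x ≠ t := fun h => hxG (by simp [h])
  refine .syndrome rfl hn (syndromeActs_isGate hxs hys hxt hzt)
    (hB.next Finset.Subset.rfl ?_ ?_ _)
  · simp only [syndromeGates, List.mem_cons, List.not_mem_nil, or_false]
    rintro g (rfl | rfl | rfl | rfl) r hr <;>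
      simp only [Gate.qubits, Finset.mem_insert, Finset.mem_singleton] at hr <;>
      rcases hr with rfl | rfl <;> simp
  · rintro j k f ⟨g1, g2, g3, g4⟩
    -- Bob's qubits, so far in the ground state, are taken into the code with bit zero before the
    -- syndrome gates act on them.
    rw [code_extend σ.isState (by simpa using hB.mem_qubits) hQS hn.2.2.2.2]
    obtain ⟨g, e1, e2, e3, e4⟩ := runAll_syndrome (w := [j, k]) (ψ := σ.ket) (err := j && k)
      (f := fun r b => if r ∈ ({s, t} : Finset Qubit) then false else f r b)
      hxG (show y ∈ _ by simp) (show z ∈ _ by simp) (show s ∈ _ by simp) (show t ∈ _ by simp)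
      hys hzs hzt h3
    refine ⟨g, e1, ⟨fun b => ?_, fun b => ?_, fun b => ?_, fun b => ?_⟩, fun b => ?_, fun b => ?_⟩
    · rw [e4 y hys hyt]
      simp [hys, hyt, g1]
    · rw [e4 z hzs hzt]
      simp [hzs, hzt, g2]
    · rw [e4 u hus hut]
      simp [hus, hut, g3]
    · rw [e4 v hvs hvt]
      simp [hvs, hvt, g4]
    · rw [e2]
      simp [hys, hyt, g1]
    · rw [e3]
      simp [hzs, hzt, g2]

/-- Entries 2 and 3 of the label `[j, k, j, k]` are the syndrome and agree with the noise bits in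
entries 0 and 1. The correction therefore repeats the original flip, and the error flag becomes `jk
⊕ jk`. -/
theorem late_correct {y z u v s t : Qubit} (hn : Ancillas y z u v s t)
    (hB : Branches σ (ω ∪ {x}) x m ({y, z} ∪ {u, v} ∪ {s, t}) ({y, z} ∪ {u, v} ∪ {s, t}) 4
      (fun j k => [j, k, j, k]) [] (fun j k => j && k) (GoodSyndrome y z u v s t)) :
    Late σ ω d x { m with proc := net .nil .nil .nil .nil (acts
      (flipActs x y z (outcome 2) (outcome 3) ++ decodeActs x y z)
        (out1 d.lift.lift.lift x)) } := by
  have hxG := hB.layout.notMem hB.mem_qubits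
  obtain ⟨h1, h2, h3, h4, h5⟩ := id hn
  simp only [Finset.disjoint_left, Finset.mem_union, Finset.mem_insert, Finset.mem_singleton]
    at h4 h5
  have hxy : x ≠ y := fun h => hxG (by simp [h])
  have hxz : x ≠ z := fun h => hxG (by simp [h])
  refine .correct rfl (forall₂_append (flipActs_isGate _ _ _ _ _) (decodeActs_isGate hxy hxz))
    (hB.next Finset.Subset.rfl ?_ ?_ _)
  · simp only [flipGates, decodeGates, List.mem_append, List.mem_cons, List.not_mem_nil, or_false]
    rintro g ((rfl | rfl | rfl) | (rfl | rfl)) r hr <;>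
      simp only [Gate.qubits, Finset.mem_insert, Finset.mem_singleton] at hr <;>
      (try rcases hr with rfl | rfl) <;> simp [*]
  · rintro j k f ⟨⟨g1, g2, g3, g4⟩, g5, g6⟩
    obtain ⟨g, e1, e2, e3, e4⟩ := runAll_flips (w := [j, k, j, k]) (ψ := σ.ket) (err := j && k)
      (f := f) hxG (show y ∈ _ by simp) (show z ∈ _ by simp) h1
      (fun w => w.getD 2 false) (fun w => w.getD 3 false)
    obtain ⟨g', e1', e2', e3', e4'⟩ := runAll_decode (w := [j, k, j, k]) (ψ := σ.ket)
      (err := (j && k) ^^ (j && k)) (f := g) hxG (show y ∈ _ by simp) (show z ∈ _ by simp) h1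
    refine ⟨g', ?_, fun r hr b => ?_⟩
    · rw [runAll_append, e1]
      refine e1'.trans ?_
      rw [Bool.xor_self]
    · by_cases hry : r = y
      · subst hry
        -- The bit of `y` is `(b ⊕ jk ⊕ j) ⊕ j k̄ ⊕ b`, which is zero; for `z` the roles of `j` and
        -- `k` are exchanged.
        simp only [e2', e2, g1]
        cases j <;> cases k <;> cases b <;> rfl
      · by_cases hrz : r = z
        · subst hrz
          simp only [e3', e3, g2]
          cases j <;> cases k <;> cases b <;> rfl
        · rw [e4' r hry hrz, e4 r hry hrz, e4 r hry hrz]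
          simp only [Finset.mem_union, Finset.mem_insert, Finset.mem_singleton] at hr
          rcases hr with ((rfl | rfl) | (rfl | rfl)) | (rfl | rfl)
          · exact absurd rfl hry
          · exact absurd rfl hrz
          · rw [g3, g3]
          · rw [g4, g4]
          · rw [g5, g5]
          · rw [g6, g6]

theorem mid_tau (h : Mid σ ω d x m) (hs : Trans (.mix m) .tau s) :
    ∃ m', s = .mix m' ∧ (Mid σ ω d x m' ∨ Late σ ω d x m') := by
  obtain ⟨y, z, u, v, R, S, As, Gs, hp, hyz, huv, hYF, hGS, hR, hAs, hB⟩ := h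
  cases hs with
  | comm h =>
    rw [hp] at h
    refine ⟨_, rfl, .inr ?_⟩
    have hE : (acts As (out3 (.loc 1) x y z)).Uses (· = .loc 1)
        fun c => c = .loc 2 ∨ c = .loc 0 := by
      refine uses_acts hAs fun k s X h => ?_
      rw [tr_out3_iff] at h
      obtain ⟨rfl, -⟩ := h
      rfl
    -- Alice has terminated, so her input channel is irrelevant and any channel may stand for it.
    rcases net_comm_cases (wired_of_uses (a := .loc 0) (uses_nil _ _) (uses_nil _ _) hE hR.uses
      (corr_uses d) (.inl rfl)) h with ⟨ms, N', E', h1, h2, rfl⟩ | ⟨ms, R', C', h1, h2, rfl⟩ |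
      ⟨ms, A', E', h1, h2, rfl⟩ | ⟨ms, E', R', h1, h2, rfl⟩
    · exact absurd h1 tr_nil
    · cases hR with
      | start => simp [tr_bobRec_iff] at h1
      | ready => simp [tr_recIn_iff] at h1
    · exact absurd h1 tr_nil
    · rw [tr_acts_iff hAs] at h1
      simp only [reduceCtorEq, false_and, and_false, exists_false, or_false, tr_out3_iff] at h1
      obtain ⟨rfl, rfl, h1, rfl⟩ := h1
      cases h1
      cases hR with
      | start => simp [tr_bobRec_iff] at h2
      | ready hst =>
        rw [tr_recIn_iff] at h2
        obtain ⟨x', y', z', h2, rfl⟩ := h2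
        cases h2
        exact late_of_mid ⟨hyz, huv, hst, hYF, hGS⟩ hB
  | @gate _ g _ h _ =>
    rw [hp, net_step_iff (rigid_gate g)] at h
    simp only [tr_nil, false_and, exists_false, false_or, tr_bobCorr_iff, reduceCtorEq,
      or_false] at h
    rcases h with ⟨E', h, rfl⟩ | ⟨R', h, rfl⟩
    · rw [tr_acts_iff hAs] at h
      simp only [tr_out3_iff, reduceCtorEq, false_and, and_false, false_or] at h
      obtain ⟨_, As', _, Gs', rfl, rfl, hAs', h, rfl⟩ := h
      cases h
      exact ⟨_, rfl, .inl ⟨y, z, u, v, R, S, _, _, rfl, hyz, huv, hYF, hGS, hR, hAs', hB.gate _⟩⟩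
    · cases hR with
      | start => simp [tr_bobRec_iff] at h
      | ready => simp [tr_recIn_iff] at h
  | @meas _ r _ h _ =>
    rw [hp, net_step_iff (rigid_meas r)] at h
    simp only [tr_nil, false_and, exists_false, false_or, tr_bobCorr_iff, reduceCtorEq,
      or_false, tr_acts_iff hAs, tr_out3_iff, and_false] at h
    obtain ⟨R', h, rfl⟩ := h
    cases hR with
    | start => simp [tr_bobRec_iff] at h
    | ready => simp [tr_recIn_iff] at h
  | @alloc _ qs _ h hnodup hqs =>
    rw [hp, net_step_iff (rigid_alloc qs)] at h
    simp only [tr_nil, false_and, exists_false, false_or, tr_bobCorr_iff, reduceCtorEq,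
      or_false, tr_acts_iff hAs, tr_out3_iff, and_false] at h
    obtain ⟨R', h, rfl⟩ := h
    refine ⟨_, rfl, .inl ?_⟩
    cases hR with
    | start =>
      rw [tr_bobRec_iff] at h
      obtain ⟨s, t, h, rfl⟩ := h
      cases h
      have hB' := hB.alloc hqs (net .nil .nil (acts As (out3 (.loc 1) x y z))
        (recIn (.loc 1) (.loc 0) s t) (corr d))
      have hd := hB.layout.disjoint_fresh hqs
      rw [Finset.union_empty] at hB' hd
      rw [pair_toFinset] at hB' hd ⊢
      exact ⟨y, z, u, v, _, _, As, Gs, rfl, hyz, huv, hYF, hd, .ready (by simpa using hnodup), hAs,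
        hB'⟩
    | ready => simp [tr_recIn_iff] at h

theorem late_tau (h : Late σ ω d x m) (hs : Trans (.mix m) .tau s) :
    ∃ m', s = .mix m' ∧ Late σ ω d x m' := by
  cases h with
  | @syndrome y z u v s t As Gs hp hn hAs hB =>
    have hR : (acts As (recMeas1 (.loc 0) x y z s t)).Uses (· = .loc 0) (· = .loc 1) := by
      refine uses_acts hAs fun k s X h => ?_
      rw [tr_recMeas1_iff] at h
      obtain ⟨rfl, -⟩ := h
      trivial
    cases hs with
    | comm h =>
      rw [hp] at h
      rcases net_comm_cases (wired_of_uses (a := .loc 0) (uses_nil _ _) (uses_nil _ _)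
        (uses_nil _ _) hR (corr_uses d) (.inl rfl)) h with ⟨ms, N', E', h1, h2, rfl⟩ |
        ⟨ms, R', C', h1, h2, rfl⟩ | ⟨ms, A', E', h1, h2, rfl⟩ | ⟨ms, E', R', h1, h2, rfl⟩
      · exact absurd h1 tr_nil
      · simp [tr_acts_iff hAs, tr_recMeas1_iff] at h1
      · exact absurd h1 tr_nil
      · exact absurd h1 tr_nil
    | @gate _ g _ h _ =>
      rw [hp, net_step_iff (rigid_gate g)] at h
      simp only [tr_nil, false_and, exists_false, false_or, tr_bobCorr_iff, reduceCtorEq,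
        or_false, tr_acts_iff hAs, tr_recMeas1_iff, and_false] at h
      obtain ⟨_, ⟨_, As', _, Gs', rfl, rfl, hAs', h, rfl⟩, rfl⟩ := h
      cases h
      exact ⟨_, rfl, .syndrome rfl hn hAs' (hB.gate _)⟩
    | @meas _ r _ h _ =>
      rw [hp, net_step_iff (rigid_meas r)] at h
      simp only [tr_nil, false_and, exists_false, false_or, tr_bobCorr_iff, reduceCtorEq,
        or_false, tr_acts_iff hAs, tr_recMeas1_iff, and_false, Step.meas.injEq] at h
      obtain ⟨_, ⟨rfl, rfl, rfl, rfl⟩, rfl⟩ := h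
      -- Two measurements have been made before, so the result of this one is entry 2 of the label,
      -- and the term refers to it as `outcome 2`.
      rw [hB.depth]
      exact ⟨_, rfl, .measured rfl hn (hB.measure (β := fun j _ => j) (by simp)
        (fun j k f hf => hf.2.1) (by simp) _)⟩
    | @alloc _ qs _ h _ _ =>
      rw [hp, net_step_iff (rigid_alloc qs)] at h
      simp [tr_bobCorr_iff, tr_acts_iff hAs, tr_recMeas1_iff] at h
  | @measured y z u v s t hp hn hB =>
    have hR : (recMeas2 (.loc 0) x y z t (outcome 2)).Uses (· = .loc 0) (· = .loc 1) := by
      intro k s X h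
      rw [tr_recMeas2_iff] at h
      obtain ⟨rfl, -⟩ := h
      trivial
    cases hs with
    | comm h =>
      rw [hp] at h
      rcases net_comm_cases (wired_of_uses (a := .loc 0) (uses_nil _ _) (uses_nil _ _)
        (uses_nil _ _) hR (corr_uses d) (.inl rfl)) h with ⟨ms, N', E', h1, h2, rfl⟩ |
        ⟨ms, R', C', h1, h2, rfl⟩ | ⟨ms, A', E', h1, h2, rfl⟩ | ⟨ms, E', R', h1, h2, rfl⟩
      · exact absurd h1 tr_nil
      · simp [tr_recMeas2_iff] at h1
      · exact absurd h1 tr_nil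
      · exact absurd h1 tr_nil
    | @gate _ g _ h _ =>
      rw [hp, net_step_iff (rigid_gate g)] at h
      simp [tr_bobCorr_iff, tr_recMeas2_iff] at h
    | @meas _ r _ h _ =>
      rw [hp, net_step_iff (rigid_meas r)] at h
      simp only [tr_nil, false_and, exists_false, false_or, tr_bobCorr_iff, reduceCtorEq,
        or_false, tr_recMeas2_iff, Step.meas.injEq] at h
      obtain ⟨_, ⟨rfl, rfl⟩, rfl⟩ := h
      rw [hB.depth]
      exact ⟨_, rfl, .sending rfl hn (hB.measure (β := fun _ k => k) (by simp)
        (fun j k f hf => hf.2.2) (by simp) _)⟩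
    | @alloc _ qs _ h _ _ =>
      rw [hp, net_step_iff (rigid_alloc qs)] at h
      simp [tr_bobCorr_iff, tr_recMeas2_iff] at h
  | @sending y z u v s t hp hn hB =>
    have hR : (recOut (.loc 0) x y z (outcome 2) (outcome 3)).Uses (· = .loc 0) (· = .loc 1) := by
      intro k s X h
      rw [tr_recOut_iff] at h
      obtain ⟨rfl, -⟩ := h
      rfl
    cases hs with
    | comm h =>
      rw [hp] at h
      rcases net_comm_cases (wired_of_uses (a := .loc 0) (uses_nil _ _) (uses_nil _ _)
        (uses_nil _ _) hR (corr_uses d) (.inl rfl)) h with ⟨ms, N', E', h1, h2, rfl⟩ |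
        ⟨ms, R', C', h1, h2, rfl⟩ | ⟨ms, A', E', h1, h2, rfl⟩ | ⟨ms, E', R', h1, h2, rfl⟩
      · exact absurd h1 tr_nil
      · rw [tr_recOut_iff] at h1
        obtain ⟨h1, rfl⟩ := h1
        cases h1
        rw [tr_bobCorr_iff] at h2
        obtain ⟨x', y', z', f, g, h2, rfl⟩ := h2
        cases h2
        exact ⟨_, rfl, late_correct hn hB⟩
      · exact absurd h1 tr_nil
      · exact absurd h1 tr_nil
    | @gate _ g _ h _ =>
      rw [hp, net_step_iff (rigid_gate g)] at h
      simp [tr_bobCorr_iff, tr_recOut_iff] at h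
    | @meas _ r _ h _ =>
      rw [hp, net_step_iff (rigid_meas r)] at h
      simp [tr_bobCorr_iff, tr_recOut_iff] at h
    | @alloc _ qs _ h _ _ =>
      rw [hp, net_step_iff (rigid_alloc qs)] at h
      simp [tr_bobCorr_iff, tr_recOut_iff] at h
  | @correct G As Gs hp hAs hB =>
    have hC : (acts As (out1 d.lift.lift.lift x)).Uses (· = d.lift.lift.lift) (· = .loc 0) := by
      refine uses_acts hAs fun k s X h => ?_
      rw [tr_out1_iff] at h
      obtain ⟨rfl, -⟩ := h
      rfl
    cases hs with
    | comm h =>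
      rw [hp] at h
      rcases net_comm_cases (wired_of_uses (a := .loc 0) (uses_nil _ _) (uses_nil _ _)
        (uses_nil _ _) (uses_nil _ _) hC (.inl rfl)) h with ⟨ms, N', E', h1, h2, rfl⟩ |
        ⟨ms, R', C', h1, h2, rfl⟩ | ⟨ms, A', E', h1, h2, rfl⟩ | ⟨ms, E', R', h1, h2, rfl⟩ <;>
      exact absurd h1 tr_nil
    | @gate _ g _ h _ =>
      rw [hp, net_step_iff (rigid_gate g)] at h
      simp only [tr_nil, false_and, exists_false, false_or, reduceCtorEq,
        tr_acts_iff hAs, tr_out1_iff, and_false] at h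
      obtain ⟨_, ⟨_, As', _, Gs', rfl, rfl, hAs', h, rfl⟩, rfl⟩ := h
      cases h
      exact ⟨_, rfl, .correct rfl hAs' (hB.gate _)⟩
    | @meas _ r _ h _ =>
      rw [hp, net_step_iff (rigid_meas r)] at h
      simp [tr_acts_iff hAs, tr_out1_iff] at h
    | @alloc _ qs _ h _ _ =>
      rw [hp, net_step_iff (rigid_alloc qs)] at h
      simp [tr_acts_iff hAs, tr_out1_iff] at h

end LateSteps

section Progress

variable {σ : QState} {ω : Finset Qubit} {a d : Chan} {q : Option Qubit} {x : Qubit} {m : Mixed}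

/-! ## Progress -/

theorem exists_alloc (h : ∀ qs : List Qubit, qs.length = 2 →
    ∃ X, m.proc.Tr m.depth (.alloc qs) X) : ∃ s, Trans (.mix m) .tau s := by
  obtain ⟨y, z, h1, h2⟩ := exists_fresh_pair m.qubits
  obtain ⟨X, hX⟩ := h [y, z] rfl
  exact ⟨_, .alloc hX h1 h2⟩

/-- Alice is ready to receive the input. -/
def InputReady (σ : QState) (ω : Finset Qubit) (a d : Chan) (m : Mixed) : Prop :=
  ∃ N E R y z F S I wt n ν Φ, m.proc = net (aliceIn a.lift.lift (.loc 1) y z) N E R (corr d) ∧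
    EarlyMain σ a none (aliceIn a.lift.lift (.loc 1) y z) E {y, z} Φ ∧
    Rnd N F I wt n ν ∧ Rec R S ∧ EarlyData σ ω m {y, z} F S I wt n ν Φ

/-- Only Alice has to move. The noise source and Bob may be at any stage when the input is accepted.
-/
theorem early_none_progress (h : Early σ ω a d none m) :
    InputReady σ ω a d m ∨ ∃ s, Trans (.mix m) .tau s := by
  obtain ⟨A, N, E, R, Y, F, S, I, wt, n, ν, Φ, hp, hM, hN, hR, hD⟩ := h
  cases hM with
  | start =>
    refine .inr (exists_alloc fun qs hqs => ?_)
    rw [eq_comm, two_eq_length] at hqs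
    obtain ⟨y, z, rfl⟩ := hqs
    rw [hp]
    exact ⟨_, (net_step_iff (rigid_alloc _)).2 (.inl ⟨_, tr_alice_iff.2 ⟨y, z, rfl, rfl⟩, rfl⟩)⟩
  | ready hyz =>
    left
    rw [inputSet, Option.elim_none, Finset.union_empty] at hD
    exact ⟨_, _, _, _, _, _, _, _, _, _, _, _, hp, .ready hyz, hN, hR, hD⟩

/-- The thread that everything waits for can always proceed: Alice until her message is delivered,
and then the noise source until its bits are. -/
theorem early_some_progress (h : Early σ ω a d (some x) m) : ∃ s, Trans (.mix m) .tau s := by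
  obtain ⟨A, N, E, R, Y, F, S, I, wt, n, ν, Φ, hp, hM, hN, hR, hD⟩ := h
  have hF : F ⊆ m.owned := (Finset.subset_union_right.trans Finset.subset_union_left).trans
    hD.layout.subset_owned
  cases hM with
  | @encode _ y z As Gs err f hyz hx hAs hGs hrun =>
    cases hAs with
    | nil =>
      refine ⟨_, .comm (P' := net .nil N (errIn (.loc 0) (.loc 1) x y z) R (corr d)) ?_⟩
      rw [hp]
      exact net_comm_alice_noise (tr_out3_iff.2 ⟨rfl, rfl⟩)
        (tr_noiseErr_iff.2 ⟨x, y, z, rfl, rfl⟩)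
    | @cons A g As' Gs' hA hAs =>
      obtain ⟨r, hr, rfl⟩ := hGs g (by simp)
      refine ⟨_, .gate (G := .cnot x r)
        (P' := net (acts As' (out3 (.loc 1) x y z)) N (NoiseErr (.loc 2) (.loc 0) (.loc 1)) R
          (corr d)) ?_ ?_⟩
      · rw [hp]
        exact (net_step_iff (rigid_gate _)).2 (.inl ⟨_, (hA _ _ _ _).2 ⟨rfl, rfl⟩, rfl⟩)
      · simp only [Gate.qubits, Finset.insert_subset_iff, Finset.singleton_subset_iff]
        refine ⟨hD.layout.base_subset_owned (by simp [inputSet]), hD.layout.subset_owned ?_⟩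
        exact Finset.mem_union_left _ (Finset.mem_union_left _ hr)
  | @sent _ y z hyz hx =>
    cases hN with
    | start =>
      refine exists_alloc fun qs hqs => ?_
      rw [eq_comm, two_eq_length] at hqs
      obtain ⟨u, v, rfl⟩ := hqs
      rw [hp]
      exact ⟨_, (net_step_iff (rigid_alloc _)).2
        (.inr (.inl ⟨_, tr_noiseRnd_iff.2 ⟨u, v, rfl, rfl⟩, rfl⟩))⟩
    | @had1 u v =>
      refine ⟨_, .gate (G := .had u)
        (P' := net .nil (rndHad2 (.loc 0) u v) (errIn (.loc 0) (.loc 1) x y z) R (corr d)) ?_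
        (by simpa [Gate.qubits] using hF (by simp))⟩
      rw [hp]
      exact (net_step_iff (rigid_gate _)).2 (.inr (.inl ⟨_, tr_rndHad1_iff.2 ⟨rfl, rfl⟩, rfl⟩))
    | @had2 u v =>
      refine ⟨_, .gate (G := .had v)
        (P' := net .nil (rndMeas1 (.loc 0) u v) (errIn (.loc 0) (.loc 1) x y z) R (corr d)) ?_
        (by simpa [Gate.qubits] using hF (by simp))⟩
      rw [hp]
      exact (net_step_iff (rigid_gate _)).2 (.inr (.inl ⟨_, tr_rndHad2_iff.2 ⟨rfl, rfl⟩, rfl⟩))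
    | @meas1 u v =>
      refine ⟨_, .meas (q := u)
        (P' := net .nil (rndMeas2 (.loc 0) v (outcome m.depth))
          (errIn (.loc 0) (.loc 1) x y z) R (corr d)) ?_ (hF (by simp))⟩
      rw [hp]
      exact (net_step_iff (rigid_meas _)).2 (.inr (.inl ⟨_, tr_rndMeas1_iff.2 ⟨rfl, rfl⟩, rfl⟩))
    | @meas2 u v =>
      refine ⟨_, .meas (q := v)
        (P' := net .nil (rndOut (.loc 0) (outcome 0) (outcome m.depth))
          (errIn (.loc 0) (.loc 1) x y z) R (corr d)) ?_
        (hF (by simp))⟩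
      rw [hp]
      exact (net_step_iff (rigid_meas _)).2 (.inr (.inl ⟨_, tr_rndMeas2_iff.2 ⟨rfl, rfl⟩, rfl⟩))
    | out =>
      refine ⟨_, .comm (P' := net .nil .nil
        (acts (flipActs x y z (outcome 0) (outcome 1)) (out3 (.loc 1) x y z)) R (corr d)) ?_⟩
      rw [hp]
      exact net_comm_noise (tr_rndOut_iff.2 ⟨rfl, rfl⟩) (tr_errIn_iff.2 ⟨_, _, rfl, rfl⟩)

theorem mid_progress (h : Mid σ ω d x m) : ∃ s, Trans (.mix m) .tau s := by
  obtain ⟨y, z, u, v, R, S, As, Gs, hp, hyz, huv, hYF, hGS, hR, hAs, hB⟩ := h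
  cases hAs with
  | nil =>
    cases hR with
    | start =>
      refine exists_alloc fun qs hqs => ?_
      rw [eq_comm, two_eq_length] at hqs
      obtain ⟨u, v, rfl⟩ := hqs
      rw [hp]
      exact ⟨_, (net_step_iff (rigid_alloc _)).2
        (.inr (.inr (.inr (.inl ⟨_, tr_bobRec_iff.2 ⟨u, v, rfl, rfl⟩, rfl⟩))))⟩
    | @ready s t hst =>
      refine ⟨_, .comm (P' := net .nil .nil .nil
        (acts (syndromeActs x y z s t) (recMeas1 (.loc 0) x y z s t)) (corr d)) ?_⟩
      rw [hp]
      exact net_comm_noise_bob (tr_out3_iff.2 ⟨rfl, rfl⟩) (tr_recIn_iff.2 ⟨x, y, z, rfl, rfl⟩)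
  | @cons A g As' Gs' hA hAs =>
    refine ⟨_, .gate (G := g) (P' := net .nil .nil (acts As' (out3 (.loc 1) x y z)) R (corr d)) ?_
      (hB.gate_owned (by simp))⟩
    rw [hp]
    exact (net_step_iff (rigid_gate _)).2
      (.inr (.inr (.inl ⟨_, (hA _ _ _ _).2 ⟨rfl, rfl⟩, rfl⟩)))

/-! ## Output -/

/-- The input qubit is about to be returned in its original state. -/
def OutputReady (σ : QState) (ω : Finset Qubit) (d : Chan) (x : Qubit) (m : Mixed) : Prop :=
  ∃ L, Restored σ L m ∧ Layout σ (ω ∪ {x}) m L.toFinset ∧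
    (m.proc = out1 d x ∨ m.proc = net .nil .nil .nil .nil (out1 d.lift.lift.lift x))

theorem late_progress (h : Late σ ω d x m) :
    OutputReady σ ω d x m ∨ ∃ s, Trans (.mix m) .tau s := by
  cases h with
  | @syndrome y z u v s t As Gs hp hn hAs hB =>
    right
    cases hAs with
    | nil =>
      refine ⟨_, .meas (q := s)
        (P' := net .nil .nil .nil (recMeas2 (.loc 0) x y z t (outcome m.depth)) (corr d)) ?_
        (hB.layout.subset_owned (by simp))⟩
      rw [hp]
      exact (net_step_iff (rigid_meas _)).2
        (.inr (.inr (.inr (.inl ⟨_, tr_recMeas1_iff.2 ⟨rfl, rfl⟩, rfl⟩))))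
    | @cons A g As' Gs' hA hAs =>
      refine ⟨_, .gate (G := g)
        (P' := net .nil .nil .nil (acts As' (recMeas1 (.loc 0) x y z s t)) (corr d)) ?_
        (hB.gate_owned (by simp))⟩
      rw [hp]
      exact (net_step_iff (rigid_gate _)).2
        (.inr (.inr (.inr (.inl ⟨_, (hA _ _ _ _).2 ⟨rfl, rfl⟩, rfl⟩))))
  | @measured y z u v s t hp hn hB =>
    refine .inr ⟨_, .meas (q := t)
      (P' := net .nil .nil .nil (recOut (.loc 0) x y z (outcome 2) (outcome m.depth)) (corr d)) ?_
      (hB.layout.subset_owned (by simp))⟩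
    rw [hp]
    exact (net_step_iff (rigid_meas _)).2
      (.inr (.inr (.inr (.inl ⟨_, tr_recMeas2_iff.2 ⟨rfl, rfl⟩, rfl⟩))))
  | @sending y z u v s t hp hn hB =>
    refine .inr ⟨_, .comm (P' := net .nil .nil .nil .nil (acts
      (flipActs x y z (outcome 2) (outcome 3) ++ decodeActs x y z)
      (out1 d.lift.lift.lift x))) ?_⟩
    rw [hp]
    exact net_comm_bob (tr_recOut_iff.2 ⟨rfl, rfl⟩)
      (tr_bobCorr_iff.2 ⟨x, y, z, _, _, rfl, rfl⟩)
  | @correct G As Gs hp hAs hB =>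
    cases hAs with
    | nil =>
      obtain ⟨L, rfl, hL⟩ := hB.restored (fun j k f hf => hf) (by simp)
      exact .inl ⟨L, hL, hB.layout, .inr hp⟩
    | @cons A g As' Gs' hA hAs =>
      refine .inr ⟨_, .gate (G := g)
        (P' := net .nil .nil .nil .nil (acts As' (out1 d.lift.lift.lift x))) ?_
        (hB.gate_owned (by simp))⟩
      rw [hp]
      exact (net_step_iff (rigid_gate _)).2
        (.inr (.inr (.inr (.inr ⟨_, (hA _ _ _ _).2 ⟨rfl, rfl⟩, rfl⟩))))

/-- The system between the input and the output of `x`. -/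
def Busy (σ : QState) (ω : Finset Qubit) (a d : Chan) (x : Qubit) (m : Mixed) : Prop :=
  Early σ ω a d (some x) m ∨ Mid σ ω d x m ∨ Late σ ω d x m

theorem busy_tau {s : Config} (h : Busy σ ω a d x m) (hs : Trans (.mix m) .tau s) :
    ∃ m', s = .mix m' ∧ Busy σ ω a d x m' := by
  rcases h with h | h | h
  · obtain ⟨m', rfl, h | ⟨x', hx, h⟩⟩ := early_tau h hs
    · exact ⟨m', rfl, .inl h⟩
    · cases hx
      exact ⟨m', rfl, .inr (.inl h)⟩
  · obtain ⟨m', rfl, h⟩ := mid_tau h hs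
    exact ⟨m', rfl, .inr h⟩
  · obtain ⟨m', rfl, h⟩ := late_tau h hs
    exact ⟨m', rfl, .inr (.inr h)⟩

theorem busy_progress (h : Busy σ ω a d x m) :
    OutputReady σ ω d x m ∨ ∃ s, Trans (.mix m) .tau s := by
  rcases h with h | h | h
  · exact .inr (early_some_progress h)
  · exact .inr (mid_progress h)
  · exact late_progress h

theorem early_none_tau {s : Config} (h : Early σ ω a d none m) (hs : Trans (.mix m) .tau s) :
    ∃ m', s = .mix m' ∧ Early σ ω a d none m' := by
  obtain ⟨m', rfl, h | ⟨x', hx, -⟩⟩ := early_tau h hs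
  · exact ⟨m', rfl, h⟩
  · cases hx

/-- No step at all is possible. -/
def Dead (P : Proc) : Prop := P = .nil ∨ P = net .nil .nil .nil .nil .nil

theorem Dead.not_tr {P X : Proc} (h : Dead P) {k : ℕ} {s : Step}
    (hs : s.Rigid ∨ s = .comm) : ¬ P.Tr k s X := by
  rcases h with rfl | rfl
  · exact tr_nil
  · intro h
    rcases hs with hs | rfl
    · simp [net_step_iff hs] at h
    · rcases net_comm_cases (a := .loc 0) (d := .loc 0) (wired_of_uses (uses_nil _ _)
        (uses_nil _ _) (uses_nil _ _) (uses_nil _ _) (uses_nil _ _) (.inl rfl)) h with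
        ⟨_, _, _, h, -⟩ | ⟨_, _, _, h, -⟩ | ⟨_, _, _, h, -⟩ | ⟨_, _, _, h, -⟩ <;>
      exact tr_nil h

theorem Dead.not_trans (h : Dead m.proc) {l : Label} {s : Config} : ¬ Trans (.mix m) l s := by
  intro hs
  cases hs with
  | comm h' => exact h.not_tr (.inr rfl) h'
  | gate h' => exact h.not_tr (.inl (rigid_gate _)) h'
  | meas h' => exact h.not_tr (.inl (rigid_meas _)) h'
  | alloc h' => exact h.not_tr (.inl (rigid_alloc _)) h'
  | inp h' => exact h.not_tr (.inl (rigid_recv_name _ _)) h'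
  | outOne h' => exact h.not_tr (.inl (rigid_send_name _ _)) h'
  | outMany h' => exact h.not_tr (.inl (rigid_send_name _ _)) h'

theorem OutputReady.tr_send {c : ℕ} {ms : List Value} {X : Proc} (h : OutputReady σ ω d x m)
    (hX : m.proc.Tr m.depth (.send (.name c) ms) X) :
    d = .name c ∧ ms = [.qubit x] ∧ Dead X := by
  obtain ⟨L, -, -, hp | hp⟩ := h
  · rw [hp, tr_out1_iff] at hX
    obtain ⟨h1, rfl⟩ := hX
    cases h1
    exact ⟨rfl, rfl, .inl rfl⟩
  · rw [hp, net_step_iff (rigid_send_name _ _)] at hX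
    simp only [tr_nil, false_and, exists_false, false_or, tr_out1_iff, Step.send.injEq] at hX
    obtain ⟨_, ⟨⟨h1, h2⟩, rfl⟩, rfl⟩ := hX
    simp only [Chan.name_eq_lift, Chan.lift_eq_name] at h1
    exact ⟨h1, h2, .inr rfl⟩

/-- The result of returning `x` to the environment. -/
noncomputable def outResult (m : Mixed) (x : Qubit) (X : Proc) : Mixed :=
  { m.cond (msgBits [.qubit x]) [] with owned := m.owned \ {x}, proc := X }

theorem msgBits_qubit (x : Qubit) (w : List Bool) : msgBits [.qubit x] w = [] := rfl

theorem image_msgBits (h : m.index.Nonempty) : m.index.image (msgBits [.qubit x]) = {[]} := by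
  ext v
  simp only [Finset.mem_image, msgBits_qubit, Finset.mem_singleton]
  constructor
  · rintro ⟨_, -, rfl⟩
    rfl
  · rintro rfl
    obtain ⟨w, hw⟩ := h
    exact ⟨w, hw, rfl⟩

/-- The message consists of a qubit only, so its classical part has the single value `[]` in all
components. This rules out `outMany`, and no distribution arises. -/
theorem OutputReady.out_cases {c : ℕ} {V : Finset (List Bool)} {qs : List Qubit} {s : Config}
    (h : OutputReady σ ω d x m) (hs : Trans (.mix m) (.out c V qs) s) :
    d = .name c ∧ V = {[]} ∧ qs = [x] ∧ ∃ X, Dead X ∧ s = .mix (outResult m x X) := by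
  have hne : m.index.Nonempty := by
    obtain ⟨L, hL, -⟩ := h
    exact hL.nonempty
  cases hs with
  | @outOne _ _ ms X v h' _ _ hV =>
    obtain ⟨h1, rfl, h2⟩ := h.tr_send h'
    rw [image_msgBits hne, Finset.singleton_inj] at hV
    subst hV
    refine ⟨h1, rfl, rfl, X, h2, ?_⟩
    simp [outResult, msgQubits]
  | outMany h' _ _ hV =>
    obtain ⟨h1, rfl, h2⟩ := h.tr_send h'
    rw [image_msgBits hne] at hV
    simp at hV

theorem OutputReady.exists_out {c : ℕ} (h : OutputReady σ ω (.name c) x m) :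
    ∃ X, Dead X ∧ Trans (.mix m) (.out c {[]} [x]) (.mix (outResult m x X)) := by
  obtain ⟨L, hL, hl, hp⟩ := h
  obtain ⟨X, hX, hd⟩ : ∃ X, m.proc.Tr m.depth (.send (.name c) [.qubit x]) X ∧ Dead X := by
    rcases hp with hp | hp
    · exact ⟨_, hp ▸ tr_out1_iff.2 ⟨rfl, rfl⟩, .inl rfl⟩
    · exact ⟨_, hp ▸ (net_step_iff (rigid_send_name _ _)).2
        (.inr (.inr (.inr (.inr ⟨_, tr_out1_iff.2 ⟨rfl, rfl⟩, rfl⟩)))), .inr rfl⟩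
  refine ⟨X, hd, ?_⟩
  have := Trans.outOne hX (by simp [msgQubits])
    (by simpa [msgQubits] using hl.base_subset_owned (by simp)) (image_msgBits hL.nonempty)
  simpa [outResult, msgQubits] using this

theorem OutputReady.density_eq (h : OutputReady σ ω d x m) (hx : x ∈ σ.qubits) :
    m.density [x] = (Mixed.pure σ ∅ .nil).density [x] := by
  obtain ⟨L, hL, -⟩ := h
  exact hL.density_eq (by simpa using hx)

/-- The ancillas remain owned and `x` is given back, so the environment is again the list of qubits
of `σ` outside `ω`, in the original order. The right-hand side does not depend on `m`, which makes
it a common value for the system and the identity. -/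
theorem OutputReady.envDensity_eq (h : OutputReady σ ω d x m) (hx : x ∈ σ.qubits) (hxω : x ∉ ω)
    (X : Proc) : (outResult m x X).envDensity =
      (Mixed.pure σ ∅ .nil).density (σ.qubits.filter fun q => q ∉ ω) := by
  obtain ⟨L, hL, hl, -⟩ := h
  have hR : Restored σ L (outResult m x X) :=
    (hL.cond (msgBits_qubit x)).update _ _
  have hxL := hl.notMem hx
  have hq : (outResult m x X).qubits.filter (fun q => q ∉ (outResult m x X).owned) =
      σ.qubits.filter fun q => q ∉ ω := by
    rw [hR.qubits, List.filter_append]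
    have h1 : L.filter (fun q => q ∉ (outResult m x X).owned) = [] := by
      rw [List.filter_eq_nil_iff]
      intro q hq
      have hqx : q ≠ x := by
        rintro rfl
        exact hxL (by simpa using hq)
      have : q ∈ m.owned := hl.subset_owned (by simpa using hq)
      simp [outResult, hqx, this]
    rw [h1, List.append_nil]
    refine List.filter_congr fun q hq => ?_
    have hqL := hl.notMem hq
    simp only [outResult, hl.owned, decide_eq_decide, Finset.mem_sdiff, Finset.mem_union,
      Finset.mem_singleton]
    by_cases hqx : q = x
    · subst hqx
      simp [hxω]
    · simp [hqx, hqL]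
  rw [Mixed.envDensity, hq]
  exact hR.density_eq fun q hq => (List.mem_filter.1 hq).1

end Progress

section Bisimulation

variable {σ : QState} {ω : Finset Qubit} {a d : Chan} {q : Option Qubit} {x : Qubit} {m n : Mixed}

/-! ## Input -/

theorem early_not_recv {a : Chan} {c : ℕ} {ms : List Value} {X : Proc} {k : ℕ}
    (h : Early σ ω a d (some x) m) : ¬ m.proc.Tr k (.recv (.name c) ms) X := by
  obtain ⟨A, N, E, R, Y, F, S, I, wt, n, ν, Φ, hp, hM, hN, hR, hD⟩ := h
  rw [hp, net_step_iff (rigid_recv_name _ _)]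
  rintro (⟨A', h, rfl⟩ | ⟨N', h, rfl⟩ | ⟨E', h, rfl⟩ | ⟨R', h, rfl⟩ | ⟨C', h, rfl⟩)
  · cases hM with
    | encode _ _ hAs => simp [tr_acts_iff hAs, tr_out3_iff] at h
    | sent => simp at h
  · exact hN.uses _ _ _ h
  · simpa [Step.Within] using hM.uses.2 _ _ _ h
  · simpa [Step.Within] using hR.uses _ _ _ h
  · simpa [Step.Within] using corr_uses d _ _ _ h

theorem early_not_send {c : ℕ} {ms : List Value} {X : Proc} {k : ℕ}
    (h : Early σ ω a d q m) : ¬ m.proc.Tr k (.send (.name c) ms) X := by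
  obtain ⟨A, N, E, R, Y, F, S, I, wt, n, ν, Φ, hp, hM, hN, hR, hD⟩ := h
  rw [hp, net_step_iff (rigid_send_name _ _)]
  rintro (⟨A', h, rfl⟩ | ⟨N', h, rfl⟩ | ⟨E', h, rfl⟩ | ⟨R', h, rfl⟩ | ⟨C', h, rfl⟩)
  · simpa [Step.Within] using hM.uses.1 _ _ _ h
  · simpa [Step.Within] using hN.uses _ _ _ h
  · simpa [Step.Within] using hM.uses.2 _ _ _ h
  · simpa [Step.Within] using hR.uses _ _ _ h
  · simp [tr_bobCorr_iff] at h

theorem mid_not_visible {s : Step} {k : ℕ} {X : Proc} (h : Mid σ ω d x m)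
    (hs : ∃ c ms, s = .send (.name c) ms ∨ s = .recv (.name c) ms) : ¬ m.proc.Tr k s X := by
  obtain ⟨y, z, u, v, R, S, As, Gs, hp, hyz, huv, hYF, hGS, hR, hAs, hB⟩ := h
  obtain ⟨c, ms, hs⟩ := hs
  have hs' : s.Rigid := by
    rcases hs with rfl | rfl
    exacts [rigid_send_name _ _, rigid_recv_name _ _]
  rw [hp, net_step_iff hs']
  simp only [tr_nil, false_and, exists_false, false_or]
  rintro (⟨E', h, rfl⟩ | ⟨R', h, rfl⟩ | ⟨C', h, rfl⟩)
  · rcases hs with rfl | rfl <;> simp [tr_acts_iff hAs, tr_out3_iff] at h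
  · have := hR.uses _ _ _ h
    rcases hs with rfl | rfl <;> simp [Step.Within] at this
  · rcases hs with rfl | rfl <;> simp [tr_bobCorr_iff] at h

theorem late_not_recv {c : ℕ} {ms : List Value} {k : ℕ} {X : Proc} (h : Late σ ω d x m) :
    ¬ m.proc.Tr k (.recv (.name c) ms) X := by
  intro hX
  cases h with
  | syndrome hp hn hAs hB =>
    rw [hp, net_step_iff (rigid_recv_name _ _)] at hX
    simp [tr_acts_iff hAs, tr_recMeas1_iff, tr_bobCorr_iff] at hX
  | measured hp hn hB =>
    rw [hp, net_step_iff (rigid_recv_name _ _)] at hX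
    simp [tr_recMeas2_iff, tr_bobCorr_iff] at hX
  | sending hp hn hB =>
    rw [hp, net_step_iff (rigid_recv_name _ _)] at hX
    simp [tr_recOut_iff, tr_bobCorr_iff] at hX
  | correct hp hAs hB =>
    rw [hp, net_step_iff (rigid_recv_name _ _)] at hX
    simp [tr_acts_iff hAs, tr_out1_iff] at hX

theorem late_send {c : ℕ} {ms : List Value} {k : ℕ} {X : Proc} (h : Late σ ω d x m)
    (hX : m.proc.Tr k (.send (.name c) ms) X) : OutputReady σ ω d x m := by
  cases h with
  | syndrome hp hn hAs hB =>
    rw [hp, net_step_iff (rigid_send_name _ _)] at hX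
    simp [tr_acts_iff hAs, tr_recMeas1_iff, tr_bobCorr_iff] at hX
  | measured hp hn hB =>
    rw [hp, net_step_iff (rigid_send_name _ _)] at hX
    simp [tr_recMeas2_iff, tr_bobCorr_iff] at hX
  | sending hp hn hB =>
    rw [hp, net_step_iff (rigid_send_name _ _)] at hX
    simp [tr_recOut_iff, tr_bobCorr_iff] at hX
  | correct hp hAs hB =>
    rw [hp, net_step_iff (rigid_send_name _ _)] at hX
    simp only [tr_nil, false_and, exists_false, false_or, tr_acts_iff hAs, reduceCtorEq, and_false,
      or_false] at hX
    obtain ⟨_, ⟨rfl, rfl, -⟩, -⟩ := hX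
    obtain ⟨L, rfl, hL⟩ := hB.restored (fun j k f hf => hf) (by simp)
    exact ⟨L, hL, hB.layout, .inr hp⟩

theorem busy_not_recv {c : ℕ} {ms : List Value} {X : Proc} {k : ℕ} (h : Busy σ ω a d x m) :
    ¬ m.proc.Tr k (.recv (.name c) ms) X := by
  rcases h with h | h | h
  · exact early_not_recv h
  · exact mid_not_visible h ⟨_, _, .inr rfl⟩
  · exact late_not_recv h

theorem busy_send {c : ℕ} {ms : List Value} {k : ℕ} {X : Proc} (h : Busy σ ω a d x m)
    (hX : m.proc.Tr k (.send (.name c) ms) X) : OutputReady σ ω d x m := by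
  rcases h with h | h | h
  · exact absurd hX (early_not_send h)
  · exact absurd hX (mid_not_visible h ⟨_, _, .inl rfl⟩)
  · exact late_send h hX

theorem map_toValue_eq_singleton {vs : List Datum} {x : Qubit}
    (h : vs.map Datum.toValue = [.qubit x]) : vs = [.qubit x] := by
  rcases vs with _ | ⟨_ | y, _ | ⟨_, _⟩⟩ <;> simp_all [Datum.toValue]

/-- All ancillas are owned, so the environment can supply only qubits of `σ`. -/
theorem mem_qubits_of_layout {G : Finset Qubit} (h : Layout σ ω m G) (hx : x ∈ m.qubits)
    (hx' : x ∉ m.owned) : x ∈ σ.qubits ∧ x ∉ ω := by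
  obtain ⟨L, h1, h2⟩ := h.qubits
  rw [h.owned, Finset.mem_union, not_or] at hx'
  rw [h1, List.mem_append] at hx
  exact ⟨hx.resolve_right fun h => hx'.2 (by rw [← h2]; simpa using h), hx'.1⟩

/-- The configurations after an input of `x`. -/
def afterInput (m : Mixed) (x : Qubit) (X : Proc) : Mixed :=
  { m with owned := m.owned ∪ {x}, proc := X }

/-- At this moment `x` becomes the core of the code: `σ` with the two fresh qubits is the code whose
ancilla bits vanish, and the pending encoding gates turn these bits into copies of the bit of `x`.
-/
theorem InputReady.early_of_input {y z : Qubit} {N E R : Proc} {F S : Finset Qubit}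
    {I : Finset (List Bool)} {wt : ℝ} {k : ℕ} {ν : List Bool → Ket} {Φ : Ket}
    (hM : EarlyMain σ a none (aliceIn a.lift.lift (.loc 1) y z) E {y, z} Φ)
    (hN : Rnd N F I wt k ν) (hR : Rec R S) (hD : EarlyData σ ω m {y, z} F S I wt k ν Φ)
    (hx : x ∈ σ.qubits) :
    Early σ ω a d (some x) (afterInput m x
      (net (acts (encodeActs x y z) (out3 (.loc 1) x y z)) N E R (corr d))) := by
  have hxY : x ∉ ({y, z} : Finset Qubit) :=
    Finset.disjoint_left.1 hD.disjoint_Y (by simpa using hx)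
  obtain ⟨hxy, hxz⟩ : x ≠ y ∧ x ≠ z := by simpa using hxY
  cases hM with
  | ready hyz =>
    have hΦ : σ.ket = code σ.ket x {y, z} false
        fun r b => if r ∈ ({y, z} : Finset Qubit) then false else b := by
      have := code_extend σ.isState (x := x) (G := ∅) (err := false) (f := fun _ b => b)
        (by simpa using hx) hD.disjoint_Y (by simp)
      rwa [code_empty, Finset.empty_union] at this
    refine ⟨_, _, _, _, _, _, _, _, _, _, _, _, rfl, .encode (err := false)
      (f := fun r b => if r ∈ ({y, z} : Finset Qubit) then false else b) hyz hx
      (encodeActs_isGate hxy hxz) ?_ ?_, hN, hR, ?_⟩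
    · simp only [encodeGates, List.mem_cons, List.not_mem_nil, or_false]
      rintro g (rfl | rfl)
      · exact ⟨z, by simp, rfl⟩
      · exact ⟨y, by simp, rfl⟩
    · rw [runAll_encode hxY (by simp) (by simp)]
      refine code_congr fun r hr b => ?_
      simp only [Finset.mem_insert, Finset.mem_singleton] at hr
      rcases hr with rfl | rfl
      · simp [hyz]
      · simp [hyz.symm]
    · rw [← hΦ]
      refine ⟨⟨hD.layout.qubits, hD.layout.disj, ?_⟩, hD.YF, hD.YS, hD.FS, hD.depth, hD.index,
        hD.weight, hD.ket⟩
      simp only [afterInput, hD.layout.owned, inputSet, Option.elim_some]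
      ext
      simp

theorem InputReady.of_recv {c : ℕ} {ms : List Value} {X : Proc} (h : Early σ ω a d none m)
    (hX : m.proc.Tr m.depth (.recv (.name c) ms) X) :
    a = .name c ∧ ∃ x, ms = [.qubit x] ∧
      (x ∈ σ.qubits → Early σ ω a d (some x) (afterInput m x X)) := by
  obtain ⟨A, N, E, R, Y, F, S, I, wt, n, ν, Φ, hp, hM, hN, hR, hD⟩ := h
  rw [hp, net_step_iff (rigid_recv_name _ _)] at hX
  rcases hX with ⟨A', h, rfl⟩ | ⟨N', h, rfl⟩ | ⟨E', h, rfl⟩ | ⟨R', h, rfl⟩ | ⟨C', h, rfl⟩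
  · cases hM with
    | start => simp [tr_alice_iff] at h
    | ready hyz =>
      rw [tr_aliceIn_iff] at h
      obtain ⟨x, h, rfl⟩ := h
      simp only [Step.recv.injEq, Chan.name_eq_lift, Chan.lift_eq_name] at h
      obtain ⟨rfl, rfl⟩ := h
      rw [inputSet, Option.elim_none, Finset.union_empty] at hD
      exact ⟨rfl, x, rfl, fun hx => InputReady.early_of_input (.ready hyz) hN hR hD hx⟩
  · exact (hN.uses _ _ _ h).elim
  · have := hM.uses.2 _ _ _ h
    simp [Step.Within] at this
  · have := hR.uses _ _ _ h
    simp [Step.Within] at this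
  · have := corr_uses d _ _ _ h
    simp [Step.Within] at this

/-! ## The bisimulation -/

/-- The classes of configurations. -/
inductive Phase
  | initial
  | got (x : Qubit)
  | final

/-- The configurations of the system and of the identity in a given phase. -/
def InPhase (σ : QState) (ω : Finset Qubit) (a d : Chan) : Phase → Mixed → Prop
  | .initial, m => m = .pure σ ω (Identity a d) ∨ Early σ ω a d none m
  | .got x, m => (x ∈ σ.qubits ∧ x ∉ ω) ∧
      ((m.proc = out1 d x ∧ OutputReady σ ω d x m) ∨ Busy σ ω a d x m)
  | .final, m => Dead m.proc

/-- Bob's last thread is the last to terminate, so it alone shows that the system has not finished.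
-/
theorem net_not_dead {A N E R C : Proc} (hC : C ≠ .nil) : ¬ Dead (net A N E R C) := by
  rintro (h | h)
  · cases h
  · simp only [net, Proc.new.injEq, Proc.par.injEq] at h
    exact hC h.2.2

theorem early_inv (h : Early σ ω a d q m) :
    ¬ Dead m.proc ∧ ∃ G, Layout σ (ω ∪ inputSet q) m G := by
  obtain ⟨A, N, E, R, Y, F, S, I, wt, n, ν, Φ, hp, hM, hN, hR, hD⟩ := h
  exact ⟨hp ▸ net_not_dead (by simp [BobCorr]), _, hD.layout⟩

theorem busy_inv (h : Busy σ ω a d x m) : ¬ Dead m.proc ∧ ∃ G, Layout σ (ω ∪ {x}) m G := by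
  rcases h with h | h | h
  · exact early_inv h
  · obtain ⟨y, z, u, v, R, S, As, Gs, hp, hyz, huv, hYF, hGS, hR, hAs, hB⟩ := h
    exact ⟨hp ▸ net_not_dead (by simp [BobCorr]), _, hB.layout⟩
  · cases h with
    | syndrome hp hn hAs hB => exact ⟨hp ▸ net_not_dead (by simp [BobCorr]), _, hB.layout⟩
    | measured hp hn hB => exact ⟨hp ▸ net_not_dead (by simp [BobCorr]), _, hB.layout⟩
    | sending hp hn hB => exact ⟨hp ▸ net_not_dead (by simp [BobCorr]), _, hB.layout⟩
    | @correct G As _ hp hAs hB =>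
      exact ⟨hp ▸ net_not_dead (by cases As <;> simp [acts, out1]), _, hB.layout⟩

theorem layout_pure (P : Proc) : Layout σ ω (.pure σ ω P) ∅ :=
  ⟨⟨[], by simp [Mixed.pure], rfl⟩, by simp, by simp [Mixed.pure]⟩

theorem initial_inv (h : InPhase σ ω a d .initial m) :
    ¬ Dead m.proc ∧ ∃ G, Layout σ ω m G := by
  rcases h with rfl | h
  · refine ⟨?_, _, layout_pure _⟩
    rintro (h | h) <;> cases h
  · obtain ⟨h1, G, h2⟩ := early_inv h
    rw [inputSet, Option.elim_none, Finset.union_empty] at h2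
    exact ⟨h1, G, h2⟩

theorem got_inv (h : InPhase σ ω a d (.got x) m) :
    ¬ Dead m.proc ∧ ∃ G, Layout σ (ω ∪ {x}) m G := by
  obtain ⟨-, ⟨hp, L, -, hl, -⟩ | h⟩ := h
  · refine ⟨?_, _, hl⟩
    rw [hp]
    rintro (h | h) <;> cases h
  · exact busy_inv h

theorem Layout.unique {ω ω' G G' : Finset Qubit} (h : Layout σ ω m G) (h' : Layout σ ω' m G')
    (hx : x ∈ σ.qubits) : x ∈ ω ↔ x ∈ ω' := by
  have h1 : x ∈ m.owned ↔ x ∈ ω := by simp [h.owned, h.notMem hx]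
  have h2 : x ∈ m.owned ↔ x ∈ ω' := by simp [h'.owned, h'.notMem hx]
  exact h1.symm.trans h2

/-- The phase can be read off a configuration. The owned qubits among those of `σ` are `ω` before
the input and `ω ∪ {x}` with `x ∉ ω` after it, and only finished terms are dead. This is what makes
`SamePhase` transitive. -/
theorem phase_unique {p p' : Phase} (h : InPhase σ ω a d p m) (h' : InPhase σ ω a d p' m) :
    p = p' := by
  have key : ∀ {x}, InPhase σ ω a d .initial m → ¬ InPhase σ ω a d (.got x) m := by
    intro x h h'
    obtain ⟨-, G, hG⟩ := initial_inv h
    obtain ⟨-, G', hG'⟩ := got_inv h'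
    exact h'.1.2 ((hG.unique hG' h'.1.1).2 (by simp))
  match p, p' with
  | .initial, .initial => rfl
  | .initial, .got x => exact absurd h' (key h)
  | .initial, .final => exact absurd h' (initial_inv h).1
  | .got x, .initial => exact absurd h (key h')
  | .got x, .got x' =>
    obtain ⟨-, G, hG⟩ := got_inv h
    obtain ⟨-, G', hG'⟩ := got_inv h'
    have := (hG.unique hG' h.1.1).1 (by simp)
    rw [Finset.mem_union, Finset.mem_singleton] at this
    rw [this.resolve_left h.1.2]
  | .got x, .final => exact absurd h' (got_inv h).1
  | .final, .initial => exact absurd h (initial_inv h').1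
  | .final, .got x => exact absurd h (got_inv h').1
  | .final, .final => rfl

theorem phase_tau {p : Phase} {s : Config} (h : InPhase σ ω a d p m)
    (hs : Trans (.mix m) .tau s) : ∃ m', s = .mix m' ∧ InPhase σ ω a d p m' := by
  match p with
  | .initial =>
    rcases h with rfl | h
    · cases hs with
      | comm h => simp [Mixed.pure, tr_identity_iff] at h
      | gate h => simp [Mixed.pure, tr_identity_iff] at h
      | meas h => simp [Mixed.pure, tr_identity_iff] at h
      | alloc h => simp [Mixed.pure, tr_identity_iff] at h
    · obtain ⟨m', rfl, h⟩ := early_none_tau h hs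
      exact ⟨m', rfl, .inr h⟩
  | .got x =>
    obtain ⟨hx, ⟨hp, h⟩ | h⟩ := h
    · cases hs with
      | comm h => simp [hp, tr_out1_iff] at h
      | gate h => simp [hp, tr_out1_iff] at h
      | meas h => simp [hp, tr_out1_iff] at h
      | alloc h => simp [hp, tr_out1_iff] at h
    · obtain ⟨m', rfl, h⟩ := busy_tau h hs
      exact ⟨m', rfl, hx, .inr h⟩
  | .final => exact absurd hs h.not_trans

theorem phase_out {p : Phase} {c : ℕ} {V : Finset (List Bool)} {qs : List Qubit} {s : Config}
    (h : InPhase σ ω a d p m) (hs : Trans (.mix m) (.out c V qs) s) :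
    ∃ x, p = .got x ∧ OutputReady σ ω d x m := by
  have hsend : ∃ ms X, m.proc.Tr m.depth (.send (.name c) ms) X := by
    cases hs with
    | outOne h => exact ⟨_, _, h⟩
    | outMany h => exact ⟨_, _, h⟩
  obtain ⟨ms, X, hX⟩ := hsend
  match p with
  | .initial =>
    rcases h with rfl | h
    · simp [Mixed.pure, tr_identity_iff] at hX
    · exact absurd hX (early_not_send h)
  | .got x =>
    obtain ⟨hx, ⟨hp, h⟩ | h⟩ := h
    · exact ⟨x, rfl, h⟩
    · exact ⟨x, rfl, busy_send h hX⟩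
  | .final => exact absurd hs h.not_trans

/-- The run stays within the phase, as branching bisimilarity demands of the configuration from
which the output is made. -/
theorem got_exists_weak (h : InPhase σ ω a d (.got x) m) :
    ∃ m', Weak (.mix m) (.mix m') ∧ InPhase σ ω a d (.got x) m' ∧ OutputReady σ ω d x m' := by
  obtain ⟨hx, ⟨hp, h⟩ | h⟩ := h
  · exact ⟨m, .refl, ⟨hx, .inl ⟨hp, h⟩⟩, h⟩
  · obtain ⟨m', h1, h2, h3⟩ := exists_weak (K := Busy σ ω a d x) (fun m s hm hs => busy_tau hm hs)
      (fun m hm => busy_progress hm) h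
    exact ⟨m', h1, ⟨hx, .inr h2⟩, h3⟩

theorem phase_inp {p : Phase} {c : ℕ} {vs : List Datum} {s : Config}
    (h : InPhase σ ω a d p m) (hs : Trans (.mix m) (.inp c vs) s) :
    p = .initial ∧ a = .name c ∧ ∃ x, vs = [.qubit x] ∧ x ∈ σ.qubits ∧ x ∉ ω ∧
      ∃ m', s = .mix m' ∧ InPhase σ ω a d (.got x) m' := by
  cases hs with
  | @inp _ _ _ X hX hnodup henv =>
    match p with
    | .initial =>
      refine ⟨rfl, ?_⟩
      obtain ⟨-, G, hl⟩ := initial_inv h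
      rcases h with rfl | h
      · rw [show (Mixed.pure σ ω (Identity a d)).proc = Identity a d from rfl,
          tr_identity_iff] at hX
        obtain ⟨x, hX, rfl⟩ := hX
        simp only [Step.recv.injEq] at hX
        obtain ⟨rfl, hX⟩ := hX
        rw [hX] at henv
        obtain rfl := map_toValue_eq_singleton hX
        obtain ⟨hx, hxω⟩ := mem_qubits_of_layout hl (henv x (by simp [msgQubits])).1
          (henv x (by simp [msgQubits])).2
        -- The identity has no ancillas and never touches the state, so it is ready for output at
        -- once, with an empty list of ancillas.
        refine ⟨rfl, x, rfl, hx, hxω, _, rfl, ⟨hx, hxω⟩, .inl ⟨rfl, [], ?_, ?_, .inl rfl⟩⟩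
        · exact (restored_pure σ ω _).update _ _
        · exact ⟨⟨[], by simp [Mixed.pure], rfl⟩, by simp, by
            simp [Mixed.pure, msgQubits, Datum.toValue]⟩
      · obtain ⟨ha, x, hms, hE⟩ := InputReady.of_recv h hX
        rw [hms] at henv
        obtain rfl := map_toValue_eq_singleton hms
        obtain ⟨hx, hxω⟩ := mem_qubits_of_layout hl (henv x (by simp [msgQubits])).1
          (henv x (by simp [msgQubits])).2
        refine ⟨ha, x, rfl, hx, hxω, _, rfl, ⟨hx, hxω⟩, .inr (.inl ?_)⟩
        simpa [afterInput, msgQubits, Datum.toValue] using hE hx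
    | .got x =>
      obtain ⟨hx, ⟨hp, h⟩ | h⟩ := h
      · simp [hp, tr_out1_iff] at hX
      · exact absurd hX (busy_not_recv h)
    | .final => exact absurd hX (h.not_tr (.inl (rigid_recv_name _ _)))

theorem initial_exists_input {c : ℕ} (h : InPhase σ ω (.name c) d .initial m) (hx : x ∈ σ.qubits)
    (hxω : x ∉ ω) : ∃ m' s, Weak (.mix m) (.mix m') ∧ InPhase σ ω (.name c) d .initial m' ∧
      Trans (.mix m') (.inp c [.qubit x]) s := by
  have key : ∀ {m G}, Layout σ ω m G →
      (∃ X, m.proc.Tr m.depth (.recv (.name c) ([Datum.qubit x].map Datum.toValue)) X) →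
      ∃ s, Trans (.mix m) (.inp c [.qubit x]) s := by
    rintro m G hl ⟨X, hX⟩
    refine ⟨_, .inp hX (by simp [msgQubits, Datum.toValue]) ?_⟩
    simp only [List.map_cons, List.map_nil, Datum.toValue, msgQubits, List.filterMap_cons,
      List.filterMap_nil, List.mem_singleton]
    rintro q rfl
    obtain ⟨L, h1, -⟩ := hl.qubits
    refine ⟨?_, ?_⟩
    · rw [h1]
      exact List.mem_append_left _ hx
    · simp [hl.owned, hxω, hl.notMem hx]
  rcases h with rfl | h
  · obtain ⟨s, hs⟩ := key (layout_pure (Identity (.name c) d)) ⟨_, tr_identity_iff.2 ⟨x, rfl, rfl⟩⟩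
    exact ⟨_, s, .refl, .inl rfl, hs⟩
  · obtain ⟨m', h1, h2, h3⟩ := exists_weak (K := Early σ ω (.name c) d none)
      (fun m s hm hs => early_none_tau hm hs) (fun m hm => early_none_progress hm) h
    obtain ⟨N, E, R, y, z, F, S, I, wt, n, ν, Φ, hp, -, -, -, hD⟩ := h3
    obtain ⟨s, hs⟩ := key hD.layout ⟨_, hp ▸ (net_step_iff (rigid_recv_name _ _)).2
      (.inl ⟨_, tr_aliceIn_iff.2 ⟨x, rfl, rfl⟩, rfl⟩)⟩
    exact ⟨m', s, h1, .inr h2, hs⟩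

/-- Equality, or being in the same phase. -/
def SamePhase (σ : QState) (ω : Finset Qubit) (a d : Chan) (s t : Config) : Prop :=
  s = t ∨ ∃ p m n, s = .mix m ∧ t = .mix n ∧ InPhase σ ω a d p m ∧ InPhase σ ω a d p n

theorem samePhase_equivalence : Equivalence (SamePhase σ ω a d) where
  refl _ := .inl rfl
  symm := by
    rintro s t (rfl | ⟨p, m, n, rfl, rfl, h1, h2⟩)
    · exact .inl rfl
    · exact .inr ⟨p, n, m, rfl, rfl, h2, h1⟩
  trans := by
    rintro s t u (rfl | ⟨p, m, n, rfl, rfl, h1, h2⟩) h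
    · exact h
    · rcases h with rfl | ⟨p', m', n', h, rfl, h3, h4⟩
      · exact .inr ⟨p, m, n, rfl, rfl, h1, h2⟩
      · cases h
        obtain rfl := phase_unique h2 h3
        exact .inr ⟨p, m, n', rfl, rfl, h1, h4⟩

/-- On equal configurations all clauses hold by repeating the transition. On two mixtures in the
same phase they follow from the analysis of the phases; the phase itself says nothing about
densities, which are compared only when the qubit is returned. -/
theorem samePhase_isBisimulation : IsBisimulation (SamePhase σ ω a d) where
  equiv := samePhase_equivalence
  tau := by
    rintro s t (rfl | ⟨p, m, n, rfl, rfl, h1, h2⟩) s' - hs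
    · exact ⟨s, s', .refl, .inr hs, .inl rfl, .inl rfl⟩
    · obtain ⟨m', rfl, h⟩ := phase_tau h1 hs
      -- The answering side does not move, since the phase has not changed.
      exact ⟨_, _, .refl, .inl rfl, .inr ⟨p, m, n, rfl, rfl, h1, h2⟩,
        .inr ⟨p, m', n, rfl, rfl, h, h2⟩⟩
  out := by
    rintro s t (rfl | ⟨p, m, n, rfl, rfl, h1, h2⟩) c V qs s' hs
    · exact ⟨s, s', qs, .refl, hs, .inl rfl, rfl, fun v _ => ⟨rfl, rfl, .inl rfl⟩⟩
    · obtain ⟨x, rfl, hm⟩ := phase_out h1 hs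
      obtain ⟨rfl, rfl, rfl, X, hX, rfl⟩ := hm.out_cases hs
      obtain ⟨n', hw, h3, hn⟩ := got_exists_weak h2
      obtain ⟨X', hX', hout⟩ := hn.exists_out
      have hx := h1.1
      refine ⟨_, _, [x], hw, hout, .inr ⟨_, _, _, rfl, rfl, h1, h3⟩, ?_, fun v _ => ⟨rfl, ?_, ?_⟩⟩
      · exact (hm.density_eq hx.1).trans (hn.density_eq hx.1).symm
      · exact (hm.envDensity_eq hx.1 hx.2 X).trans (hn.envDensity_eq hx.1 hx.2 X').symm
      · exact .inr ⟨.final, _, _, rfl, rfl, hX, hX'⟩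
  inp := by
    rintro s t (rfl | ⟨p, m, n, rfl, rfl, h1, h2⟩) c vs s' hs
    · exact ⟨s, s', .refl, hs, .inl rfl, .inl rfl⟩
    · obtain ⟨rfl, rfl, x, rfl, hx, hxω, m', rfl, hm'⟩ := phase_inp h1 hs
      obtain ⟨n', t'', hw, h3, ht⟩ := initial_exists_input h2 hx hxω
      -- The analysis of inputs applies to the answering side as well and puts its successor into
      -- the same phase.
      obtain ⟨-, -, x', hxx', -, -, n'', rfl, hn''⟩ := phase_inp h3 ht
      cases hxx'
      exact ⟨_, _, hw, ht, .inr ⟨_, _, _, rfl, rfl, h1, h3⟩, .inr ⟨_, _, _, rfl, rfl, hm', hn''⟩⟩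
  prob := by
    rintro s t (rfl | ⟨p, m, n, rfl, rfl, h1, h2⟩) hs u
    · rfl
    -- A mixture has no probabilistic transitions, so this case is void.
    · obtain ⟨π, -, -, t, ht⟩ := hs
      cases ht

theorem early_pure : Early σ ω a d none (.pure σ ω (QECC a d)) := by
  refine ⟨_, _, _, _, _, _, _, _, _, _, _, _, qecc_eq_net a d, .start, .start, .start, ?_⟩
  refine ⟨?_, by simp, by simp, by simp, rfl, rfl, ?_, ?_⟩
  · have := layout_pure (σ := σ) (ω := ω) (QECC a d)
    simpa [inputSet] using this
  · simp [Mixed.pure]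
  · simp [Mixed.pure, tens_empty]

end Bisimulation

/-! ## The system and the identity -/

/-- All data variables are bound, so a substitution can act only on the two channels; it commutes
with lifting by `Chan.subst_lift`. -/
theorem qecc_apply (a d : Chan) (κ : Subst) :
    (QECC a d).apply κ = QECC (a.subst κ.chan) (d.subst κ.chan) := by
  simp only [Proc.apply, QECC, Alice, Noise, NoiseRnd, NoiseErr, Bob, BobRec, BobCorr, flips,
    Proc.subst, Chan.subst_lift]
  rfl

theorem identity_apply (a d : Chan) (κ : Subst) :
    (Identity a d).apply κ = Identity (a.subst κ.chan) (d.subst κ.chan) := by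
  simp only [Proc.apply, Identity, Proc.subst]
  rfl

end CQP

theorem mainTheorem2 (a d : CQP.Chan) :
    CQP.FullBisimilar (CQP.QECC a d) (CQP.Identity a d) := by
  intro κ σ ω _
  rw [CQP.qecc_apply, CQP.identity_apply]
  exact ⟨_, CQP.samePhase_isBisimulation,
    .inr ⟨.initial, _, _, rfl, rfl, .inr CQP.early_pure, .inl rfl⟩⟩
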